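/- Let $\mathbb S^2=\{\xi\in\mathbb R^3:\|\xi\|=1\}$ with spherical coordinates $\Phi(\varphi,\vartheta)=(\cos\varphi\sin\vartheta,\sin\varphi\sin\vartheta,\cos\vartheta)$ and surface measure $\sin\vartheta\,d\varphi\,d\vartheta$ on $[0,2\pi]\times[0,\pi]$. Let $SO(3)$ carry the invariant measure $\sin\beta\,d\alpha\,d\beta\,d\gamma$ on $[0,2\pi]\times[0,\pi]\times[0,2\pi]$ (of total mass $8\pi^2$) in the Euler angles $\Psi(\alpha,\beta,\gamma)=R_3(\alpha)R_2(\beta)R_3(\gamma)$, where $$R_3(\alpha)=\begin{pmatrix}\cos\alpha&-\sin\alpha&0\\ \sin\alpha&\cos\alpha&0\\0&0&1\end{pmatrix},\qquad R_2(\beta)=\begin{pmatrix}\cos\beta&0&\sin\beta\\0&1&0\\-\sin\beta&0&\cos\beta\end{pmatrix}.$$ The normalized semicircle transform of $f\colon\mathbb S^2\to\mathbb C$ is $$\mathcal Wf(Q)=\frac1{4\pi}\int_0^\pi f\bigl(Q\,\Phi(0,\vartheta)\bigr)\sin\vartheta\,d\vartheta,\qquad Q\in SO(3).$$ For $n\in\mathbb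 N_0$ and integers $k,j\in\{-n,\dots,n\}$ let $$Y_n^k(\Phi(\varphi,\vartheta))=\sqrt{\tfrac{2n+1}{4\pi}\tfrac{(n-k)!}{(n+k)!}}\,P_n^k(\cos\vartheta)\,e^{ik\varphi}$$ be the spherical harmonics, where $P_n^k(t)=\frac{(-1)^k}{2^nn!}(1-t^2)^{k/2}\frac{d^{n+k}}{dt^{n+k}}(t^2-1)^n$ for $k\ge0$ and $P_n^{-k}=(-1)^k\frac{(n-k)!}{(n+k)!}P_n^k$. Let $$D_n^{k,j}(\Psi(\alpha,\beta,\gamma))=e^{-ik\alpha}\,d_n^{k,j}(\cos\beta)\,e^{-ij\gamma}$$ be the Wigner D-functions, where $$d_n^{k,j}(t)=\frac{(-1)^{n-j}}{2^n}\sqrt{\frac{(n+k)!\,(1-t)^{j-k}}{(n-j)!\,(n+j)!\,(n-k)!\,(1+t)^{j+k}}}\;\frac{d^{n-k}}{dt^{n-k}}\Bigl[(1+t)^{n+j}(1-t)^{n-j}\Bigr]$$ for $-1<t<1$, extended continuously to $t=\pm1$. With the convention $(-1)!!=0!!=1$, put $\lambda_0^0=2(4\pi)^{-3/2}$ and, for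 $n\ge1$ and $j\in\{1,\dots,n\}$ with $n+j$ even, $$\lambda_n^j=\frac{(-1)^j}{4\pi}\sqrt{\tfrac{2n+1}{4\pi}\tfrac{(n-j)!}{(n+j)!}}\;\frac{j\,(n-2)!!\,(n+j-1)!!}{(n-j)!!\,(n+1)!!}\cdot\begin{cases}2,&n\text{ even},\\ \pi,&n\text{ odd},\end{cases}\qquad \lambda_n^{-j}=(-1)^j\lambda_n^j,$$ and $\lambda_n^j=0$ in all other cases. **Theorem.** $\mathcal W$ defines a bounded linear operator $L^2(\mathbb S^2)\to L^2(SO(3))$: for every $f\in L^2(\mathbb S^2)$ the integral defining $\mathcal Wf(Q)$ converges absolutely for almost every $Q$, and the function $\mathcal Wf$ so obtained represents the image of $f$. This operator has the following singular value decomposition. The functions $Y_n^k$ ($n\in\mathbb N_0$, $-n\le k\le n$) form an orthonormal basis of $L^2(\mathbb S^2)$. The number $\mathrm w_n:=\|\mathcal WY_n^k\|_{L^2(SO(3))}$ does not depend on $k\in\{-n,\dots,n\}$. The functions $$Z_n^k:=\mathrm w_n^{-1}\sum_{j=-n}^n\lambda_n^j\,\overline{D_n^{k,j}},\qquad n\in\mathbb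 N_0,\ -n\le k\le n,$$ are orthonormal in $L^2(SO(3))$. For all $n\in\mathbb N_0$ and $-n\le k\le n$, $$\mathcal WY_n^k=\mathrm w_n Z_n^k,$$ both in $L^2(SO(3))$ and at every point of $SO(3)$. Moreover, there are constants $C_1,C_2>0$ such that $$C_1(n+1)^{-1/2}\le \mathrm w_n\le C_2(n+1)^{-1/2}\qquad\text{for all } n\in\mathbb N_0.$$ -/

import Mathlib

open MeasureTheory

namespace SemicircleTransform

noncomputable section

/-! ### The sphere -/

/-- The two-dimensional unit sphere in `ℝ³`. -/
abbrev S2 : Type := Metric.sphere (0 : EuclideanSpace ℝ (Fin 3)) 1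

/-- Spherical coordinates with azimuth `φ` and zenith `ϑ`. -/
def sph (φ ϑ : ℝ) : S2 :=
  ⟨!₂[Real.cos φ * Real.sin ϑ, Real.sin φ * Real.sin ϑ, Real.cos ϑ], by
    rw [mem_sphere_zero_iff_norm, EuclideanSpace.norm_eq, Real.sqrt_eq_one]
    simp only [Real.norm_eq_abs, sq_abs, Fin.sum_univ_three, Matrix.cons_val]
    linear_combination Real.sin ϑ ^ 2 * Real.sin_sq_add_cos_sq φ + Real.sin_sq_add_cos_sq ϑ⟩

theorem continuous_sph : Continuous fun p : ℝ × ℝ => sph p.1 p.2 := by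
  refine Continuous.subtype_mk ((PiLp.continuous_toLp 2 _).comp (continuous_pi fun i => ?_)) _
  fin_cases i <;> simp <;> fun_prop

/-- The azimuth angle (a representative in `(-π, π]`, equal to `0` at the two poles). -/
def azi (ξ : S2) : ℝ := Complex.arg (Complex.mk (ξ.1 0) (ξ.1 1))

/-- The zenith angle, in `[0, π]`. -/
def zen (ξ : S2) : ℝ := Real.arccos (ξ.1 2)

/-- The surface measure on the sphere: the image of `sin ϑ dφ dϑ` on `[0, 2π] × [0, π]` under
spherical coordinates. -/
def sphereMeasure : Measure S2 :=
  (((volume : Measure (ℝ × ℝ)).restrict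
      (Set.Icc 0 (2 * Real.pi) ×ˢ Set.Icc 0 Real.pi)).withDensity
    (fun p => ENNReal.ofReal (Real.sin p.2))).map (fun p => sph p.1 p.2)

/-! ### The rotation group -/

/-- The rotation group of `ℝ³`. -/
abbrev SO3 : Type := Matrix.specialOrthogonalGroup (Fin 3) ℝ

instance : MeasurableSpace SO3 := borel SO3

instance : BorelSpace SO3 := ⟨rfl⟩

/-- Rotation about the third axis. -/
def R3 (α : ℝ) : SO3 :=
  ⟨!![Real.cos α, -Real.sin α, 0; Real.sin α, Real.cos α, 0; 0, 0, 1], by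
    have h := Real.sin_sq_add_cos_sq α
    rw [Matrix.mem_specialOrthogonalGroup_iff, Matrix.mem_orthogonalGroup_iff]
    constructor
    · ext i j
      fin_cases i <;> fin_cases j <;>
        simp [Matrix.mul_apply, Fin.sum_univ_three] <;>
        linarith
    · simp [Matrix.det_fin_three]
      linarith⟩

/-- Rotation about the second axis. -/
def R2 (β : ℝ) : SO3 :=
  ⟨!![Real.cos β, 0, Real.sin β; 0, 1, 0; -Real.sin β, 0, Real.cos β], by
    have h := Real.sin_sq_add_cos_sq β
    rw [Matrix.mem_specialOrthogonalGroup_iff, Matrix.mem_orthogonalGroup_iff]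
    constructor
    · ext i j
      fin_cases i <;> fin_cases j <;>
        simp [Matrix.mul_apply, Fin.sum_univ_three] <;>
        linarith
    · simp [Matrix.det_fin_three]
      linarith⟩

/-- The Euler angle parameterization of the rotation group. -/
def eul (α β γ : ℝ) : SO3 := R3 α * R2 β * R3 γ

theorem continuous_eul : Continuous fun p : ℝ × ℝ × ℝ => eul p.1 p.2.1 p.2.2 := by
  have h3 : Continuous R3 := by
    refine Continuous.subtype_mk (continuous_matrix fun i j => ?_) _
    fin_cases i <;> fin_cases j <;> simp <;> fun_prop
  have h2 : Continuous R2 := by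
    refine Continuous.subtype_mk (continuous_matrix fun i j => ?_) _
    fin_cases i <;> fin_cases j <;> simp <;> fun_prop
  exact ((h3.comp continuous_fst).mul (h2.comp (continuous_fst.comp continuous_snd))).mul
    (h3.comp (continuous_snd.comp continuous_snd))

/-- The action of a rotation on a point of the sphere. -/
def rotate (Q : SO3) (ξ : S2) : S2 :=
  ⟨WithLp.toLp 2 (Q.1.mulVec ξ.1.ofLp), by
    have hQ : Q.1.transpose * Q.1 = 1 :=
      (Matrix.mem_orthogonalGroup_iff' (Fin 3) ℝ).1
        (Matrix.mem_specialOrthogonalGroup_iff.1 Q.2).1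
    have hξ : ‖ξ.1‖ = 1 := mem_sphere_zero_iff_norm.1 ξ.2
    have key : dotProduct (Q.1.mulVec ξ.1.ofLp) (Q.1.mulVec ξ.1.ofLp)
        = dotProduct ξ.1.ofLp ξ.1.ofLp := by
      rw [Matrix.dotProduct_mulVec, ← Matrix.mulVec_transpose, Matrix.mulVec_mulVec, hQ,
        Matrix.one_mulVec]
    rw [EuclideanSpace.norm_eq, Real.sqrt_eq_one] at hξ
    rw [mem_sphere_zero_iff_norm, EuclideanSpace.norm_eq, Real.sqrt_eq_one]
    refine Eq.trans ?_ hξ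
    simpa [dotProduct, pow_two] using key⟩

/-- The rotationally invariant measure on the rotation group (of total mass `8π²`): the image of
`sin β dα dβ dγ` on `[0, 2π] × [0, π] × [0, 2π]` under the Euler angle parameterization. -/
def rotationMeasure : Measure SO3 :=
  (((volume : Measure (ℝ × ℝ × ℝ)).restrict
      (Set.Icc 0 (2 * Real.pi) ×ˢ Set.Icc 0 Real.pi ×ˢ Set.Icc 0 (2 * Real.pi))).withDensity
    (fun p => ENNReal.ofReal (Real.sin p.2.1))).map (fun p => eul p.1 p.2.1 p.2.2)

/-! Euler angles of a rotation `Q`: `sph α β` is the image of the north pole `e³` under `Q`, and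
`γ` is the azimuth of the image of `e¹` under `(eul α β 0)⁻¹ Q`, which is a rotation about the
third axis. -/

/-- First Euler angle. -/
def eulerAlpha (Q : SO3) : ℝ := azi (rotate Q (sph 0 0))

/-- Second Euler angle. -/
def eulerBeta (Q : SO3) : ℝ := zen (rotate Q (sph 0 0))

/-- Third Euler angle. -/
def eulerGamma (Q : SO3) : ℝ :=
  azi (rotate ((eul (eulerAlpha Q) (eulerBeta Q) 0)⁻¹ * Q) (sph 0 (Real.pi / 2)))

theorem sph_azi_zen (ξ : S2) : sph (azi ξ) (zen ξ) = ξ := by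
  have hξ : ‖ξ.1‖ = 1 := mem_sphere_zero_iff_norm.1 ξ.2
  rw [EuclideanSpace.norm_eq, Real.sqrt_eq_one] at hξ
  simp only [Real.norm_eq_abs, sq_abs, Fin.sum_univ_three] at hξ
  have hs : Real.sin (zen ξ) = ‖Complex.mk (ξ.1 0) (ξ.1 1)‖ := by
    rw [zen, Real.sin_arccos, Complex.norm_def, Complex.normSq_mk]
    congr 1
    linarith
  have hc : Real.cos (zen ξ) = ξ.1 2 :=
    Real.cos_arccos (by nlinarith [sq_nonneg (ξ.1 0), sq_nonneg (ξ.1 1)])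
      (by nlinarith [sq_nonneg (ξ.1 0), sq_nonneg (ξ.1 1)])
  have h0 := Complex.norm_mul_cos_arg (Complex.mk (ξ.1 0) (ξ.1 1))
  have h1 := Complex.norm_mul_sin_arg (Complex.mk (ξ.1 0) (ξ.1 1))
  ext i
  fin_cases i
  · simp [sph, hs, azi]
    linarith
  · simp [sph, hs, azi]
    linarith
  · simpa [sph] using hc

theorem rotate_mul (P Q : SO3) (ξ : S2) : rotate (P * Q) ξ = rotate P (rotate Q ξ) := by
  apply Subtype.ext
  simp [rotate, Matrix.mulVec_mulVec]

theorem rotate_eul (α β : ℝ) : rotate (eul α β 0) (sph 0 0) = sph α β := by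
  apply Subtype.ext
  ext i
  fin_cases i <;>
    simp [rotate, eul, R3, R2, sph, Matrix.mulVec, dotProduct, Matrix.mul_apply,
      Fin.sum_univ_three]

theorem eq_R3_of_fixes (P : SO3) (h : rotate P (sph 0 0) = sph 0 0) :
    P = R3 (azi (rotate P (sph 0 (Real.pi / 2)))) := by
  have hc : ∀ i, P.1 i 2 = (sph 0 0).1 i := by
    intro i
    rw [← h]
    simp [rotate, sph, Matrix.mulVec, dotProduct, Fin.sum_univ_three]
  have h02 : P.1 0 2 = 0 := by simpa [sph] using hc 0
  have h12 : P.1 1 2 = 0 := by simpa [sph] using hc 1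
  have h22 : P.1 2 2 = 1 := by simpa [sph] using hc 2
  have hP := Matrix.mem_specialOrthogonalGroup_iff.1 P.2
  have hT : P.1.transpose * P.1 = 1 := (Matrix.mem_orthogonalGroup_iff' (Fin 3) ℝ).1 hP.1
  have hT' : P.1 * P.1.transpose = 1 := (Matrix.mem_orthogonalGroup_iff (Fin 3) ℝ).1 hP.1
  have e20 := congrFun (congrFun hT 0) 2
  have e21 := congrFun (congrFun hT 1) 2
  have e00 := congrFun (congrFun hT 0) 0
  have e01 := congrFun (congrFun hT 0) 1
  have hd := hP.2
  rw [Matrix.det_fin_three] at hd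
  simp [Matrix.mul_apply, Fin.sum_univ_three, h02, h12, h22] at e20 e21 e00 e01 hd
  simp [e20, e21] at e00 e01 hd
  set a := P.1 0 0
  set b := P.1 0 1
  set c := P.1 1 0
  set d := P.1 1 1
  have hda : d = a := by linear_combination a * hd - d * e00 + c * e01
  have hbc : b = -c := by linear_combination b * e00 * (-1) + a * e01 - c * hd
  have hn : ‖Complex.mk a c‖ = 1 := by
    rw [Complex.norm_def, Complex.normSq_mk, Real.sqrt_eq_one]
    linarith
  have haz : azi (rotate P (sph 0 (Real.pi / 2))) = Complex.arg (Complex.mk a c) := by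
    simp [azi, rotate, sph, Matrix.mulVec, dotProduct, Fin.sum_univ_three, a, c]
  have hcos := Complex.norm_mul_cos_arg (Complex.mk a c)
  have hsin := Complex.norm_mul_sin_arg (Complex.mk a c)
  rw [hn, one_mul] at hcos hsin
  apply Subtype.ext
  ext i j
  rw [haz]
  fin_cases i <;> fin_cases j <;> simp [R3, hcos, hsin, h02, h12, h22, e20, e21] <;>
    first | exact hbc | exact hda | rfl

/-- The three angles are Euler angles of the given rotation. -/
theorem eul_eulerAngles (Q : SO3) : eul (eulerAlpha Q) (eulerBeta Q) (eulerGamma Q) = Q := by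
  have h0 : R3 0 = 1 := by
    apply Subtype.ext
    ext i j
    fin_cases i <;> fin_cases j <;> simp [R3]
  have h1 : ∀ ξ, rotate 1 ξ = ξ := fun ξ => Subtype.ext (by simp [rotate])
  have hfix : rotate ((eul (eulerAlpha Q) (eulerBeta Q) 0)⁻¹ * Q) (sph 0 0) = sph 0 0 := by
    rw [rotate_mul, ← sph_azi_zen (rotate Q (sph 0 0)), ← eulerAlpha, ← eulerBeta,
      ← rotate_eul, ← rotate_mul, inv_mul_cancel, h1]
  have h := eq_R3_of_fixes _ hfix
  rw [← eulerGamma, inv_mul_eq_iff_eq_mul] at h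
  refine Eq.trans ?_ h.symm
  simp [eul, h0]

/-! ### Spherical harmonics -/

/-- Associated Legendre functions of nonnegative order. -/
def legendreNonneg (n k : ℕ) (t : ℝ) : ℝ :=
  (-1) ^ k / (2 ^ n * (n.factorial : ℝ)) * Real.sqrt (1 - t ^ 2) ^ k *
    iteratedDeriv (n + k) (fun s : ℝ => (s ^ 2 - 1) ^ n) t

/-- The factorial of `m`, for an integer `m ≥ 0`. -/
def fact (m : ℤ) : ℝ := (m.toNat.factorial : ℝ)

/-- Associated Legendre functions `P_n^k`, `|k| ≤ n`. -/
def legendre (n : ℕ) (k : ℤ) (t : ℝ) : ℝ :=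
  if 0 ≤ k then legendreNonneg n k.toNat t
  else (-1) ^ k.natAbs * (fact (n - k.natAbs) / fact (n + k.natAbs)) * legendreNonneg n k.natAbs t

/-- Spherical harmonics `Y_n^k`, `|k| ≤ n`. -/
def sphericalHarmonic (n : ℕ) (k : ℤ) (ξ : S2) : ℂ :=
  ((Real.sqrt ((2 * n + 1) / (4 * Real.pi) * (fact (n - k) / fact (n + k))) *
      legendre n k (Real.cos (zen ξ)) : ℝ) : ℂ) *
    Complex.exp (Complex.I * k * azi ξ)

/-! ### Rotational harmonics -/

/-- The Rodrigues type formula for the Wigner d-functions, meaningful for `-1 < t < 1`. -/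
def wignerdFormula (n : ℕ) (k j : ℤ) (t : ℝ) : ℝ :=
  (-1) ^ (n - j).toNat / 2 ^ n *
    Real.sqrt (fact (n + k) * (1 - t) ^ (j - k) /
      (fact (n - j) * fact (n + j) * fact (n - k) * (1 + t) ^ (j + k))) *
    iteratedDeriv (n - k).toNat
      (fun s : ℝ => (1 + s) ^ (n + j).toNat * (1 - s) ^ (n - j).toNat) t

/-- The Wigner d-functions on `[-1, 1]`, with the values at `±1` defined by continuity. -/
def wignerd (n : ℕ) (k j : ℤ) : ℝ → ℝ :=
  extendFrom (Set.Ioo (-1) 1) (wignerdFormula n k j)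

/-- Rotational harmonics (Wigner D-functions) `D_n^{k,j}`, `|k|, |j| ≤ n`. -/
def wignerD (n : ℕ) (k j : ℤ) (Q : SO3) : ℂ :=
  Complex.exp (-Complex.I * k * eulerAlpha Q) * (wignerd n k j (Real.cos (eulerBeta Q)) : ℂ) *
    Complex.exp (-Complex.I * j * eulerGamma Q)

/-! ### The normalized semicircle transform -/

/-- The normalized semicircle transform of a function on the sphere. -/
def semicircle (f : S2 → ℂ) (Q : SO3) : ℂ :=
  1 / (4 * Real.pi) * ∫ ϑ in (0 : ℝ)..Real.pi, f (rotate Q (sph 0 ϑ)) * (Real.sin ϑ : ℂ)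

/-- The coefficients `λ_n^j` for `j ≥ 0`. The double factorial `(n - 2)!!` is `1` for `n = 1`, by
the truncated subtraction, in accordance with `(-1)!! = 1`. -/
def lambdaNonneg (n j : ℕ) : ℝ :=
  if n = 0 ∧ j = 0 then 2 * (4 * Real.pi) ^ (-(3 / 2) : ℝ)
  else if 1 ≤ j ∧ j ≤ n ∧ Even (n + j) then
    (-1) ^ j / (4 * Real.pi) *
      Real.sqrt ((2 * n + 1) / (4 * Real.pi) *
        (((n - j).factorial : ℝ) / ((n + j).factorial : ℝ))) *
      ((j * (n - 2).doubleFactorial * (n + j - 1).doubleFactorial : ℝ) /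
        ((n - j).doubleFactorial * (n + 1).doubleFactorial : ℝ)) *
      (if Even n then 2 else Real.pi)
  else 0

/-- The coefficients `λ_n^j`, with `λ_n^{-j} = (-1)^j λ_n^j`. -/
def lambda (n : ℕ) (j : ℤ) : ℝ :=
  if 0 ≤ j then lambdaNonneg n j.toNat else (-1) ^ j.natAbs * lambdaNonneg n j.natAbs

/-- The number `w_n`, the `L²` norm of the transform of `Y_n^k`. It is defined here with `k = 0`;
that it is the same for all orders `k` is a part of the theorem. -/
def singularValue (n : ℕ) : ℝ :=
  (eLpNorm (semicircle (sphericalHarmonic n 0)) 2 rotationMeasure).toReal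

/-- The functions `Z_n^k`. -/
def Z (n : ℕ) (k : ℤ) (Q : SO3) : ℂ :=
  (singularValue n : ℂ)⁻¹ *
    ∑ j ∈ Finset.Icc (-(n : ℤ)) n, (lambda n j : ℂ) * (starRingEnd ℂ) (wignerD n k j Q)

/-- The index set of all pairs `(n, k)` with `n ∈ ℕ` and `k ∈ {-n, …, n}`. -/
abbrev Idx : Type := {p : ℕ × ℤ // -(p.1 : ℤ) ≤ p.2 ∧ p.2 ≤ p.1}

end

end SemicircleTransform

open SemicircleTransform

/-!
The proof rests on one generating function. For a point `ξ` of the sphere put `h = ξ₁ + i ξ₂` and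
let `genPoly ξ` be the quadratic polynomial `h x² + 2 ξ₃ x - conj h`. The coefficient of `x^(n+k)`
in its `n`-th power is, up to a real factor `ycoef`, the spherical harmonic `Y_n^k`
(`sphericalHarmonic_eq`). A rotation about the third axis multiplies `h` by a phase, and one about
the second axis acts on `genPoly ξ` by the Möbius substitution
`x ↦ (x cos (β/2) - sin (β/2)) / (x sin (β/2) + cos (β/2))`. Hence rotations act on the harmonics of
degree `n` through the coefficients `wig` of the products of powers of `x cos (β/2) - sin (β/2)` and
`x sin (β/2) + cos (β/2)`, and Taylor expansion identifies these coefficients with the Rodrigues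
formula of the Wigner functions (`sphericalHarmonic_rotate_eul`, `conj_wignerD`). Throughout,
orders `k, j` are encoded by the exponents `b = n + k` and `a = n + j` of the monomials.

*Orthogonality.* The derivative of `wig` and the action of the derivation `x d/dx` give two
contiguity relations. Together they turn the derivative of
`wig a · wig (a' + 1) · sin` into a difference of two Wigner products, so that integration over
`[0, π]` yields a ladder relation for the inner products (`wigInner_ladder`). Going up the ladder and
down again compares two different factors when the degrees differ, which proves orthogonality, and
climbing it from an Euler beta integral gives the norms.

*The transform of `Y_n^k`.* By the transformation law, `𝓦 Y_n^k` is the combination of the matrix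
entries with the semicircle integrals of the `Y_n^j` as coefficients. These integrals satisfy a
ladder relation of the same kind (`semiInt_ladder`), which leads from `∫ sin^(n+1)` to the closed
form of `λ_n^j`. Orthogonality of the matrix entries gives the inner products of the transforms, and
`‖𝓦 Y_n^k‖²` is a multiple of `∑ j, (λ_n^j)²`, independently of `k`.

*Completeness.* For fixed `k` the harmonics `Y_n^k` are `h^k` times polynomials in `ξ₃` of every
degree `n - k`, so their span contains all polynomials in `h`, `conj h` and `ξ₃` and is dense in the
continuous functions by the Stone–Weierstrass theorem (`harmonicSpan_dense`).

*Boundedness.* A finite measure on the sphere is determined by its integrals of spherical harmonics.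
This shows that `Q ↦ Q ξ` carries the invariant measure of the rotation group to a multiple of the
surface measure. So composition with `(Q, ϑ) ↦ Q (sph 0 ϑ)` preserves square integrability, and the
integral over `ϑ` is controlled by the Cauchy–Schwarz inequality (`eLpNorm_semicircle_le`).

*Size of the singular values.* With `c_i = binom(2i, i) / 4^i`, the squares of the `λ_n^j` are a
common factor times `(p - q)² c_p c_q` for `p + q = n`, `p - q = j`. Comparing coefficients in powers
of `1 - x` sums them to `n (n + 1) / 2`, whence
`w_n² = (n + 1) / (16 π n) · (∫ sin^(n+1))²` for `n ≥ 1` (`normSq_eq`), and the Wallis product identity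
`∫ sin^(n+1) · ∫ sin^(n+2) = 2π / (n + 2)` finishes the estimate.
-/

namespace SemicircleTransform

noncomputable section

section PolynomialMethods

open Polynomial

/-! ### Powers of quadratic forms and their coefficients -/

/-- The quadratic polynomial `p x² + 2 z x - m`. For `p = ξ₁ + i ξ₂`, `z = ξ₃`, `m = ξ₁ - i ξ₂`
the coefficients of its `n`-th power are, up to normalization, the spherical harmonics `Y_n^k`. -/
def quad {R : Type*} [CommRing R] (p z m : R) : R[X] :=
  C p * X ^ 2 + C (2 * z) * X - C m

theorem natDegree_quad_le {R : Type*} [CommRing R] (p z m : R) : (quad p z m).natDegree ≤ 2 := by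
  unfold quad; compute_degree

theorem natDegree_quad_pow_le {R : Type*} [CommRing R] (p z m : R) (n : ℕ) :
    (quad p z m ^ n).natDegree ≤ 2 * n := by
  rw [mul_comm]
  exact natDegree_pow_le_of_le n (natDegree_quad_le p z m)

theorem homogenize_pow {R : Type*} [CommRing R] (q : R[X]) (d : ℕ) (hq : q.natDegree ≤ d)
    (n : ℕ) : (q ^ n).homogenize (d * n) = q.homogenize d ^ n := by
  induction n with
  | zero => simp
  | succ n ih =>
    rw [pow_succ, mul_add, mul_one, homogenize_mul, ih, pow_succ]
    · rw [mul_comm]; exact natDegree_pow_le_of_le n hq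
    · exact hq

/-- Substituting `a / b` into a power of a quadratic polynomial, in homogeneous form. -/
theorem quad_pow_expand {R A : Type*} [CommRing R] [CommRing A] [Algebra R A] (p z m : R)
    (n : ℕ) (a b : A) :
    (algebraMap R A p * a ^ 2 + 2 * algebraMap R A z * a * b - algebraMap R A m * b ^ 2) ^ n =
      ∑ i ∈ Finset.range (2 * n + 1),
        algebraMap R A ((quad p z m ^ n).coeff i) * (a ^ i * b ^ (2 * n - i)) := by
  have h := congrArg (MvPolynomial.aeval ![a, b])
    (homogenize_pow (quad p z m) 2 (natDegree_quad_le p z m) n)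
  have hq : MvPolynomial.aeval ![a, b] ((quad p z m).homogenize 2) =
      algebraMap R A p * a ^ 2 + 2 * algebraMap R A z * a * b - algebraMap R A m * b ^ 2 := by
    have e : quad p z m = C p * X ^ 2 + C (2 * z) * X - C m := rfl
    rw [e, homogenize_sub, homogenize_add, homogenize_C_mul, homogenize_C_mul,
      homogenize_X_pow le_rfl, homogenize_X two_ne_zero, homogenize_C]
    simp [map_ofNat]
    ring
  rw [map_pow, hq] at h
  rw [← h, homogenize, map_sum, Finset.Nat.sum_antidiagonal_eq_sum_range_succ_mk]
  refine Finset.sum_congr rfl fun i _ => ?_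
  rw [MvPolynomial.aeval_monomial, Finsupp.prod_fintype _ _ (by simp)]
  simp

/-! ### Half-angle polynomials and the contiguity relations of the Wigner functions -/

/-- `cos (β/2) x - sin (β/2)`. -/
def halfA (β : ℝ) : ℝ[X] := C (Real.cos (β / 2)) * X - C (Real.sin (β / 2))

/-- `sin (β/2) x + cos (β/2)`. -/
def halfB (β : ℝ) : ℝ[X] := C (Real.sin (β / 2)) * X + C (Real.cos (β / 2))

/-- The image of the monomial `x^p` under the rotation by `β` about the second axis, which acts on
polynomials of degree at most `p + q` by a Möbius substitution. -/
def wigPoly (p q : ℕ) (β : ℝ) : ℝ[X] := halfA β ^ p * halfB β ^ q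

/-- The unnormalized Wigner functions: matrix entries of the rotation about the second axis on
polynomials of degree at most `N`, in the monomial basis. -/
def wig (N a b : ℕ) (β : ℝ) : ℝ := (wigPoly a (N - a) β).coeff b

/-- Coefficientwise differentiability of a polynomial-valued function. -/
def HasCoeffDerivAt (F : ℝ → ℝ[X]) (F' : ℝ[X]) (β : ℝ) : Prop :=
  ∀ b, HasDerivAt (fun t => (F t).coeff b) (F'.coeff b) β

theorem HasCoeffDerivAt.mul {F G : ℝ → ℝ[X]} {F' G' : ℝ[X]} {β : ℝ}
    (hF : HasCoeffDerivAt F F' β) (hG : HasCoeffDerivAt G G' β) :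
    HasCoeffDerivAt (fun t => F t * G t) (F' * G β + F β * G') β := by
  intro b
  simp only [coeff_add, coeff_mul, ← Finset.sum_add_distrib]
  exact HasDerivAt.fun_sum fun i _ => (hF i.1).mul (hG i.2)

theorem HasCoeffDerivAt.pow {F : ℝ → ℝ[X]} {F' : ℝ[X]} {β : ℝ}
    (hF : HasCoeffDerivAt F F' β) (n : ℕ) :
    HasCoeffDerivAt (fun t => F t ^ n) (n * F β ^ (n - 1) * F') β := by
  induction n with
  | zero =>
    intro b
    simpa using hasDerivAt_const β ((1 : ℝ[X]).coeff b)
  | succ n ih =>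
    have h := ih.mul hF
    simp only [← pow_succ] at h
    convert h using 1
    rcases n with _ | n
    · simp
    · push_cast
      simp only [pow_succ]
      ring

theorem hasDerivAt_cos_half (β : ℝ) :
    HasDerivAt (fun t => Real.cos (t / 2)) (-(1 / 2) * Real.sin (β / 2)) β := by
  have h := ((hasDerivAt_id β).div_const 2).cos
  simp only [id] at h
  convert h using 1
  ring

theorem hasDerivAt_sin_half (β : ℝ) :
    HasDerivAt (fun t => Real.sin (t / 2)) (1 / 2 * Real.cos (β / 2)) β := by
  have h := ((hasDerivAt_id β).div_const 2).sin
  simp only [id] at h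
  convert h using 1
  ring

theorem hasCoeffDerivAt_halfA (β : ℝ) :
    HasCoeffDerivAt halfA (C (-(1 / 2)) * halfB β) β := by
  intro b
  have h := ((hasDerivAt_cos_half β).mul_const (X.coeff b : ℝ)).sub
    ((hasDerivAt_sin_half β).mul_const ((1 : ℝ[X]).coeff b))
  have e : (fun t => (halfA t).coeff b) = fun t => Real.cos (t / 2) * (X.coeff b : ℝ) -
      Real.sin (t / 2) * (1 : ℝ[X]).coeff b := by
    funext t
    rw [halfA, coeff_sub, coeff_C_mul, ← coeff_C_mul (1 : ℝ[X]), mul_one]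
  rw [e]
  refine h.congr_deriv ?_
  rw [halfB, coeff_C_mul, coeff_add, coeff_C_mul, ← mul_one (C (Real.cos (β / 2))), coeff_C_mul]
  ring

theorem hasCoeffDerivAt_halfB (β : ℝ) :
    HasCoeffDerivAt halfB (C (1 / 2) * halfA β) β := by
  intro b
  have h := ((hasDerivAt_sin_half β).mul_const (X.coeff b : ℝ)).add
    ((hasDerivAt_cos_half β).mul_const ((1 : ℝ[X]).coeff b))
  have e : (fun t => (halfB t).coeff b) = fun t => Real.sin (t / 2) * (X.coeff b : ℝ) +
      Real.cos (t / 2) * (1 : ℝ[X]).coeff b := by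
    funext t
    rw [halfB, coeff_add, coeff_C_mul, ← coeff_C_mul (1 : ℝ[X]), mul_one]
  rw [e]
  refine h.congr_deriv ?_
  rw [halfA, coeff_C_mul, coeff_sub, coeff_C_mul, ← mul_one (C (Real.sin (β / 2))), coeff_C_mul]
  ring

theorem hasCoeffDerivAt_wigPoly (p q : ℕ) (β : ℝ) :
    HasCoeffDerivAt (wigPoly p q)
      (C (q / 2 : ℝ) * wigPoly (p + 1) (q - 1) β - C (p / 2 : ℝ) * wigPoly (p - 1) (q + 1) β) β := by
  have h := ((hasCoeffDerivAt_halfA β).pow p).mul ((hasCoeffDerivAt_halfB β).pow q)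
  have e1 : C (q / 2 : ℝ) = (q : ℝ[X]) * C (1 / 2) := by
    rw [← C_eq_natCast, ← C_mul]; congr 1; ring
  have e2 : C (p / 2 : ℝ) = -((p : ℝ[X]) * C (-(1 / 2))) := by
    rw [← C_eq_natCast, ← C_mul, ← C_neg]; congr 1; ring
  refine fun b => (h b).congr_deriv (congrArg (fun F : ℝ[X] => F.coeff b) ?_)
  rw [e1, e2]
  simp only [wigPoly]
  ring

/-- Differentiation in `β` couples the neighbouring indices `a ± 1`, as an infinitesimal rotation
about the second axis. -/
theorem hasDerivAt_wig {N a : ℕ} (ha : a ≤ N) (b : ℕ) (β : ℝ) :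
    HasDerivAt (wig N a b)
      (((N : ℝ) - a) / 2 * wig N (a + 1) b β - (a : ℝ) / 2 * wig N (a - 1) b β) β := by
  have h := hasCoeffDerivAt_wigPoly a (N - a) β b
  refine h.congr_deriv ?_
  rw [coeff_sub, coeff_C_mul, coeff_C_mul, Nat.cast_sub ha, wig, wig, Nat.sub_sub]
  rcases a with _ | a
  · simp
  · congr 4
    omega

theorem cos_half_sq (β : ℝ) : Real.cos (β / 2) ^ 2 = (1 + Real.cos β) / 2 := by
  rw [Real.cos_sq, mul_div_cancel₀ β two_ne_zero]; ring

theorem sin_half_sq (β : ℝ) : Real.sin (β / 2) ^ 2 = (1 - Real.cos β) / 2 := by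
  rw [Real.sin_sq, cos_half_sq]; ring

theorem cos_half_mul_sin_half (β : ℝ) :
    Real.cos (β / 2) * Real.sin (β / 2) = Real.sin β / 2 := by
  have h := Real.sin_two_mul (β / 2)
  rw [mul_div_cancel₀ β two_ne_zero] at h
  linarith

theorem X_eq_halfA_halfB (β : ℝ) :
    (X : ℝ[X]) = C (Real.cos (β / 2)) * halfA β + C (Real.sin (β / 2)) * halfB β := by
  have h : C (Real.cos (β / 2)) ^ 2 + C (Real.sin (β / 2)) ^ 2 = (1 : ℝ[X]) := by
    rw [← C_pow, ← C_pow, ← C_add, Real.cos_sq_add_sin_sq, C_1]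
  rw [halfA, halfB]
  linear_combination (-X : ℝ[X]) * h

theorem X_mul_derivative_wigPoly (p q : ℕ) (β : ℝ) :
    X * derivative (wigPoly p q β) =
      C ((p + q) / 2 + (p - q) / 2 * Real.cos β : ℝ) * wigPoly p q β +
        C (Real.sin β / 2) * (C (p : ℝ) * wigPoly (p - 1) (q + 1) β +
          C (q : ℝ) * wigPoly (p + 1) (q - 1) β) := by
  have hX := X_eq_halfA_halfB β
  have dA : derivative (halfA β) = C (Real.cos (β / 2)) := by simp [halfA]
  have dB : derivative (halfB β) = C (Real.sin (β / 2)) := by simp [halfB]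
  have e1 : C ((p + q) / 2 + (p - q) / 2 * Real.cos β : ℝ) =
      (p : ℝ[X]) * C (Real.cos (β / 2)) ^ 2 + (q : ℝ[X]) * C (Real.sin (β / 2)) ^ 2 := by
    rw [← C_eq_natCast, ← C_eq_natCast, ← C_pow, ← C_pow, ← C_mul, ← C_mul, ← C_add,
      cos_half_sq, sin_half_sq]
    congr 1
    ring
  have e2 : C (Real.sin β / 2) = C (Real.cos (β / 2)) * C (Real.sin (β / 2)) := by
    rw [← C_mul, cos_half_mul_sin_half]
  have hp : ∀ (r : ℕ) (F : ℝ[X]), (r : ℝ[X]) * F ^ r = (r : ℝ[X]) * (F ^ (r - 1) * F) := by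
    rintro (_ | r) F
    · simp
    · simp [pow_succ]
  rw [e1, e2]
  simp only [wigPoly, derivative_mul, derivative_pow, dA, dB, C_eq_natCast]
  generalize C (Real.cos (β / 2)) = c at *
  generalize C (Real.sin (β / 2)) = s at *
  calc _ = (c * halfA β + s * halfB β) * (p * halfA β ^ (p - 1) * c * halfB β ^ q
        + halfA β ^ p * (q * halfB β ^ (q - 1) * s)) := by rw [← hX]
    _ = c ^ 2 * (p * (halfA β ^ (p - 1) * halfA β)) * halfB β ^ q +
        s ^ 2 * (halfA β ^ p * (q * (halfB β ^ (q - 1) * halfB β))) +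
        c * s * (p * (halfA β ^ (p - 1) * halfB β ^ (q + 1)) +
          q * (halfA β ^ (p + 1) * halfB β ^ (q - 1))) := by ring
    _ = _ := by rw [← hp, ← hp]; ring

/-- The second relation between neighbouring Wigner functions. It comes from the derivation `x d/dx`,
which generates the rotations about the third axis: it multiplies the coefficient of `x^b` by `b`. -/
theorem wig_contiguity {N a : ℕ} (ha : a ≤ N) (b : ℕ) (β : ℝ) :
    ((b : ℝ) - N / 2 - (a - N / 2) * Real.cos β) * wig N a b β =
      Real.sin β / 2 * (a * wig N (a - 1) b β + ((N : ℝ) - a) * wig N (a + 1) b β) := by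
  have h := congrArg (fun F => F.coeff b) (X_mul_derivative_wigPoly a (N - a) β)
  have hl : (X * derivative (wigPoly a (N - a) β)).coeff b = b * wig N a b β := by
    rcases b with _ | b
    · simp
    · rw [coeff_X_mul, coeff_derivative, wig]; push_cast; ring
  simp only [hl, coeff_add, coeff_C_mul, Nat.cast_sub ha] at h
  have h2 : (a : ℝ) * (wigPoly (a - 1) (N - a + 1) β).coeff b = a * wig N (a - 1) b β := by
    rcases a with _ | a
    · simp
    · rw [wig]; congr 3; omega
  rw [h2, Nat.sub_sub, ← wig, ← wig] at h
  linear_combination h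

theorem continuous_wig (N a b : ℕ) : Continuous (wig N a b) := by
  have h : ∀ p q, Continuous fun β => (wigPoly p q β).coeff b := fun p q =>
    continuous_iff_continuousAt.2 fun β => (hasCoeffDerivAt_wigPoly p q β b).continuousAt
  exact h a (N - a)

/-- The ladder relation behind the orthogonality of the Wigner functions. -/
theorem hasDerivAt_wig_mul_wig {N M a a' b b' : ℕ} (ha : a ≤ N) (ha' : a' + 1 ≤ M)
    (hk : (b : ℝ) - N / 2 = b' - M / 2) (hj : (a : ℝ) - N / 2 = a' - M / 2) (β : ℝ) :
    HasDerivAt (fun t => wig N a b t * wig M (a' + 1) b' t * Real.sin t)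
      (((N : ℝ) - a) * (wig N (a + 1) b β * wig M (a' + 1) b' β * Real.sin β) -
        ((a' : ℝ) + 1) * (wig N a b β * wig M a' b' β * Real.sin β)) β := by
  have h1 := hasDerivAt_wig ha b β
  have h2 := hasDerivAt_wig ha' b' β
  refine ((h1.mul h2).mul (Real.hasDerivAt_sin β)).congr_deriv ?_
  have c1 := wig_contiguity ha b β
  have c2 := wig_contiguity ha' b' β
  simp only [Nat.add_sub_cancel, Pi.mul_apply] at *
  push_cast at *
  rw [hk, hj] at c1
  linear_combination (wig M (a' + 1) b' β) * c1 - (wig N a b β) * c2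

/-- The inner products of Wigner functions with respect to `sin β dβ`. -/
def wigInner (N M a a' b b' : ℕ) : ℝ :=
  ∫ β in (0 : ℝ)..Real.pi, wig N a b β * wig M a' b' β * Real.sin β

theorem intervalIntegrable_wig_mul_wig (N M a a' b b' : ℕ) :
    IntervalIntegrable (fun β => wig N a b β * wig M a' b' β * Real.sin β) volume 0 Real.pi :=
  (((continuous_wig N a b).mul (continuous_wig M a' b')).mul
    Real.continuous_sin).intervalIntegrable _ _

/-- The ladder relation, integrated over `[0, π]`, where the factor `sin` removes the boundary terms. -/
theorem wigInner_ladder {N M a a' b b' : ℕ} (ha : a ≤ N) (ha' : a' + 1 ≤ M)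
    (hk : (b : ℝ) - N / 2 = b' - M / 2) (hj : (a : ℝ) - N / 2 = a' - M / 2) :
    ((N : ℝ) - a) * wigInner N M (a + 1) (a' + 1) b b' =
      ((a' : ℝ) + 1) * wigInner N M a a' b b' := by
  have h := intervalIntegral.integral_eq_sub_of_hasDerivAt
    (fun β _ => hasDerivAt_wig_mul_wig ha ha' hk hj β)
    (((intervalIntegrable_wig_mul_wig N M (a + 1) (a' + 1) b b').const_mul _).sub
      ((intervalIntegrable_wig_mul_wig N M a a' b b').const_mul _))
  rw [intervalIntegral.integral_sub
      ((intervalIntegrable_wig_mul_wig N M (a + 1) (a' + 1) b b').const_mul _)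
      ((intervalIntegrable_wig_mul_wig N M a a' b b').const_mul _),
    intervalIntegral.integral_const_mul, intervalIntegral.integral_const_mul] at h
  simp only [Real.sin_pi, Real.sin_zero, mul_zero, sub_zero] at h
  rw [wigInner, wigInner]
  linarith

theorem wigInner_comm (N M a a' b b' : ℕ) :
    wigInner N M a a' b b' = wigInner M N a' a b' b := by
  rw [wigInner, wigInner]
  congr 1
  funext β
  ring

/-- Wigner functions with the same orders and different degrees are orthogonal. -/
theorem wigInner_eq_zero {n m a a' b b' : ℕ} (hnm : n < m) (ha : a ≤ 2 * n)
    (hk : (b : ℝ) - n = b' - m) (hj : (a : ℝ) - n = a' - m) :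
    wigInner (2 * n) (2 * m) a a' b b' = 0 := by
  have hnm' : (n : ℝ) < m := by exact_mod_cast hnm
  have ha2 : (a : ℝ) ≤ 2 * n := by exact_mod_cast ha
  have ha' : a' + 1 ≤ 2 * m := by
    have : (a' : ℝ) < 2 * m := by linarith
    exact_mod_cast this
  have hk' : (b : ℝ) - (2 * n : ℕ) / 2 = b' - (2 * m : ℕ) / 2 := by push_cast; linarith
  have hj' : (a : ℝ) - (2 * n : ℕ) / 2 = a' - (2 * m : ℕ) / 2 := by push_cast; linarith
  have h1 := wigInner_ladder ha ha' hk' hj'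
  rcases Nat.lt_or_ge a (2 * n) with hlt | hge
  -- One step up and one step down, with the roles of the degrees exchanged, multiply the inner
  -- product by two factors that differ by `(m - n) (m + n + 1)`.
  · have h2 := wigInner_ladder (Nat.le_of_succ_le ha') hlt hk'.symm hj'.symm
    rw [wigInner_comm, wigInner_comm (2 * m)] at h2
    push_cast at h1 h2
    have h3 : ((2 * m - a') * (a' + 1 : ℝ) - (2 * n - a) * (a + 1)) *
        wigInner (2 * n) (2 * m) a a' b b' = 0 := by
      linear_combination (-(2 * m - a' : ℝ)) * h1 + (2 * n - a : ℝ) * h2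
    rcases mul_eq_zero.1 h3 with h | h
    · have e : (a' : ℝ) = a - n + m := by linarith
      rw [e] at h
      have : ((m : ℝ) - n) * (m + n + 1) = 0 := by linear_combination h
      rcases mul_eq_zero.1 this with h | h
      · linarith
      · have : (0 : ℝ) ≤ n := n.cast_nonneg
        linarith
    · exact h
  -- At the top of the smaller representation the left side of the ladder relation vanishes.
  · have e : (a : ℝ) = 2 * n := by
      have : a = 2 * n := le_antisymm ha hge
      exact_mod_cast this
    push_cast at h1
    rw [e] at h1
    have h3 : ((a' : ℝ) + 1) * wigInner (2 * n) (2 * m) a a' b b' = 0 := by linarith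
    rcases mul_eq_zero.1 h3 with h | h
    · have : (0 : ℝ) ≤ a' := a'.cast_nonneg
      linarith
    · exact h

/-! ### Norms of the Wigner functions -/

theorem hasDerivAt_sin_half_sq (β : ℝ) :
    HasDerivAt (fun t => Real.sin (t / 2) ^ 2) (Real.sin β / 2) β := by
  refine ((hasDerivAt_sin_half β).pow 2).congr_deriv ?_
  rw [← cos_half_mul_sin_half]
  push_cast
  ring

theorem hasDerivAt_cos_half_sq (β : ℝ) :
    HasDerivAt (fun t => Real.cos (t / 2) ^ 2) (-(Real.sin β / 2)) β := by
  refine ((hasDerivAt_cos_half β).pow 2).congr_deriv ?_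
  rw [← cos_half_mul_sin_half]
  push_cast
  ring

/-- An Euler beta integral in trigonometric form. -/
theorem integral_sin_half_cos_half (N b : ℕ) (hb : b ≤ N) :
    ∫ β in (0 : ℝ)..Real.pi,
      (Real.sin (β / 2) ^ 2) ^ b * (Real.cos (β / 2) ^ 2) ^ (N - b) * Real.sin β =
      2 / ((N + 1) * N.choose b) := by
  induction b with
  | zero =>
    have h := intervalIntegral.integral_eq_sub_of_hasDerivAt (a := 0) (b := Real.pi)
      (fun β _ => (hasDerivAt_cos_half_sq β).pow (N + 1))
      (Continuous.intervalIntegrable (by fun_prop) _ _)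
    simp only [Nat.add_sub_cancel, Pi.pow_apply] at h
    have e : ∀ β : ℝ, (Real.sin (β / 2) ^ 2) ^ 0 * (Real.cos (β / 2) ^ 2) ^ (N - 0) * Real.sin β =
        (-(2 / (N + 1)) : ℝ) *
          (((N + 1 : ℕ) : ℝ) * (Real.cos (β / 2) ^ 2) ^ N * -(Real.sin β / 2)) := by
      intro β
      push_cast
      field_simp
      simp [mul_comm]
    simp only [e, intervalIntegral.integral_const_mul, h]
    simp
  | succ b ih =>
    have ih := ih (Nat.le_of_succ_le hb)
    obtain ⟨e, rfl⟩ := Nat.exists_eq_add_of_le hb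
    have h := intervalIntegral.integral_eq_sub_of_hasDerivAt (a := 0) (b := Real.pi)
      (fun β _ => ((hasDerivAt_sin_half_sq β).pow (b + 1)).mul
        ((hasDerivAt_cos_half_sq β).pow (e + 1)))
      (Continuous.intervalIntegrable (by fun_prop) _ _)
    have e1 : b + 1 + e - (b + 1) = e := by omega
    have e2 : b + 1 + e - b = e + 1 := by omega
    rw [e2] at ih
    rw [e1]
    simp only [Nat.add_sub_cancel, Pi.pow_apply, Pi.mul_apply] at h
    have hi : ∀ β : ℝ, ((b + 1 : ℕ) : ℝ) * (Real.sin (β / 2) ^ 2) ^ b * (Real.sin β / 2) *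
          (Real.cos (β / 2) ^ 2) ^ (e + 1) +
        (Real.sin (β / 2) ^ 2) ^ (b + 1) *
          (((e + 1 : ℕ) : ℝ) * (Real.cos (β / 2) ^ 2) ^ e * -(Real.sin β / 2)) =
        ((b + 1 : ℝ) / 2) *
          ((Real.sin (β / 2) ^ 2) ^ b * (Real.cos (β / 2) ^ 2) ^ (e + 1) * Real.sin β) -
        ((e + 1 : ℝ) / 2) *
          ((Real.sin (β / 2) ^ 2) ^ (b + 1) * (Real.cos (β / 2) ^ 2) ^ e * Real.sin β) := by
      intro β
      push_cast
      ring
    simp only [hi] at h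
    rw [intervalIntegral.integral_sub (Continuous.intervalIntegrable (by fun_prop) _ _)
      (Continuous.intervalIntegrable (by fun_prop) _ _), intervalIntegral.integral_const_mul,
      intervalIntegral.integral_const_mul, ih] at h
    simp only [Real.cos_pi_div_two, zero_div, Real.sin_zero] at h
    have hc := Nat.choose_succ_right_eq (b + 1 + e) b
    rw [e2] at hc
    have hc' : ((b + 1 + e).choose (b + 1) : ℝ) * (b + 1) = (b + 1 + e).choose b * (e + 1) := by
      exact_mod_cast hc
    have hp1 : (0 : ℝ) < (b + 1 + e).choose b := by
      exact_mod_cast Nat.choose_pos (by omega)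
    have hp2 : (0 : ℝ) < (b + 1 + e).choose (b + 1) := by
      exact_mod_cast Nat.choose_pos (by omega)
    have hp3 : (0 : ℝ) < ((b + 1 + e : ℕ) : ℝ) + 1 := by positivity
    generalize ((b + 1 + e : ℕ) : ℝ) + 1 = M at *
    rw [eq_div_iff (by positivity)]
    generalize (∫ β in (0 : ℝ)..Real.pi, (Real.sin (β / 2) ^ 2) ^ (b + 1) *
      (Real.cos (β / 2) ^ 2) ^ e * Real.sin β) = I at *
    generalize ((b + 1 + e).choose b : ℝ) = c at *
    have h3 : ((e : ℝ) + 1) * I * (M * c) = 2 * (b + 1) := by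
      have : ((e : ℝ) + 1) * I = 2 * (b + 1) / (M * c) := by
        simp at h
        linear_combination -2 * h
      rw [this]
      field_simp
    have hb1 : (b : ℝ) + 1 ≠ 0 := by positivity
    refine mul_right_cancel₀ hb1 ?_
    linear_combination I * M * hc' + h3

theorem wig_zero (N b : ℕ) (hb : b ≤ N) (β : ℝ) :
    wig N 0 b β = N.choose b * Real.sin (β / 2) ^ b * Real.cos (β / 2) ^ (N - b) := by
  rw [wig, wigPoly, halfB, pow_zero, one_mul, Nat.sub_zero, add_pow, finsetSum_coeff]
  rw [Finset.sum_eq_single b]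
  · rw [mul_pow, ← C_pow, ← C_pow, ← C_eq_natCast, mul_assoc, mul_assoc, ← C_mul, coeff_C_mul,
      mul_comm (X ^ b), coeff_C_mul, coeff_X_pow, if_pos rfl]
    ring
  · intro i _ hi
    rw [mul_pow, ← C_pow, ← C_pow, ← C_eq_natCast, mul_assoc, mul_assoc, ← C_mul, coeff_C_mul,
      mul_comm (X ^ i), coeff_C_mul, coeff_X_pow, if_neg hi.symm]
    ring
  · intro h
    exact absurd (Finset.mem_range.2 (by omega)) h

/-- The norms of the Wigner functions, by climbing the ladder from `a = 0`, where the integral is an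
Euler beta integral. -/
theorem wigInner_self {N a b : ℕ} (ha : a ≤ N) (hb : b ≤ N) :
    wigInner N N a a b b = 2 / (N + 1) * (N.choose b / N.choose a) := by
  induction a with
  | zero =>
    rw [wigInner]
    have e : ∀ β : ℝ, wig N 0 b β * wig N 0 b β * Real.sin β = (N.choose b : ℝ) ^ 2 *
        ((Real.sin (β / 2) ^ 2) ^ b * (Real.cos (β / 2) ^ 2) ^ (N - b) * Real.sin β) := by
      intro β
      rw [wig_zero N b hb]
      ring
    simp only [e, intervalIntegral.integral_const_mul, integral_sin_half_cos_half N b hb]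
    have hp1 : (0 : ℝ) < N.choose b := by exact_mod_cast Nat.choose_pos hb
    simp
    field_simp
  | succ a ih =>
    have ih := ih (Nat.le_of_succ_le ha)
    have h := wigInner_ladder (b := b) (b' := b) (Nat.le_of_succ_le ha) ha rfl rfl
    rw [ih] at h
    have hc : (N.choose (a + 1) : ℝ) * (a + 1) = N.choose a * (N - a) := by
      rw [← Nat.cast_sub (Nat.le_of_succ_le ha)]
      exact_mod_cast Nat.choose_succ_right_eq N a
    have hp1 : (0 : ℝ) < N.choose a := by exact_mod_cast Nat.choose_pos (Nat.le_of_succ_le ha)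
    have hp2 : (0 : ℝ) < N.choose (a + 1) := by exact_mod_cast Nat.choose_pos ha
    have hp3 : (0 : ℝ) < N - a := by
      have : ((a + 1 : ℕ) : ℝ) ≤ N := by exact_mod_cast ha
      push_cast at this
      linarith
    refine mul_left_cancel₀ hp3.ne' (h.trans ?_)
    field_simp
    linear_combination (N.choose b : ℝ) * hc

/-! ### Coefficients of powers of quadratic polynomials -/

/-- Substitution of `u x` for `x`, in a form without division. -/
theorem coeff_quad_pow_scale {R : Type*} [CommRing R] (u p z m : R) (n b : ℕ) :
    u ^ n * (quad (u * p) z m ^ n).coeff b = u ^ b * (quad p z (u * m) ^ n).coeff b := by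
  have h : C u * quad (u * p) z m = (quad p z (u * m)).comp (C u * X) := by
    simp [quad]
    ring
  have h2 := congrArg (fun F : R[X] => (F ^ n).coeff b) h
  simp only [mul_pow, ← C_pow, coeff_C_mul, ← pow_comp, comp_C_mul_X_coeff] at h2
  rw [h2, mul_comm]

theorem coeff_quad_zero_pow {R : Type*} [CommRing R] (z m : R) (n : ℕ) :
    (quad 0 z m ^ n).coeff n = (2 * z) ^ n := by
  have h : (quad 0 z m).natDegree ≤ 1 := by
    simp only [quad, C_0, zero_mul, zero_add]
    compute_degree
  have h2 := coeff_pow_of_natDegree_le h (m := n)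
  rw [mul_one] at h2
  rw [h2]
  congr 1
  simp [quad]

theorem coeff_quad_zero_pow_of_lt {R : Type*} [CommRing R] (z m : R) {n b : ℕ} (hb : n < b) :
    (quad 0 z m ^ n).coeff b = 0 := by
  have h : (quad 0 z m).natDegree ≤ 1 := by
    simp only [quad, C_0, zero_mul, zero_add]
    compute_degree
  refine coeff_eq_zero_of_natDegree_lt ((natDegree_pow_le_of_le n h).trans_lt ?_)
  omega

/-- The dependence of the upper coefficients on `p`: they are `p ^ k` times a polynomial in `z` and
`p * m`. -/
theorem coeff_quad_pow_upper {K : Type*} [Field K] (p z m : K) (n k : ℕ) :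
    (quad p z m ^ n).coeff (n + k) = p ^ k * (quad 1 z (p * m) ^ n).coeff (n + k) := by
  rcases eq_or_ne p 0 with rfl | hp
  · rcases k with _ | k
    · rw [Nat.add_zero, coeff_quad_zero_pow, zero_mul, pow_zero, one_mul]
      have h : quad 1 z 0 = X * (X + C (2 * z)) := by
        simp [quad]
        ring
      rw [h, mul_pow X]
      have h2 := coeff_X_pow_mul ((X + C (2 * z)) ^ n) n 0
      rw [zero_add] at h2
      rw [h2, coeff_zero_eq_eval_zero]
      simp
    · rw [coeff_quad_zero_pow_of_lt _ _ (by omega), zero_pow (by omega), zero_mul]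
  · have h := coeff_quad_pow_scale p 1 z m n (n + k)
    rw [mul_one, pow_add, mul_assoc] at h
    exact mul_left_cancel₀ (pow_ne_zero n hp) h

/-- Substitution of `-1 / x` for `x`: it reverses the order of the coefficients. -/
theorem coeff_quad_pow_reflect {R : Type*} [CommRing R] (p z m : R) {n b : ℕ} (hb : b ≤ 2 * n) :
    (-1) ^ n * (quad m z p ^ n).coeff b = (-1) ^ b * (quad p z m ^ n).coeff (2 * n - b) := by
  have h := quad_pow_expand p z m n (-1 : R[X]) X
  have e : (algebraMap R R[X] p * (-1) ^ 2 + 2 * algebraMap R R[X] z * (-1) * X -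
      algebraMap R R[X] m * X ^ 2) = C (-1) * quad m z p := by
    simp only [quad, algebraMap_eq, C_mul, C_neg, C_1]
    rw [show (C 2 : R[X]) = 2 from rfl]
    ring
  rw [e, mul_pow, ← C_pow] at h
  have h2 := congrArg (fun F : R[X] => F.coeff b) h
  simp only [coeff_C_mul, finsetSum_coeff, algebraMap_eq] at h2
  rw [h2, Finset.sum_eq_single (2 * n - b)]
  · have e2 : 2 * n - (2 * n - b) = b := by omega
    have e3 : ((-1 : R[X]) ^ (2 * n - b)) = C ((-1) ^ b) := by
      rw [C_pow, C_neg, C_1]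
      have : (-1 : R[X]) ^ (2 * n - b) * ((-1) ^ b * (-1) ^ b) = (-1) ^ b := by
        rw [← mul_assoc, ← pow_add, Nat.sub_add_cancel hb, pow_mul]
        simp
      rw [← this, ← pow_add, ← two_mul, pow_mul]
      simp
    rw [e2, e3, coeff_C_mul, coeff_X_pow, if_pos rfl, mul_one, mul_comm]
  · intro i hi hib
    have : b ≠ 2 * n - i := by
      have := Finset.mem_range.1 hi
      omega
    have e3 : ((-1 : R[X]) ^ i) = C ((-1) ^ i) := by simp
    rw [e3, coeff_C_mul, coeff_X_pow, if_neg this, mul_zero, mul_zero]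
  · intro h
    exact absurd (Finset.mem_range.2 (by omega)) h

/-! ### Spherical harmonics as coefficients of a generating polynomial -/

/-- The horizontal part `ξ₁ + i ξ₂` of a point of the sphere. -/
def horiz (ξ : S2) : ℂ := Complex.mk (ξ.1 0) (ξ.1 1)

/-- The quadratic polynomial whose `n`-th power generates the spherical harmonics of degree `n`. -/
def genPoly (ξ : S2) : ℂ[X] := quad (horiz ξ) (ξ.1 2 : ℝ) (starRingEnd ℂ (horiz ξ))

theorem S2.sum_sq (ξ : S2) : ξ.1 0 ^ 2 + ξ.1 1 ^ 2 + ξ.1 2 ^ 2 = 1 := by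
  have hξ : ‖ξ.1‖ = 1 := mem_sphere_zero_iff_norm.1 ξ.2
  rw [EuclideanSpace.norm_eq, Real.sqrt_eq_one] at hξ
  simpa only [Real.norm_eq_abs, sq_abs, Fin.sum_univ_three] using hξ

theorem cos_zen (ξ : S2) : Real.cos (zen ξ) = ξ.1 2 := by
  have h := S2.sum_sq ξ
  exact Real.cos_arccos (by nlinarith [sq_nonneg (ξ.1 0), sq_nonneg (ξ.1 1)])
    (by nlinarith [sq_nonneg (ξ.1 0), sq_nonneg (ξ.1 1)])

theorem horiz_mul_conj (ξ : S2) :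
    horiz ξ * starRingEnd ℂ (horiz ξ) = ((1 - (ξ.1 2) ^ 2 : ℝ) : ℂ) := by
  rw [Complex.mul_conj, horiz, Complex.normSq_mk]
  congr 1
  linarith [S2.sum_sq ξ]

theorem horiz_eq (ξ : S2) :
    horiz ξ = (Real.sqrt (1 - (ξ.1 2) ^ 2) : ℂ) * Complex.exp (Complex.I * azi ξ) := by
  have h : ‖horiz ξ‖ = Real.sqrt (1 - (ξ.1 2) ^ 2) := by
    rw [Complex.norm_def, horiz, Complex.normSq_mk]
    congr 1
    linarith [S2.sum_sq ξ]
  rw [← h, mul_comm Complex.I]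
  exact (Complex.norm_mul_exp_arg_mul_I (horiz ξ)).symm

theorem horiz_pow (ξ : S2) (k : ℕ) :
    horiz ξ ^ k = ((Real.sqrt (1 - (ξ.1 2) ^ 2) ^ k : ℝ) : ℂ) *
      Complex.exp (Complex.I * k * azi ξ) := by
  rw [horiz_eq, mul_pow, ← Complex.exp_nat_mul]
  push_cast
  congr 2
  ring

theorem iteratedDeriv_polynomial (p : ℝ[X]) (m : ℕ) :
    iteratedDeriv m (fun s => p.eval s) = fun t => (derivative^[m] p).eval t := by
  induction m generalizing p with
  | zero => simp
  | succ m ih =>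
    rw [iteratedDeriv_succ']
    have : deriv (fun s => p.eval s) = fun s => (derivative p).eval s := by
      funext s
      exact p.deriv
    rw [this, ih, Function.iterate_succ_apply]

/-- Derivatives as Taylor coefficients. -/
theorem eval_iterate_derivative {R : Type*} [CommRing R] (p : R[X]) (m : ℕ) (t : R) :
    (derivative^[m] p).eval t = m.factorial * (p.comp (X + C t)).coeff m := by
  rw [← taylor_apply, taylor_coeff, ← factorial_smul_hasseDeriv]
  simp

/-- The normalizing factor of `Y_n^k`, `b = n + k`, relative to the generating polynomial. -/
def ycoef (n b : ℕ) : ℝ :=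
  (-1) ^ (n + b) * Real.sqrt (b.factorial * (2 * n - b).factorial) *
    (Real.sqrt ((2 * n + 1) / (4 * Real.pi)) / (2 ^ n * n.factorial))

theorem ycoef_ne_zero (n b : ℕ) : ycoef n b ≠ 0 := by
  unfold ycoef
  have := Real.pi_pos
  positivity

theorem fact_natCast (m : ℕ) : fact (m : ℤ) = m.factorial := by
  simp [fact]

theorem legendreNonneg_eq (n k : ℕ) (t : ℝ) :
    legendreNonneg n k t = (-1) ^ k / (2 ^ n * (n.factorial : ℝ)) * Real.sqrt (1 - t ^ 2) ^ k *
      (derivative^[n + k] ((X ^ 2 - 1 : ℝ[X]) ^ n)).eval t := by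
  have h := congrFun (iteratedDeriv_polynomial ((X ^ 2 - 1 : ℝ[X]) ^ n) (n + k)) t
  rw [legendreNonneg, ← h]
  simp

theorem legendreNonneg_eq_coeff (n k : ℕ) (t : ℝ) :
    legendreNonneg n k t = (-1) ^ k / (2 ^ n * (n.factorial : ℝ)) * Real.sqrt (1 - t ^ 2) ^ k *
      ((n + k).factorial * (quad 1 t (1 - t ^ 2) ^ n).coeff (n + k)) := by
  rw [legendreNonneg_eq, eval_iterate_derivative]
  congr 4
  rw [pow_comp]
  congr 1
  simp [quad, map_ofNat]
  ring

/-- The normalization of the Legendre functions in a form symmetric under `k ↦ -k`. -/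
theorem sqrt_mul_factorial (A x y : ℝ) (hA : 0 ≤ A) (hx : 0 ≤ x) (hy : 0 < y) :
    Real.sqrt (A * (x / y)) * y = Real.sqrt (y * x) * Real.sqrt A := by
  rw [Real.sqrt_mul hA, Real.sqrt_mul hy.le, Real.sqrt_div hx]
  have := Real.mul_self_sqrt hy.le
  have h2 : Real.sqrt y ≠ 0 := (Real.sqrt_pos.2 hy).ne'
  field_simp
  rw [Real.sq_sqrt hy.le]

theorem sphericalHarmonic_natCast {n k : ℕ} (hk : k ≤ n) (ξ : S2) :
    sphericalHarmonic n k ξ = ycoef n (n + k) * (genPoly ξ ^ n).coeff (n + k) := by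
  have hup := coeff_quad_pow_upper (horiz ξ) ((ξ.1 2 : ℝ) : ℂ) (starRingEnd ℂ (horiz ξ)) n k
  have hmap : quad (1 : ℂ) ((ξ.1 2 : ℝ) : ℂ) (horiz ξ * starRingEnd ℂ (horiz ξ)) =
      (quad 1 (ξ.1 2) (1 - (ξ.1 2) ^ 2)).map Complex.ofRealHom := by
    rw [horiz_mul_conj]
    simp [quad]
  rw [hmap, ← Polynomial.map_pow, coeff_map] at hup
  rw [genPoly, hup, sphericalHarmonic, cos_zen, horiz_pow, legendre, if_pos (by positivity),
    Int.toNat_natCast, legendreNonneg_eq_coeff, ← Nat.cast_sub hk, ← Nat.cast_add, fact_natCast,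
    fact_natCast]
  have hs := sqrt_mul_factorial ((2 * n + 1) / (4 * Real.pi)) ((n - k).factorial)
    ((n + k).factorial) (by have := Real.pi_pos; positivity) (by positivity) (by positivity)
  have hy : ycoef n (n + k) = (-1) ^ k / (2 ^ n * (n.factorial : ℝ)) *
      (Real.sqrt ((2 * n + 1) / (4 * Real.pi) * ((n - k).factorial / (n + k).factorial)) *
        (n + k).factorial) := by
    rw [hs, ycoef, ← add_assoc, pow_add, ← two_mul, pow_mul, neg_one_sq, one_pow, one_mul,
      show 2 * n - (n + k) = n - k by omega]
    ring
  rw [hy]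
  simp only [Complex.ofRealHom_eq_coe, Int.cast_natCast]
  push_cast
  ring

theorem sphericalHarmonic_neg {n k : ℕ} (hk : k ≤ n) (ξ : S2) :
    sphericalHarmonic n (-(k : ℤ)) ξ =
      (-1) ^ k * starRingEnd ℂ (sphericalHarmonic n k ξ) := by
  rcases k with _ | k
  · simp [sphericalHarmonic]
  · have hneg : ¬ (0 : ℤ) ≤ -((k + 1 : ℕ) : ℤ) := by push_cast; omega
    rw [sphericalHarmonic, sphericalHarmonic, legendre, legendre, if_neg hneg,
      if_pos (by positivity), Int.natAbs_neg, Int.natAbs_natCast, Int.toNat_natCast]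
    rw [sub_neg_eq_add, ← sub_eq_add_neg, ← Nat.cast_sub hk, ← Nat.cast_add, fact_natCast,
      fact_natCast]
    have h1 := sqrt_mul_factorial ((2 * n + 1) / (4 * Real.pi)) ((n + (k + 1)).factorial)
      ((n - (k + 1)).factorial) (by have := Real.pi_pos; positivity) (by positivity)
      (by positivity)
    have h2 := sqrt_mul_factorial ((2 * n + 1) / (4 * Real.pi)) ((n - (k + 1)).factorial)
      ((n + (k + 1)).factorial) (by have := Real.pi_pos; positivity) (by positivity)
      (by positivity)
    rw [mul_comm ((n + (k + 1)).factorial : ℝ), ← h1] at h2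
    have hp : ((n + (k + 1)).factorial : ℝ) ≠ 0 := by positivity
    rw [← eq_div_iff hp, mul_div_assoc] at h2
    rw [h2, map_mul, Complex.conj_ofReal, ← Complex.exp_conj]
    have e : starRingEnd ℂ (Complex.I * ((k + 1 : ℕ) : ℤ) * azi ξ) =
        Complex.I * (-((k + 1 : ℕ) : ℤ) : ℤ) * azi ξ := by
      simp
      ring
    rw [e]
    push_cast
    ring

theorem coeff_genPoly_pow_neg {n k : ℕ} (hk : k ≤ n) (ξ : S2) :
    (genPoly ξ ^ n).coeff (n - k) =
      (-1) ^ k * starRingEnd ℂ ((genPoly ξ ^ n).coeff (n + k)) := by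
  have h := coeff_quad_pow_reflect (horiz ξ) ((ξ.1 2 : ℝ) : ℂ) (starRingEnd ℂ (horiz ξ))
    (n := n) (b := n + k) (by omega)
  rw [show 2 * n - (n + k) = n - k by omega] at h
  have hc : quad (starRingEnd ℂ (horiz ξ)) ((ξ.1 2 : ℝ) : ℂ) (horiz ξ) =
      (genPoly ξ).map (starRingEnd ℂ) := by
    simp [quad, genPoly, map_ofNat]
  rw [hc, ← Polynomial.map_pow, coeff_map, ← genPoly, pow_add, mul_assoc] at h
  have h2 := mul_left_cancel₀ (pow_ne_zero n (neg_ne_zero.2 one_ne_zero)) h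
  rw [h2, ← mul_assoc, ← mul_pow]
  simp

/-- The spherical harmonics are the normalized coefficients of the generating polynomial. -/
theorem sphericalHarmonic_eq {n b : ℕ} (hb : b ≤ 2 * n) (ξ : S2) :
    sphericalHarmonic n ((b : ℤ) - n) ξ = ycoef n b * (genPoly ξ ^ n).coeff b := by
  rcases le_total n b with h | h
  · obtain ⟨k, rfl⟩ := Nat.exists_eq_add_of_le h
    rw [← sphericalHarmonic_natCast (by omega)]
    congr 1
    push_cast
    ring
  · obtain ⟨k, rfl⟩ := Nat.exists_eq_add_of_le h
    have e : ((b : ℤ) - (b + k : ℕ)) = -(k : ℤ) := by push_cast; ring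
    have h2 := coeff_genPoly_pow_neg (n := b + k) (k := k) (by omega) ξ
    rw [Nat.add_sub_cancel] at h2
    rw [e, sphericalHarmonic_neg (by omega), sphericalHarmonic_natCast (by omega), h2, map_mul,
      Complex.conj_ofReal]
    have hy : ycoef (b + k) (b + k + k) = ycoef (b + k) b := by
      rw [ycoef, ycoef, show 2 * (b + k) - (b + k + k) = b by omega,
        show 2 * (b + k) - b = b + k + k by omega,
        mul_comm ((b + k + k).factorial : ℝ)]
      congr 2
      rw [show b + k + (b + k + k) = b + k + b + 2 * k by ring, pow_add _ _ (2 * k), pow_mul]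
      simp
    rw [hy]
    ring

/-! ### The action of rotations on the generating polynomial -/

theorem horiz_rotate_R3 (α : ℝ) (ξ : S2) :
    horiz (rotate (R3 α) ξ) = Complex.exp (Complex.I * α) * horiz ξ := by
  rw [mul_comm Complex.I, Complex.exp_mul_I, ← Complex.ofReal_cos, ← Complex.ofReal_sin]
  apply Complex.ext <;>
  simp [horiz, rotate, R3, dotProduct, Fin.sum_univ_three, -Complex.ofReal_cos,
    -Complex.ofReal_sin] <;> ring

theorem rotate_R3_two (α : ℝ) (ξ : S2) : (rotate (R3 α) ξ).1 2 = ξ.1 2 := by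
  simp [rotate, R3, dotProduct, Fin.sum_univ_three]

theorem coeff_genPoly_rotate_R3 (α : ℝ) (ξ : S2) (n b : ℕ) :
    (genPoly (rotate (R3 α) ξ) ^ n).coeff b =
      Complex.exp (Complex.I * ((b : ℤ) - n : ℤ) * α) * (genPoly ξ ^ n).coeff b := by
  have h := coeff_quad_pow_scale (Complex.exp (Complex.I * α)) (horiz ξ) ((ξ.1 2 : ℝ) : ℂ)
    (starRingEnd ℂ (horiz (rotate (R3 α) ξ))) n b
  have e : Complex.exp (Complex.I * α) * starRingEnd ℂ (horiz (rotate (R3 α) ξ)) =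
      starRingEnd ℂ (horiz ξ) := by
    rw [horiz_rotate_R3, map_mul, ← mul_assoc, Complex.mul_conj, Complex.normSq_eq_norm_sq,
      mul_comm Complex.I, Complex.norm_exp_ofReal_mul_I]
    simp
  rw [e, ← horiz_rotate_R3, ← rotate_R3_two α ξ, ← genPoly, rotate_R3_two α ξ, ← genPoly] at h
  refine mul_left_cancel₀ (pow_ne_zero n (Complex.exp_ne_zero (Complex.I * α))) (h.trans ?_)
  rw [← mul_assoc, ← Complex.exp_nat_mul, ← Complex.exp_nat_mul, ← Complex.exp_add]
  congr 2
  push_cast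
  ring

/-- A rotation about the second axis acts on the generating polynomial by a Möbius substitution. -/
theorem genPoly_rotate_R2 (β : ℝ) (ξ : S2) :
    genPoly (rotate (R2 β) ξ) = C (horiz ξ) * (halfA β).map Complex.ofRealHom ^ 2 +
      2 * C ((ξ.1 2 : ℝ) : ℂ) * (halfA β).map Complex.ofRealHom *
        (halfB β).map Complex.ofRealHom -
      C (starRingEnd ℂ (horiz ξ)) * (halfB β).map Complex.ofRealHom ^ 2 := by
  have h1 : horiz ξ = (ξ.1 0 : ℂ) + ξ.1 1 * Complex.I := by
    apply Complex.ext <;> simp [horiz]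
  have h2 : horiz (rotate (R2 β) ξ) = (Real.cos β : ℂ) * ξ.1 0 + Real.sin β * ξ.1 2 +
      ξ.1 1 * Complex.I := by
    apply Complex.ext <;>
    simp [horiz, rotate, R2, dotProduct, Fin.sum_univ_three,
      -Complex.ofReal_cos, -Complex.ofReal_sin]
  have h3 : (rotate (R2 β) ξ).1 2 = -Real.sin β * ξ.1 0 + Real.cos β * ξ.1 2 := by
    simp [rotate, R2, dotProduct, Fin.sum_univ_three]
  have hc : Real.cos β = Real.cos (β / 2) ^ 2 - Real.sin (β / 2) ^ 2 := by
    rw [cos_half_sq, sin_half_sq]; ring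
  have hs : Real.sin β = 2 * (Real.cos (β / 2) * Real.sin (β / 2)) := by
    rw [cos_half_mul_sin_half]; ring
  have hone : (1 : ℂ[X]) = C (Real.cos (β / 2) : ℂ) ^ 2 + C (Real.sin (β / 2) : ℂ) ^ 2 := by
    rw [← C_pow, ← C_pow, ← C_add, ← Complex.ofReal_pow, ← Complex.ofReal_pow,
      ← Complex.ofReal_add, Real.cos_sq_add_sin_sq]
    simp
  rw [genPoly, h2, h3, hc, hs, h1]
  simp only [quad, halfA, halfB, Polynomial.map_sub, Polynomial.map_add, Polynomial.map_mul,
    map_C, map_X, Complex.ofRealHom_eq_coe, map_add, map_mul, map_sub, map_pow, map_neg,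
    Complex.conj_ofReal, Complex.conj_I, Complex.ofReal_add, Complex.ofReal_mul,
    Complex.ofReal_sub, Complex.ofReal_pow, Complex.ofReal_neg, Complex.ofReal_ofNat, map_ofNat]
  linear_combination (C (ξ.1 1 : ℂ) * C Complex.I * (X ^ 2 + 1)) * hone

/-- A rotation about the second axis acts on the coefficients through the Wigner functions. -/
theorem coeff_genPoly_rotate_R2 (β : ℝ) (ξ : S2) (n b : ℕ) :
    (genPoly (rotate (R2 β) ξ) ^ n).coeff b =
      ∑ a ∈ Finset.range (2 * n + 1), (wig (2 * n) a b β : ℂ) * (genPoly ξ ^ n).coeff a := by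
  rw [genPoly_rotate_R2]
  have h := quad_pow_expand (horiz ξ) ((ξ.1 2 : ℝ) : ℂ) (starRingEnd ℂ (horiz ξ)) n
    ((halfA β).map Complex.ofRealHom) ((halfB β).map Complex.ofRealHom)
  rw [algebraMap_eq] at h
  rw [h, finsetSum_coeff]
  refine Finset.sum_congr rfl fun a _ => ?_
  rw [coeff_C_mul, ← Polynomial.map_pow, ← Polynomial.map_pow, ← Polynomial.map_mul, coeff_map,
    ← genPoly, mul_comm]
  rfl

/-- The normalized Wigner functions in terms of the Euler angle `β`; the indices are
`b = n + k` and `a = n + j`. -/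
def dfun (n b a : ℕ) (β : ℝ) : ℝ := ycoef n b / ycoef n a * wig (2 * n) a b β

/-- The matrix entries of the rotation `eul α β γ` on spherical harmonics of degree `n`; the
indices are `b = n + k` and `a = n + j`. -/
def eulerEntry (n b a : ℕ) (α β γ : ℝ) : ℂ :=
  Complex.exp (Complex.I * ((b : ℤ) - n : ℤ) * α) * (dfun n b a β : ℂ) *
    Complex.exp (Complex.I * ((a : ℤ) - n : ℤ) * γ)

/-- The transformation law of spherical harmonics under rotations. -/
theorem sphericalHarmonic_rotate_eul {n b : ℕ} (hb : b ≤ 2 * n) (α β γ : ℝ) (ξ : S2) :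
    sphericalHarmonic n ((b : ℤ) - n) (rotate (eul α β γ) ξ) =
      ∑ a ∈ Finset.range (2 * n + 1),
        eulerEntry n b a α β γ * sphericalHarmonic n ((a : ℤ) - n) ξ := by
  rw [sphericalHarmonic_eq hb, eul, rotate_mul, rotate_mul, coeff_genPoly_rotate_R3,
    coeff_genPoly_rotate_R2, Finset.mul_sum, Finset.mul_sum]
  refine Finset.sum_congr rfl fun a ha => ?_
  have ha' : a ≤ 2 * n := Nat.lt_succ_iff.1 (Finset.mem_range.1 ha)
  have hy : (ycoef n a : ℂ) ≠ 0 := by exact_mod_cast ycoef_ne_zero n a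
  rw [coeff_genPoly_rotate_R3, sphericalHarmonic_eq ha', eulerEntry, dfun]
  push_cast
  field_simp

/-- At the north pole only the harmonics of order zero do not vanish. -/
theorem coeff_genPoly_north (n b : ℕ) :
    (genPoly (sph 0 0) ^ n).coeff b = if b = n then 2 ^ n else 0 := by
  have h : genPoly (sph 0 0) = C 2 * X := by
    have : horiz (sph 0 0) = 0 := by
      apply Complex.ext <;> simp [horiz, sph]
    rw [genPoly, this]
    simp [quad, sph]
  rw [h, mul_pow, ← C_pow, coeff_C_mul, coeff_X_pow]
  simp

/-- Spherical harmonics as matrix entries with `j = 0`. -/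
theorem sphericalHarmonic_sph {n b : ℕ} (hb : b ≤ 2 * n) (φ ϑ : ℝ) :
    sphericalHarmonic n ((b : ℤ) - n) (sph φ ϑ) =
      (Real.sqrt ((2 * n + 1) / (4 * Real.pi)) : ℂ) * eulerEntry n b n φ ϑ 0 := by
  rw [← rotate_eul, sphericalHarmonic_rotate_eul hb, Finset.sum_eq_single n]
  · rw [sphericalHarmonic_eq (by omega), coeff_genPoly_north, if_pos rfl, mul_comm]
    congr 1
    have : ycoef n n * 2 ^ n = Real.sqrt ((2 * n + 1) / (4 * Real.pi)) := by
      rw [ycoef, ← two_mul, pow_mul, neg_one_sq, one_pow, one_mul,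
        show 2 * n - n = n by omega, Real.sqrt_mul_self (by positivity)]
      field_simp
    rw [← this]
    push_cast
    ring
  · intro a ha han
    have ha' : a ≤ 2 * n := Nat.lt_succ_iff.1 (Finset.mem_range.1 ha)
    rw [sphericalHarmonic_eq ha', coeff_genPoly_north, if_neg han]
    simp
  · intro h
    exact absurd (Finset.mem_range.2 (by omega)) h

/-! ### The Rodrigues formula for the Wigner functions -/

theorem reflect_pow {R : Type*} [CommRing R] (f : R[X]) {d : ℕ} (hf : f.natDegree ≤ d) (n : ℕ) :
    reflect (n * d) (f ^ n) = reflect d f ^ n := by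
  induction n with
  | zero => simp
  | succ n ih =>
    rw [pow_succ, add_mul, one_mul, reflect_mul _ _ (natDegree_pow_le_of_le n hf) hf, ih, pow_succ]

theorem reflect_linear {R : Type*} [CommRing R] (u v : R) :
    reflect 1 (C u * X + C v) = C v * X + C u := by
  have h := reflect_C_mul_X_pow 1 1 (c := u)
  rw [pow_one] at h
  rw [reflect_add, h, reflect_C, revAt_le le_rfl]
  simp [add_comm]

/-- The polynomials of the Rodrigues formula are, after rescaling, reversals of the polynomials
which define the Wigner functions. -/
theorem coeff_rodrigues_eq_wig {N a b : ℕ} (ha : a ≤ N) (hb : b ≤ N) (β : ℝ) :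
    ((C (Real.sin (β / 2)) * X + C (Real.cos (β / 2)) : ℝ[X]) ^ a *
      (C (-Real.cos (β / 2)) * X + C (Real.sin (β / 2))) ^ (N - a)).coeff (N - b) =
      (-1) ^ (N + b) * wig N a b β := by
  obtain ⟨q, rfl⟩ := Nat.exists_eq_add_of_le ha
  rw [Nat.add_sub_cancel_left, wig, Nat.add_sub_cancel_left]
  generalize hc : Real.cos (β / 2) = c
  generalize hs : Real.sin (β / 2) = s
  have d : ∀ u v : ℝ, (C u * X + C v : ℝ[X]).natDegree ≤ 1 := fun u v => by compute_degree
  have h1 : ((C s * X + C c : ℝ[X]) ^ a * (C (-c) * X + C s) ^ q).coeff (a + q - b) =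
      (reflect (a * 1 + q * 1) ((C s * X + C c : ℝ[X]) ^ a * (C (-c) * X + C s) ^ q)).coeff b := by
    rw [coeff_reflect, mul_one, mul_one, revAt_le hb]
  have h2 : wigPoly a q β = C ((-1) ^ (a + q)) *
      ((C c * X + C s) ^ a * (C s * X + C (-c)) ^ q).comp (C (-1) * X) := by
    rw [wigPoly, halfA, halfB, hc, hs, mul_comp, pow_comp, pow_comp, pow_add, C_mul, C_pow, C_pow,
      mul_mul_mul_comm, ← mul_pow, ← mul_pow]
    congr 2 <;> simp <;> ring
  rw [h1, reflect_mul _ _ (natDegree_pow_le_of_le a (d _ _)) (natDegree_pow_le_of_le q (d _ _)),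
    reflect_pow _ (d _ _), reflect_pow _ (d _ _), reflect_linear, reflect_linear, h2, coeff_C_mul,
    comp_C_mul_X_coeff, pow_add _ (a + q) b]
  have e1 : ((-1 : ℝ) ^ (a + q)) * (-1) ^ (a + q) = 1 := by rw [← mul_pow]; simp
  have e2 : ((-1 : ℝ) ^ b) * (-1) ^ b = 1 := by rw [← mul_pow]; simp
  linear_combination (-(-1 : ℝ) ^ b * (-1) ^ b *
    ((C c * X + C s) ^ a * (C s * X + C (-c)) ^ q : ℝ[X]).coeff b) * e1 -
    (((C c * X + C s) ^ a * (C s * X + C (-c)) ^ q : ℝ[X]).coeff b) * e2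

/-- The Rodrigues formula, by expanding at the point `cos β` and rescaling the variable by `sin β`. -/
theorem iteratedDeriv_rodrigues {N a b : ℕ} (ha : a ≤ N) (hb : b ≤ N) {β : ℝ}
    (hc : 0 < Real.cos (β / 2)) (hs : 0 < Real.sin (β / 2)) :
    iteratedDeriv (N - b) (fun s : ℝ => (1 + s) ^ a * (1 - s) ^ (N - a)) (Real.cos β) =
      (N - b).factorial * ((2 * Real.cos (β / 2)) ^ a * (2 * Real.sin (β / 2)) ^ (N - a) /
        (2 * Real.cos (β / 2) * Real.sin (β / 2)) ^ (N - b)) * ((-1) ^ (N + b) * wig N a b β) := by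
  have h := congrFun (iteratedDeriv_polynomial ((1 + X : ℝ[X]) ^ a * (1 - X) ^ (N - a)) (N - b))
    (Real.cos β)
  have e : (fun s : ℝ => (1 + s) ^ a * (1 - s) ^ (N - a)) =
      fun s => ((1 + X : ℝ[X]) ^ a * (1 - X) ^ (N - a)).eval s := by
    funext s; simp
  rw [e, h, eval_iterate_derivative, ← coeff_rodrigues_eq_wig ha hb]
  have h1 : 1 + Real.cos β = 2 * Real.cos (β / 2) * Real.cos (β / 2) := by
    linear_combination (-2) * cos_half_sq β
  have h2 : 1 - Real.cos β = 2 * Real.sin (β / 2) * Real.sin (β / 2) := by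
    linear_combination (-2) * sin_half_sq β
  generalize Real.cos (β / 2) = c at *
  generalize Real.sin (β / 2) = s at *
  generalize Real.cos β = t at *
  have hcomp : (((1 + X : ℝ[X]) ^ a * (1 - X) ^ (N - a)).comp (X + C t)).comp
      (C (2 * c * s) * X) = C ((2 * c) ^ a * (2 * s) ^ (N - a)) *
        ((C s * X + C c) ^ a * (C (-c) * X + C s) ^ (N - a)) := by
    simp only [mul_comp, pow_comp]
    have hC : C ((2 * c) ^ a * (2 * s) ^ (N - a)) = C (2 * c) ^ a * C (2 * s) ^ (N - a) := by
      rw [C_mul, C_pow, C_pow]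
    rw [hC, mul_mul_mul_comm, ← mul_pow, ← mul_pow]
    have h1' := congrArg (C : ℝ → ℝ[X]) h1
    have h2' := congrArg (C : ℝ → ℝ[X]) h2
    simp only [C_add, C_sub, C_mul, C_1] at h1' h2'
    congr 2 <;> simp
    · linear_combination h1'
    · linear_combination h2'
  have hk := congrArg (fun F : ℝ[X] => F.coeff (N - b)) hcomp
  simp only [comp_C_mul_X_coeff, coeff_C_mul] at hk
  have hne : (2 * c * s) ^ (N - b) ≠ 0 := by positivity
  rw [← eq_div_iff hne] at hk
  rw [hk]
  ring

theorem wignerdFormula_eq_dfun {n a b : ℕ} (ha : a ≤ 2 * n) (hb : b ≤ 2 * n) {β : ℝ}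
    (hβ : β ∈ Set.Ioo 0 Real.pi) :
    wignerdFormula n ((b : ℤ) - n) ((a : ℤ) - n) (Real.cos β) = dfun n b a β := by
  have hc : 0 < Real.cos (β / 2) :=
    Real.cos_pos_of_mem_Ioo ⟨by linarith [hβ.1, Real.pi_pos], by linarith [hβ.2]⟩
  have hs : 0 < Real.sin (β / 2) :=
    Real.sin_pos_of_pos_of_lt_pi (by linarith [hβ.1]) (by linarith [hβ.2, hβ.1])
  have i1 : (n : ℤ) + ((b : ℤ) - n) = (b : ℕ) := by ring
  have i2 : (n : ℤ) + ((a : ℤ) - n) = (a : ℕ) := by ring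
  have i3 : (n : ℤ) - ((b : ℤ) - n) = (2 * n - b : ℕ) := by rw [Nat.cast_sub hb]; push_cast; ring
  have i4 : (n : ℤ) - ((a : ℤ) - n) = (2 * n - a : ℕ) := by rw [Nat.cast_sub ha]; push_cast; ring
  have i5 : ((a : ℤ) - n) - ((b : ℤ) - n) = a - b := by ring
  have i6 : ((a : ℤ) - n) + ((b : ℤ) - n) = a + b - (2 * n : ℕ) := by push_cast; ring
  rw [wignerdFormula, i1, i2, i3, i4, i5, i6]
  simp only [Int.toNat_natCast, fact_natCast]
  rw [iteratedDeriv_rodrigues ha hb hc hs, dfun, ycoef, ycoef]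
  have h1 : 1 + Real.cos β = 2 * Real.cos (β / 2) ^ 2 := by
    linear_combination (-2) * cos_half_sq β
  have h2 : 1 - Real.cos β = 2 * Real.sin (β / 2) ^ 2 := by
    linear_combination (-2) * sin_half_sq β
  rw [h1, h2]
  generalize Real.cos (β / 2) = c at *
  generalize Real.sin (β / 2) = s at *
  generalize wig (2 * n) a b β = w
  set M := 2 * n - b with hM
  set L := 2 * n - a with hL
  have hsq : Real.sqrt ((b.factorial : ℝ) * (2 * s ^ 2) ^ ((a : ℤ) - b) /
      ((L.factorial : ℝ) * a.factorial * M.factorial *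
        (2 * c ^ 2) ^ ((a : ℤ) + b - (2 * n : ℕ)))) =
      Real.sqrt (b.factorial * M.factorial) / Real.sqrt (a.factorial * L.factorial) *
        ((2 ^ n * (2 * c * s) ^ M / ((2 * c) ^ a * (2 * s) ^ L)) / M.factorial) := by
    rw [← Real.sqrt_div (by positivity)]
    have hx : (0 : ℝ) ≤ 2 ^ n * (2 * c * s) ^ M / ((2 * c) ^ a * (2 * s) ^ L) / M.factorial := by
      positivity
    rw [← Real.sqrt_sq hx, ← Real.sqrt_mul (by positivity)]
    congr 1
    have hb' : ((2 * n : ℕ) : ℤ) = b + M := by omega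
    have ha' : (a : ℤ) + b - (2 * n : ℕ) = a - M := by omega
    have hn : (2 : ℝ) ^ (2 * n) = 2 ^ b * 2 ^ M := by rw [← pow_add]; congr 1; omega
    have hab : a + L = b + M := by omega
    rw [ha', zpow_sub₀ (by positivity), zpow_sub₀ (by positivity)]
    simp only [zpow_natCast]
    have hab' : ∀ x : ℝ, x ^ a * x ^ L = x ^ b * x ^ M := fun x => by
      rw [← pow_add, ← pow_add, hab]
    have hn' : ((2 : ℝ) ^ n) ^ 2 = 2 ^ b * 2 ^ M := by rw [← pow_mul, mul_comm n 2, hn]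
    have q2 := hab' 2
    have qs := hab' s
    field_simp
    rw [hn']
    calc _ = 2 ^ a * 2 ^ M * (c ^ M) ^ 2 * (c ^ a) ^ 2 * (2 ^ a * 2 ^ L) ^ 2 *
          (s ^ a * s ^ L) ^ 2 := by
          simp only [mul_pow]
          ring
      _ = _ := by
          rw [q2, qs]
          simp only [mul_pow]
          ring
  rw [hsq]
  have e1 : ((-1 : ℝ) ^ L) * (-1) ^ (2 * n + b) = (-1) ^ (n + b) / (-1) ^ (n + a) := by
    rw [eq_div_iff (by positivity), ← pow_add, ← pow_add,
      show L + (2 * n + b) + (n + a) = n + b + 2 * (2 * n) by omega, pow_add _ _ (2 * (2 * n)),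
      pow_mul]
    simp
  have hf : (0 : ℝ) < M.factorial := by positivity
  have hq : (0 : ℝ) < Real.sqrt ((2 * n + 1) / (4 * Real.pi)) := by
    have := Real.pi_pos
    positivity
  have hr : (0 : ℝ) < Real.sqrt (a.factorial * L.factorial) := by positivity
  calc _ = ((-1 : ℝ) ^ L) * (-1) ^ (2 * n + b) *
        (Real.sqrt (b.factorial * M.factorial) / Real.sqrt (a.factorial * L.factorial)) * w := by
        field_simp
    _ = _ := by
        rw [e1]
        field_simp

/-- The endpoints are reached by continuity, since `dfun` is continuous on the closed interval. -/
theorem wignerd_eq_dfun {n a b : ℕ} (ha : a ≤ 2 * n) (hb : b ≤ 2 * n) {β : ℝ}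
    (hβ : β ∈ Set.Icc 0 Real.pi) :
    wignerd n ((b : ℤ) - n) ((a : ℤ) - n) (Real.cos β) = dfun n b a β := by
  have hcont : Continuous fun t => dfun n b a (Real.arccos t) :=
    ((continuous_wig (2 * n) a b).comp Real.continuous_arccos).const_mul _
  refine extendFrom_eq ?_ ?_
  · rw [closure_Ioo (by norm_num)]
    exact Real.cos_mem_Icc β
  · have h := (hcont.tendsto (Real.cos β)).mono_left
      (nhdsWithin_le_nhds (s := Set.Ioo (-1) 1))
    rw [Real.arccos_cos hβ.1 hβ.2] at h
    refine h.congr' ?_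
    filter_upwards [self_mem_nhdsWithin] with t ht
    have h2 := wignerdFormula_eq_dfun ha hb (β := Real.arccos t)
      ⟨Real.arccos_pos.2 ht.2, (Real.arccos_le_pi t).lt_of_ne fun h => ?_⟩
    · rw [Real.cos_arccos ht.1.le ht.2.le] at h2
      exact h2.symm
    · exact absurd (Real.arccos_eq_pi.1 h) (not_le.2 ht.1)

/-- The rotational harmonics are the conjugates of the matrix entries of rotations. -/
theorem conj_wignerD {n a b : ℕ} (ha : a ≤ 2 * n) (hb : b ≤ 2 * n) (Q : SO3) :
    starRingEnd ℂ (wignerD n ((b : ℤ) - n) ((a : ℤ) - n) Q) =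
      eulerEntry n b a (eulerAlpha Q) (eulerBeta Q) (eulerGamma Q) := by
  have hβ : eulerBeta Q ∈ Set.Icc 0 Real.pi := ⟨Real.arccos_nonneg _, Real.arccos_le_pi _⟩
  rw [wignerD, wignerd_eq_dfun ha hb hβ, eulerEntry]
  simp only [map_mul, Complex.conj_ofReal, ← Complex.exp_conj, map_neg, Complex.conj_I,
    Complex.conj_ofReal, neg_neg]
  simp

/-! ### Integrals of spherical harmonics over the semicircle -/

/-- The generating polynomials of spherical harmonics on the semicircle. -/
def semiGen (n b : ℕ) (ϑ : ℝ) : ℝ :=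
  (quad (Real.sin ϑ) (Real.cos ϑ) (Real.sin ϑ) ^ n).coeff b

/-- The integral of `semiGen` against `sin ϑ dϑ` over the semicircle. -/
def semiInt (n b : ℕ) : ℝ := ∫ ϑ in (0 : ℝ)..Real.pi, semiGen n b ϑ * Real.sin ϑ

theorem horiz_sph_zero (ϑ : ℝ) : horiz (sph 0 ϑ) = Real.sin ϑ := by
  apply Complex.ext <;> simp [horiz, sph, -Complex.ofReal_sin]

theorem coeff_genPoly_sph_zero (n b : ℕ) (ϑ : ℝ) :
    (genPoly (sph 0 ϑ) ^ n).coeff b = semiGen n b ϑ := by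
  have h : genPoly (sph 0 ϑ) =
      (quad (Real.sin ϑ) (Real.cos ϑ) (Real.sin ϑ)).map Complex.ofRealHom := by
    have h2 : (sph 0 ϑ).1 2 = Real.cos ϑ := by simp [sph]
    rw [genPoly, horiz_sph_zero, Complex.conj_ofReal, h2]
    simp only [quad, Polynomial.map_sub, Polynomial.map_add, Polynomial.map_mul, map_C,
      Polynomial.map_pow, map_X, map_mul, map_ofNat, Polynomial.map_ofNat,
      Complex.ofRealHom_eq_coe]
  rw [h, ← Polynomial.map_pow, coeff_map]
  rfl

theorem hasCoeffDerivAt_quad (ϑ : ℝ) :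
    HasCoeffDerivAt (fun t => quad (Real.sin t) (Real.cos t) (Real.sin t))
      (quad (Real.cos ϑ) (-Real.sin ϑ) (Real.cos ϑ)) ϑ := by
  have h : ∀ p z b, (quad p z p : ℝ[X]).coeff b =
      p * (X ^ 2 - 1 : ℝ[X]).coeff b + z * (2 * X : ℝ[X]).coeff b := by
    intro p z b
    rw [← coeff_C_mul, ← coeff_C_mul, ← coeff_add]
    congr 1
    simp only [quad, C_mul, map_ofNat]
    ring
  intro b
  simp only [h]
  exact ((Real.hasDerivAt_sin ϑ).mul_const _).add ((Real.hasDerivAt_cos ϑ).mul_const _)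

theorem derivative_quad {R : Type*} [CommRing R] (p z m : R) :
    derivative (quad p z m) = 2 * (C p * X + C z) := by
  simp [quad, map_ofNat]
  ring

theorem coeff_X_sq_mul_derivative {R : Type*} [CommRing R] (G : R[X]) (b : ℕ) :
    (X ^ 2 * derivative G).coeff (b + 1) = b * G.coeff b := by
  rw [pow_two, mul_assoc, coeff_X_mul]
  rcases b with _ | b
  · simp
  · rw [coeff_X_mul, coeff_derivative]
    push_cast
    ring

/-- Infinitesimal rotation about the second axis, on the semicircle. -/
theorem hasDerivAt_semiGen (n b : ℕ) (ϑ : ℝ) :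
    HasDerivAt (semiGen n (b + 1))
      (((2 * n - b) * semiGen n b ϑ - (b + 2) * semiGen n (b + 2) ϑ) / 2) ϑ := by
  refine ((hasCoeffDerivAt_quad ϑ).pow n (b + 1)).congr_deriv ?_
  set Q := quad (Real.sin ϑ) (Real.cos ϑ) (Real.sin ϑ) with hQ
  have hd : derivative (Q ^ n) = n * Q ^ (n - 1) * derivative Q := by
    rw [derivative_pow, C_eq_natCast]
  have hn : (n : ℝ[X]) * Q ^ n = n * Q ^ (n - 1) * Q := by
    rcases n with _ | n
    · simp
    · simp [pow_succ, mul_assoc]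
  have key : 2 * ((n : ℝ[X]) * Q ^ (n - 1) * quad (Real.cos ϑ) (-Real.sin ϑ) (Real.cos ϑ)) =
      2 * ((n : ℝ[X]) * Q ^ n * X) - derivative (Q ^ n) - X ^ 2 * derivative (Q ^ n) := by
    rw [hd, hn, hQ, derivative_quad]
    simp only [quad, C_mul, map_ofNat, C_neg]
    ring
  have h := congrArg (fun F : ℝ[X] => F.coeff (b + 1)) key
  simp only [coeff_sub, coeff_X_sq_mul_derivative, coeff_ofNat_mul, coeff_mul_X,
    coeff_derivative, coeff_natCast_mul] at h
  rw [← mul_assoc] at h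
  simp only [semiGen, ← hQ]
  push_cast at h ⊢
  linarith

/-- Infinitesimal rotation about the third axis, on the semicircle. -/
theorem semiGen_contiguity (n b : ℕ) (ϑ : ℝ) :
    2 * ((b : ℝ) + 1 - n) * (Real.cos ϑ * semiGen n (b + 1) ϑ) =
      Real.sin ϑ * ((2 * n - b) * semiGen n b ϑ + (b + 2) * semiGen n (b + 2) ϑ) := by
  set Q := quad (Real.sin ϑ) (Real.cos ϑ) (Real.sin ϑ) with hQ
  have hd : derivative (Q ^ n) = n * Q ^ (n - 1) * derivative Q := by
    rw [derivative_pow, C_eq_natCast]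
  have hn : (n : ℝ[X]) * Q ^ n = n * Q ^ (n - 1) * Q := by
    rcases n with _ | n
    · simp
    · simp [pow_succ, mul_assoc]
  have key : C (2 * Real.cos ϑ) * (derivative (Q ^ n) * X - (n : ℝ[X]) * Q ^ n) =
      C (Real.sin ϑ) * (2 * ((n : ℝ[X]) * Q ^ n * X) + derivative (Q ^ n) - X ^ 2 * derivative (Q ^ n)) := by
    rw [hd, hn, hQ, derivative_quad]
    simp only [quad, C_mul, map_ofNat]
    ring
  have h := congrArg (fun F : ℝ[X] => F.coeff (b + 1)) key
  simp only [coeff_sub, coeff_add, coeff_C_mul, coeff_X_sq_mul_derivative, coeff_ofNat_mul,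
    coeff_mul_X, coeff_derivative, coeff_natCast_mul] at h
  simp only [semiGen, ← hQ]
  push_cast at h ⊢
  linear_combination h

theorem continuous_coeff_pow {T K : Type*} [TopologicalSpace T] [CommRing K] [TopologicalSpace K]
    [IsTopologicalRing K] {F : T → K[X]} (hF : ∀ b, Continuous fun t => (F t).coeff b) (n b : ℕ) :
    Continuous fun t => (F t ^ n).coeff b := by
  induction n generalizing b with
  | zero => simpa using continuous_const
  | succ n ih =>
    simp only [pow_succ, coeff_mul]
    exact continuous_finsetSum _ fun i _ => (ih i.1).mul (hF i.2)

theorem continuous_coeff_quad_pow {T K : Type*} [TopologicalSpace T] [CommRing K]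
    [TopologicalSpace K] [IsTopologicalRing K] {p z m : T → K} (hp : Continuous p)
    (hz : Continuous z) (hm : Continuous m) (n b : ℕ) :
    Continuous fun t => (quad (p t) (z t) (m t) ^ n).coeff b := by
  refine continuous_coeff_pow (fun b => ?_) n b
  simp only [quad, coeff_sub, coeff_add, coeff_C_mul, coeff_C]
  refine ((hp.mul continuous_const).add ((continuous_const.mul hz).mul continuous_const)).sub ?_
  split_ifs
  exacts [hm, continuous_const]

theorem continuous_semiGen (n b : ℕ) : Continuous (semiGen n b) :=
  continuous_coeff_quad_pow Real.continuous_sin Real.continuous_cos Real.continuous_sin n b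

/-- Integration of the derivative of `semiGen · sin` and elimination of the cosine term. The boundary
terms vanish. -/
theorem semiInt_ladder (n b : ℕ) :
    ((b : ℝ) + 2 - n) * (2 * n - b) * semiInt n b = (b - n) * (b + 2) * semiInt n (b + 2) := by
  have ci : ∀ f : ℝ → ℝ, Continuous f → IntervalIntegrable f volume 0 Real.pi :=
    fun f hf => hf.intervalIntegrable _ _
  have c0 := continuous_semiGen n b
  have c1 := continuous_semiGen n (b + 1)
  have c2 := continuous_semiGen n (b + 2)
  have h1 := intervalIntegral.integral_eq_sub_of_hasDerivAt (a := 0) (b := Real.pi)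
    (fun ϑ _ => (hasDerivAt_semiGen n b ϑ).mul (Real.hasDerivAt_sin ϑ))
    (ci _ (by fun_prop))
  have e1 : ∀ ϑ, ((2 * n - b) * semiGen n b ϑ - (b + 2) * semiGen n (b + 2) ϑ) / 2 * Real.sin ϑ +
      semiGen n (b + 1) ϑ * Real.cos ϑ =
      ((2 * n - b) / 2 * (semiGen n b ϑ * Real.sin ϑ) -
        (b + 2) / 2 * (semiGen n (b + 2) ϑ * Real.sin ϑ)) +
      Real.cos ϑ * semiGen n (b + 1) ϑ := fun ϑ => by ring
  simp only [e1, Pi.mul_apply] at h1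
  rw [intervalIntegral.integral_add (ci _ (by fun_prop)) (ci _ (by fun_prop)),
    intervalIntegral.integral_sub (ci _ (by fun_prop)) (ci _ (by fun_prop)),
    intervalIntegral.integral_const_mul, intervalIntegral.integral_const_mul, ← semiInt,
    ← semiInt] at h1
  have h2 : ∫ ϑ in (0 : ℝ)..Real.pi,
      2 * ((b : ℝ) + 1 - n) * (Real.cos ϑ * semiGen n (b + 1) ϑ) =
      ∫ ϑ in (0 : ℝ)..Real.pi, ((2 * n - b) * (semiGen n b ϑ * Real.sin ϑ) +
        (b + 2) * (semiGen n (b + 2) ϑ * Real.sin ϑ)) := by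
    congr 1
    funext ϑ
    rw [semiGen_contiguity]
    ring
  rw [intervalIntegral.integral_add (ci _ (by fun_prop)) (ci _ (by fun_prop)),
    intervalIntegral.integral_const_mul, intervalIntegral.integral_const_mul,
    intervalIntegral.integral_const_mul, ← semiInt, ← semiInt] at h2
  simp only [Real.sin_pi, Real.sin_zero, mul_zero, sub_zero] at h1
  linear_combination 2 * ((b : ℝ) + 1 - n) * h1 - h2

/-- Descent in the order from `j = n + 1`, where the coefficient vanishes by degree. -/
theorem semiInt_eq_zero_of_odd (j m : ℕ) : semiInt (j + 2 * m + 1) (j + 2 * m + 1 + j) = 0 := by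
  induction m generalizing j with
  | zero =>
    have h := semiInt_ladder (j + 1) (j + 1 + j)
    have h0 : semiInt (j + 1) (j + 1 + j + 2) = 0 := by
      have : ∀ ϑ, semiGen (j + 1) (j + 1 + j + 2) ϑ = 0 := fun ϑ =>
        coeff_eq_zero_of_natDegree_lt ((natDegree_quad_pow_le _ _ _ _).trans_lt (by omega))
      simp [semiInt, this]
    rw [h0, mul_zero] at h
    refine (mul_eq_zero.1 h).resolve_left ?_
    push_cast
    have : (0 : ℝ) < (j + 1 + j + 2 - (j + 1)) * (2 * (j + 1) - (j + 1 + j)) := by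
      ring_nf
      positivity
    exact this.ne'
  | succ m ih =>
    have ih := ih (j + 2)
    rw [show j + 2 + 2 * m + 1 = j + 2 * (m + 1) + 1 by ring,
      show j + 2 * (m + 1) + 1 + (j + 2) = j + 2 * (m + 1) + 1 + j + 2 by ring] at ih
    have h := semiInt_ladder (j + 2 * (m + 1) + 1) (j + 2 * (m + 1) + 1 + j)
    rw [ih, mul_zero] at h
    refine (mul_eq_zero.1 h).resolve_left ?_
    push_cast
    have : (0 : ℝ) < (j + 2 * (m + 1) + 1 + j + 2 - (j + 2 * (m + 1) + 1)) *
        (2 * (j + 2 * (m + 1) + 1) - (j + 2 * (m + 1) + 1 + j)) := by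
      ring_nf
      positivity
    exact this.ne'

theorem semiInt_eq_zero_of_zero {n : ℕ} (hn : n ≠ 0) : semiInt n n = 0 := by
  have h := semiInt_ladder n n
  rw [sub_self, zero_mul, zero_mul] at h
  refine (mul_eq_zero.1 h).resolve_left ?_
  have : (n : ℝ) ≠ 0 := by exact_mod_cast hn
  ring_nf
  simpa using this

open Nat in
theorem integral_sin_pow_eq (n : ℕ) :
    ∫ ϑ in (0 : ℝ)..Real.pi, Real.sin ϑ ^ (n + 1) =
      (n‼ : ℝ) / ((n + 1)‼ : ℝ) * (if Even n then 2 else Real.pi) := by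
  induction n using Nat.twoStepInduction with
  | zero => simp; norm_num
  | one =>
    rw [integral_sin_pow]
    simp
  | more n ih _ =>
    rw [show n + 2 + 1 = (n + 1) + 2 by ring, integral_sin_pow, ih]
    have h1 : Even (n + 2) ↔ Even n := by simp [Nat.even_add]
    simp only [h1, Nat.doubleFactorial_add_two, Real.sin_zero, Real.sin_pi]
    push_cast
    have : ((n + 1)‼ : ℝ) ≠ 0 := by exact_mod_cast (Nat.doubleFactorial_pos _).ne'
    field_simp
    simp
    ring_nf

theorem semiGen_top (n : ℕ) (ϑ : ℝ) : semiGen n (2 * n) ϑ = Real.sin ϑ ^ n := by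
  rw [semiGen, mul_comm, coeff_pow_of_natDegree_le (natDegree_quad_le _ _ _)]
  simp [quad]

open Nat in
theorem mul_doubleFactorial_sub_two {n : ℕ} (hn : n ≠ 0) : n * (n - 2)‼ = n‼ := by
  rcases n with _ | _ | n
  · exact absurd rfl hn
  · simp
  · rw [Nat.doubleFactorial_add_two]
    rfl

open Nat in
theorem factorial_two_mul {m : ℕ} (hm : m ≠ 0) : (2 * m)! = (2 * m)‼ * (2 * m - 1)‼ := by
  obtain ⟨i, rfl⟩ := Nat.exists_eq_succ_of_ne_zero hm
  rw [show 2 * i.succ = 2 * i + 1 + 1 by rw [Nat.succ_eq_add_one]; ring,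
    Nat.factorial_eq_mul_doubleFactorial, Nat.add_sub_cancel]

open Nat in
/-- Descent in the order from `j = n`, where the integral is that of a power of the sine. -/
theorem semiInt_eq (m j : ℕ) (hj : j ≠ 0) :
    semiInt (j + 2 * m) (j + 2 * m + j) =
      2 ^ (j + 2 * m) * (j + 2 * m)! / ((j + 2 * m + j)! : ℝ) *
        ((j * (j + 2 * m - 2)‼ * (j + 2 * m + j - 1)‼ : ℝ) /
          ((2 * m)‼ * (j + 2 * m + 1)‼ : ℝ)) *
        (if Even (j + 2 * m) then 2 else Real.pi) := by
  induction m generalizing j with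
  | zero =>
    have h1 := integral_sin_pow_eq j
    have h2 : semiInt j (j + j) = ∫ ϑ in (0 : ℝ)..Real.pi, Real.sin ϑ ^ (j + 1) := by
      rw [semiInt, ← two_mul]
      simp only [semiGen_top, pow_succ]
    have h3 := mul_doubleFactorial_sub_two hj
    have h4 := factorial_two_mul hj
    rw [Nat.doubleFactorial_two_mul] at h4
    simp only [mul_zero, add_zero]
    rw [h2, h1, ← two_mul, h4, ← h3]
    have p1 : ((2 * j - 1)‼ : ℝ) ≠ 0 := by exact_mod_cast (Nat.doubleFactorial_pos _).ne'
    push_cast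
    have p2 : (j ! : ℝ) ≠ 0 := by positivity
    simp only [Nat.doubleFactorial, Nat.cast_one]
    field_simp
  | succ m ih =>
    have ih := ih (j + 2) (by omega)
    rw [show j + 2 + 2 * m = j + 2 * (m + 1) by ring,
      show j + 2 * (m + 1) + (j + 2) = j + 2 * (m + 1) + j + 2 by ring] at ih
    have h := semiInt_ladder (j + 2 * (m + 1)) (j + 2 * (m + 1) + j)
    rw [ih] at h
    have e1 : (2 * (m + 1))‼ = (2 * m + 2) * (2 * m)‼ := Nat.doubleFactorial_add_two _
    have e2 : (j + 2 * (m + 1) + j + 2 - 1)‼ =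
        (j + 2 * (m + 1) + j + 1) * (j + 2 * (m + 1) + j - 1)‼ := by
      rw [show j + 2 * (m + 1) + j + 2 - 1 = (j + 2 * (m + 1) + j - 1) + 2 by omega,
        Nat.doubleFactorial_add_two]
      congr 1
      omega
    rw [e2, Nat.factorial_succ, Nat.factorial_succ] at h
    rw [e1]
    generalize (if Even (j + 2 * (m + 1)) then (2 : ℝ) else Real.pi) = κ at *
    generalize hN : j + 2 * (m + 1) = N at *
    have hN' : (N : ℝ) = j + 2 * (m + 1) := by rw [← hN]; push_cast; ring
    have p1 : ((N + j)! : ℝ) ≠ 0 := by positivity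
    have p2 : ((N + 1)‼ : ℝ) ≠ 0 := by exact_mod_cast (Nat.doubleFactorial_pos _).ne'
    have p3 : ((2 * m)‼ : ℝ) ≠ 0 := by exact_mod_cast (Nat.doubleFactorial_pos _).ne'
    have p4 : ((j : ℝ) + 2) * (2 * m + 2) ≠ 0 := by positivity
    push_cast at h ⊢
    have e3 : ((N : ℝ) + j + 2 - N) * (2 * N - (N + j)) = (j + 2) * (2 * m + 2) := by
      rw [hN']; ring
    have e4 : (N : ℝ) + j - N = j := by ring
    rw [e3, e4] at h
    refine mul_left_cancel₀ p4 (h.trans ?_)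
    have p5 : (N : ℝ) + j + 1 ≠ 0 := by positivity
    have p6 : (N : ℝ) + j + 1 + 1 ≠ 0 := by positivity
    have e5 : (N : ℝ) + j + 2 = N + j + 1 + 1 := by ring
    rw [e5]
    field_simp

/-! ### The semicircle transform of a spherical harmonic -/

open Nat in
/-- The coefficients `λ_n^j` are the semicircle integrals of the spherical harmonics. -/
theorem lambdaNonneg_eq {n j : ℕ} (hj : j ≤ n) :
    lambdaNonneg n j = 1 / (4 * Real.pi) * (ycoef n (n + j) * semiInt n (n + j)) := by
  have hpi := Real.pi_pos
  rcases Nat.eq_zero_or_pos j with rfl | hj0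
  · rcases Nat.eq_zero_or_pos n with rfl | hn0
    · have h1 : semiInt 0 0 = 2 := by
        simp [semiInt, semiGen]
        norm_num
      have h2 : (4 * Real.pi) ^ (-(3 / 2) : ℝ) =
          1 / (4 * Real.pi) * Real.sqrt (1 / (4 * Real.pi)) := by
        rw [show (-(3 / 2) : ℝ) = -1 + -(1 / 2) by norm_num, Real.rpow_add (by positivity),
          Real.rpow_neg_one, Real.rpow_neg (by positivity), ← Real.sqrt_eq_rpow]
        simp only [one_div, Real.sqrt_inv]
      rw [lambdaNonneg, if_pos ⟨rfl, rfl⟩, Nat.add_zero, h1, h2, ycoef]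
      simp
      ring
    · rw [Nat.add_zero, semiInt_eq_zero_of_zero hn0.ne', lambdaNonneg, if_neg (by omega),
        if_neg (by omega)]
      simp
  · obtain ⟨d, rfl⟩ := Nat.exists_eq_add_of_le hj
    rcases Nat.even_or_odd' d with ⟨m, rfl | rfl⟩
    · have he : Even (j + 2 * m + j) := ⟨j + m, by ring⟩
      rw [lambdaNonneg, if_neg (by omega), if_pos ⟨hj0, hj, he⟩, semiInt_eq m j hj0.ne']
      have e1 : j + 2 * m - j = 2 * m := by omega
      have e2 : 2 * (j + 2 * m) - (j + 2 * m + j) = 2 * m := by omega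
      rw [ycoef, e1, e2]
      have hs := sqrt_mul_factorial ((2 * (j + 2 * m : ℕ) + 1) / (4 * Real.pi)) ((2 * m)!)
        ((j + 2 * m + j)!) (by positivity) (by positivity) (by positivity)
      have hp : ((j + 2 * m + j)! : ℝ) ≠ 0 := by positivity
      have hp2 : ((j + 2 * m)! : ℝ) ≠ 0 := by positivity
      rw [← eq_div_iff hp] at hs
      rw [hs, show j + 2 * m + (j + 2 * m + j) = j + 2 * (j + 2 * m) by ring, pow_add, pow_mul]
      generalize (if Even (j + 2 * m) then (2 : ℝ) else Real.pi) = κ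
      simp only [neg_one_sq, one_pow, mul_one]
      field_simp
    · have he : ¬ Even (j + (2 * m + 1) + j) := by
        rw [Nat.not_even_iff_odd]
        exact ⟨j + m, by ring⟩
      have h := semiInt_eq_zero_of_odd j m
      rw [add_assoc j (2 * m) 1] at h
      rw [lambdaNonneg, if_neg (by omega), if_neg (by tauto), h]
      simp

/-- The integral of a spherical harmonic over the semicircle is given by the coefficients
`λ_n^j`. -/
theorem semicircle_integral_sphericalHarmonic {n a : ℕ} (ha : a ≤ 2 * n) :
    1 / (4 * Real.pi : ℂ) * ∫ ϑ in (0 : ℝ)..Real.pi,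
      sphericalHarmonic n ((a : ℤ) - n) (sph 0 ϑ) * (Real.sin ϑ : ℂ) =
      lambda n ((a : ℤ) - n) := by
  have hnat : ∀ j, j ≤ n → (1 / (4 * Real.pi : ℂ)) * ∫ ϑ in (0 : ℝ)..Real.pi,
      sphericalHarmonic n j (sph 0 ϑ) * (Real.sin ϑ : ℂ) = lambdaNonneg n j := by
    intro j hj
    have e : ∀ ϑ, sphericalHarmonic n j (sph 0 ϑ) * (Real.sin ϑ : ℂ) =
        ((ycoef n (n + j) * (semiGen n (n + j) ϑ * Real.sin ϑ) : ℝ) : ℂ) := by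
      intro ϑ
      rw [sphericalHarmonic_natCast hj, coeff_genPoly_sph_zero]
      push_cast
      ring
    simp only [e]
    rw [intervalIntegral.integral_ofReal, intervalIntegral.integral_const_mul, ← semiInt,
      lambdaNonneg_eq hj]
    push_cast
    ring
  rcases le_total n a with h | h
  · obtain ⟨j, rfl⟩ := Nat.exists_eq_add_of_le h
    have e : (((n + j : ℕ) : ℤ) - n) = j := by push_cast; ring
    rw [e, hnat j (by omega), lambda, if_pos (by positivity), Int.toNat_natCast]
  · obtain ⟨j, rfl⟩ := Nat.exists_eq_add_of_le h
    have hj : j ≤ a + j := by omega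
    have e : ((a : ℤ) - (a + j : ℕ)) = -(j : ℤ) := by push_cast; ring
    have e2 : ∀ ϑ, sphericalHarmonic (a + j) (-(j : ℤ)) (sph 0 ϑ) * (Real.sin ϑ : ℂ) =
        (-1) ^ j * (sphericalHarmonic (a + j) j (sph 0 ϑ) * (Real.sin ϑ : ℂ)) := by
      intro ϑ
      rw [sphericalHarmonic_neg hj, sphericalHarmonic_natCast hj, coeff_genPoly_sph_zero, map_mul,
        Complex.conj_ofReal, Complex.conj_ofReal]
      ring
    rw [e]
    simp only [e2]
    rw [intervalIntegral.integral_const_mul, mul_left_comm, hnat j hj, lambda]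
    rcases Nat.eq_zero_or_pos j with rfl | hj0
    · simp
    · rw [if_neg (by omega), Int.natAbs_neg, Int.natAbs_natCast]
      push_cast
      ring

theorem continuous_horiz : Continuous horiz := by
  have h : ∀ i : Fin 3, Continuous fun ξ : S2 => (ξ.1 i : ℂ) := fun i => by fun_prop
  have e : horiz = fun ξ : S2 => (ξ.1 0 : ℂ) + ξ.1 1 * Complex.I := by
    funext ξ
    apply Complex.ext <;> simp [horiz]
  rw [e]
  exact (h 0).add ((h 1).mul continuous_const)

theorem continuous_sphericalHarmonic {n b : ℕ} (hb : b ≤ 2 * n) :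
    Continuous (sphericalHarmonic n ((b : ℤ) - n)) := by
  have e : sphericalHarmonic n ((b : ℤ) - n) =
      fun ξ => (ycoef n b : ℂ) * (genPoly ξ ^ n).coeff b := funext (sphericalHarmonic_eq hb)
  rw [e]
  have h2 : Continuous fun ξ : S2 => ((ξ.1 2 : ℝ) : ℂ) := by fun_prop
  exact continuous_const.mul (continuous_coeff_quad_pow continuous_horiz h2
    (Complex.continuous_conj.comp continuous_horiz) n b)

theorem semicircle_sphericalHarmonic_eul {n b : ℕ} (hb : b ≤ 2 * n) (α β γ : ℝ) :
    semicircle (sphericalHarmonic n ((b : ℤ) - n)) (eul α β γ) =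
      ∑ a ∈ Finset.range (2 * n + 1), (lambda n ((a : ℤ) - n) : ℂ) * eulerEntry n b a α β γ := by
  have hs : Continuous fun ϑ : ℝ => sph 0 ϑ :=
    continuous_sph.comp (f := fun ϑ : ℝ => ((0 : ℝ), ϑ)) (by fun_prop)
  rw [semicircle]
  simp only [sphericalHarmonic_rotate_eul hb, Finset.sum_mul]
  rw [intervalIntegral.integral_finsetSum, Finset.mul_sum]
  · refine Finset.sum_congr rfl fun a ha => ?_
    have ha' : a ≤ 2 * n := Nat.lt_succ_iff.1 (Finset.mem_range.1 ha)
    simp only [mul_assoc (eulerEntry n b a α β γ)]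
    rw [intervalIntegral.integral_const_mul, mul_left_comm,
      semicircle_integral_sphericalHarmonic ha', mul_comm]
  · intro a ha
    have ha' : a ≤ 2 * n := Nat.lt_succ_iff.1 (Finset.mem_range.1 ha)
    have := (continuous_sphericalHarmonic ha').comp hs
    exact Continuous.intervalIntegrable ((continuous_const.mul this).mul
      (Complex.continuous_ofReal.comp Real.continuous_sin)) _ _

theorem sum_Icc_eq_sum_range {M : Type*} [AddCommMonoid M] (n : ℕ) (f : ℤ → M) :
    ∑ j ∈ Finset.Icc (-(n : ℤ)) n, f j = ∑ a ∈ Finset.range (2 * n + 1), f ((a : ℤ) - n) := by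
  symm
  refine Finset.sum_bij (fun a _ => (a : ℤ) - n) ?_ ?_ ?_ ?_
  · intro a ha
    have := Finset.mem_range.1 ha
    rw [Finset.mem_Icc]
    omega
  · intro a _ a' _ h
    simpa using h
  · intro j hj
    rw [Finset.mem_Icc] at hj
    exact ⟨(j + n).toNat, by rw [Finset.mem_range]; omega, by omega⟩
  · intro a _
    rfl

/-- The transform of a spherical harmonic at every rotation. -/
theorem semicircle_sphericalHarmonic {n b : ℕ} (hb : b ≤ 2 * n) (Q : SO3) :
    semicircle (sphericalHarmonic n ((b : ℤ) - n)) Q =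
      ∑ j ∈ Finset.Icc (-(n : ℤ)) n,
        (lambda n j : ℂ) * starRingEnd ℂ (wignerD n ((b : ℤ) - n) j Q) := by
  conv_lhs => rw [← eul_eulerAngles Q]
  rw [semicircle_sphericalHarmonic_eul hb, sum_Icc_eq_sum_range]
  refine Finset.sum_congr rfl fun a ha => ?_
  rw [conj_wignerD (Nat.lt_succ_iff.1 (Finset.mem_range.1 ha)) hb]

end PolynomialMethods

/-! ### Integration in angular coordinates -/

/-- The coordinate box `[0, 2π] × [0, π]` of the sphere. -/
def box2 : Set (ℝ × ℝ) := Set.Icc 0 (2 * Real.pi) ×ˢ Set.Icc 0 Real.pi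

/-- The coordinate box `[0, 2π] × [0, π] × [0, 2π]` of the rotation group. -/
def box3 : Set (ℝ × ℝ × ℝ) :=
  Set.Icc 0 (2 * Real.pi) ×ˢ Set.Icc 0 Real.pi ×ˢ Set.Icc 0 (2 * Real.pi)

theorem isCompact_box2 : IsCompact box2 := isCompact_Icc.prod isCompact_Icc

theorem isCompact_box3 : IsCompact box3 := isCompact_Icc.prod (isCompact_Icc.prod isCompact_Icc)

theorem isFiniteMeasure_map_withDensity {X Y : Type*} [TopologicalSpace X] [MeasurableSpace X]
    [OpensMeasurableSpace X] [MeasurableSpace Y] (μ : Measure X) [IsFiniteMeasureOnCompacts μ]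
    {K : Set X} (hK : IsCompact K) (hKm : MeasurableSet K) {w : X → ℝ} (hw : Continuous w)
    (T : X → Y) :
    IsFiniteMeasure (((μ.restrict K).withDensity fun x => ENNReal.ofReal (w x)).map T) := by
  have h : Integrable w (μ.restrict K) := hw.continuousOn.integrableOn_compact' hK hKm
  have := isFiniteMeasure_withDensity_ofReal h.2
  exact Measure.isFiniteMeasure_map _ _

theorem integral_map_withDensity {X Y : Type*} [TopologicalSpace X] [MeasurableSpace X]
    [BorelSpace X] [TopologicalSpace Y] [MeasurableSpace Y] [BorelSpace Y] (μ : Measure X)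
    {K : Set X} (hKm : MeasurableSet K) {w : X → ℝ} (hw : Continuous w)
    (hw0 : ∀ x ∈ K, 0 ≤ w x) {T : X → Y} (hT : Continuous T) {F : Y → ℂ} (hF : Continuous F) :
    ∫ y, F y ∂(((μ.restrict K).withDensity fun x => ENNReal.ofReal (w x)).map T) =
      ∫ x in K, (w x : ℂ) * F (T x) ∂μ := by
  rw [integral_map hT.measurable.aemeasurable hF.stronglyMeasurable.aestronglyMeasurable,
    integral_withDensity_eq_integral_toReal_smul
      hw.measurable.ennreal_ofReal (by simp)]
  refine setIntegral_congr_fun hKm fun x hx => ?_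
  simp only [ENNReal.toReal_ofReal (hw0 x hx), Complex.real_smul]

instance : IsFiniteMeasure sphereMeasure :=
  isFiniteMeasure_map_withDensity _ isCompact_box2 isCompact_box2.measurableSet
    (Real.continuous_sin.comp continuous_snd) _

instance : IsFiniteMeasure rotationMeasure :=
  isFiniteMeasure_map_withDensity _ isCompact_box3 isCompact_box3.measurableSet
    (Real.continuous_sin.comp (continuous_fst.comp continuous_snd)) _

theorem integral_sphereMeasure {F : S2 → ℂ} (hF : Continuous F) :
    ∫ ξ, F ξ ∂sphereMeasure = ∫ p in box2, (Real.sin p.2 : ℂ) * F (sph p.1 p.2) :=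
  integral_map_withDensity _ isCompact_box2.measurableSet
    (Real.continuous_sin.comp continuous_snd)
    (fun _ hp => Real.sin_nonneg_of_mem_Icc hp.2) continuous_sph hF

theorem integral_rotationMeasure {F : SO3 → ℂ} (hF : Continuous F) :
    ∫ Q, F Q ∂rotationMeasure = ∫ p in box3, (Real.sin p.2.1 : ℂ) * F (eul p.1 p.2.1 p.2.2) :=
  integral_map_withDensity _ isCompact_box3.measurableSet
    (Real.continuous_sin.comp (continuous_fst.comp continuous_snd))
    (fun _ hp => Real.sin_nonneg_of_mem_Icc hp.2.1) continuous_eul hF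

theorem setIntegral_box2_mul (f g : ℝ → ℂ) :
    ∫ p in box2, f p.1 * g p.2 =
      (∫ φ in (0 : ℝ)..2 * Real.pi, f φ) * ∫ ϑ in (0 : ℝ)..Real.pi, g ϑ := by
  have hpi := Real.pi_pos
  rw [box2, Measure.volume_eq_prod, ← Measure.prod_restrict, integral_prod_mul,
    integral_Icc_eq_integral_Ioc, integral_Icc_eq_integral_Ioc,
    intervalIntegral.integral_of_le (by positivity), intervalIntegral.integral_of_le hpi.le]

theorem setIntegral_box3_mul (f g h : ℝ → ℂ) :
    ∫ p in box3, f p.1 * (g p.2.1 * h p.2.2) =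
      (∫ α in (0 : ℝ)..2 * Real.pi, f α) * ((∫ β in (0 : ℝ)..Real.pi, g β) *
        ∫ γ in (0 : ℝ)..2 * Real.pi, h γ) := by
  have hpi := Real.pi_pos
  rw [box3, Measure.volume_eq_prod, ← Measure.prod_restrict,
    integral_prod_mul f fun q : ℝ × ℝ => g q.1 * h q.2, Measure.volume_eq_prod,
    ← Measure.prod_restrict, integral_prod_mul,
    integral_Icc_eq_integral_Ioc, integral_Icc_eq_integral_Ioc, integral_Icc_eq_integral_Ioc,
    intervalIntegral.integral_of_le (by positivity), intervalIntegral.integral_of_le hpi.le,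
    intervalIntegral.integral_of_le (by positivity)]

theorem integral_exp_conj_mul_exp (k l : ℤ) :
    ∫ α in (0 : ℝ)..2 * Real.pi, starRingEnd ℂ (Complex.exp (Complex.I * k * α)) *
      Complex.exp (Complex.I * l * α) = if k = l then 2 * (Real.pi : ℂ) else 0 := by
  have e : ∀ α : ℝ, starRingEnd ℂ (Complex.exp (Complex.I * k * α)) *
      Complex.exp (Complex.I * l * α) = Complex.exp (Complex.I * (l - k : ℤ) * α) := by
    intro α
    rw [← Complex.exp_conj, ← Complex.exp_add]
    congr 1
    simp
    ring
  simp only [e]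
  split_ifs with h
  · simp [h]
  · have hc : Complex.I * ((l - k : ℤ) : ℂ) ≠ 0 :=
      mul_ne_zero Complex.I_ne_zero (by exact_mod_cast sub_ne_zero.2 (Ne.symm h))
    rw [integral_exp_mul_complex hc]
    have h2 : Complex.exp (Complex.I * ((l - k : ℤ) : ℂ) * ((2 * Real.pi : ℝ) : ℂ)) = 1 := by
      rw [Complex.exp_eq_one_iff]
      exact ⟨l - k, by push_cast; ring⟩
    rw [h2]
    simp

/-- The normalized Wigner functions with fixed orders are orthogonal. -/
theorem integral_dfun_mul_dfun {n m b b' a a' : ℕ} (hb : b ≤ 2 * n) (ha : a ≤ 2 * n)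
    (hb' : b' ≤ 2 * m) (ha' : a' ≤ 2 * m) (hk : (b : ℤ) - n = b' - m) (hj : (a : ℤ) - n = a' - m) :
    ∫ β in (0 : ℝ)..Real.pi, dfun n b a β * dfun m b' a' β * Real.sin β =
      if n = m then 2 / (2 * n + 1 : ℝ) else 0 := by
  have e : ∀ β, dfun n b a β * dfun m b' a' β * Real.sin β =
      (ycoef n b / ycoef n a * (ycoef m b' / ycoef m a')) *
        (wig (2 * n) a b β * wig (2 * m) a' b' β * Real.sin β) := by
    intro β
    rw [dfun, dfun]
    ring
  simp only [e, intervalIntegral.integral_const_mul]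
  rw [← wigInner]
  have hk' : (b : ℝ) - n = b' - m := by exact_mod_cast hk
  have hj' : (a : ℝ) - n = a' - m := by exact_mod_cast hj
  split_ifs with h
  · subst h
    obtain rfl : b = b' := by omega
    obtain rfl : a = a' := by omega
    rw [wigInner_self ha hb, Nat.choose_eq_factorial_div_factorial ha,
      Nat.choose_eq_factorial_div_factorial hb,
      Nat.cast_div (Nat.factorial_mul_factorial_dvd_factorial ha) (by positivity),
      Nat.cast_div (Nat.factorial_mul_factorial_dvd_factorial hb) (by positivity)]
    have hsq : ∀ i : ℕ, i ≤ 2 * n → ycoef n i * ycoef n i =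
        (i.factorial * (2 * n - i).factorial : ℝ) *
        (Real.sqrt ((2 * n + 1) / (4 * Real.pi)) / (2 ^ n * n.factorial)) ^ 2 := by
      intro i _
      have h1 : ((-1 : ℝ) ^ (n + i)) * (-1) ^ (n + i) = 1 := by rw [← mul_pow]; simp
      have h2 := Real.mul_self_sqrt
        (show (0 : ℝ) ≤ i.factorial * (2 * n - i).factorial by positivity)
      rw [ycoef]
      linear_combination (Real.sqrt (i.factorial * (2 * n - i).factorial) *
        Real.sqrt (i.factorial * (2 * n - i).factorial) *
        (Real.sqrt ((2 * n + 1) / (4 * Real.pi)) / (2 ^ n * n.factorial)) ^ 2) * h1 +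
        (Real.sqrt ((2 * n + 1) / (4 * Real.pi)) / (2 ^ n * n.factorial)) ^ 2 * h2
    have hq : (Real.sqrt ((2 * n + 1) / (4 * Real.pi)) / (2 ^ n * n.factorial)) ^ 2 ≠ 0 := by
      have := Real.pi_pos
      positivity
    rw [div_mul_div_comm, hsq b hb, hsq a ha]
    generalize (Real.sqrt ((2 * n + 1) / (4 * Real.pi)) / (2 ^ n * n.factorial)) ^ 2 = q at *
    have p1 : ((a.factorial : ℕ) : ℝ) ≠ 0 := by positivity
    have p2 : ((b.factorial : ℕ) : ℝ) ≠ 0 := by positivity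
    have p3 : (((2 * n - a).factorial : ℕ) : ℝ) ≠ 0 := by positivity
    have p4 : (((2 * n - b).factorial : ℕ) : ℝ) ≠ 0 := by positivity
    have p5 : (((2 * n).factorial : ℕ) : ℝ) ≠ 0 := by positivity
    push_cast
    field_simp
  · rcases lt_or_gt_of_ne h with h | h
    · rw [wigInner_eq_zero h ha hk' hj', mul_zero]
    · rw [wigInner_comm, wigInner_eq_zero h ha' hk'.symm hj'.symm, mul_zero]

theorem continuous_dfun (n b a : ℕ) : Continuous (dfun n b a) :=
  (continuous_wig (2 * n) a b).const_mul _

/-- Orthogonality of the matrix entries of rotations. -/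
theorem integral_eulerEntry_mul {n m b b' a a' : ℕ} (hb : b ≤ 2 * n) (ha : a ≤ 2 * n)
    (hb' : b' ≤ 2 * m) (ha' : a' ≤ 2 * m) :
    ∫ p in box3, (Real.sin p.2.1 : ℂ) * (starRingEnd ℂ (eulerEntry n b a p.1 p.2.1 p.2.2) *
      eulerEntry m b' a' p.1 p.2.1 p.2.2) =
      if n = m ∧ b = b' ∧ a = a' then ((8 * Real.pi ^ 2 / (2 * n + 1) : ℝ) : ℂ) else 0 := by
  have e : ∀ p : ℝ × ℝ × ℝ,
      (Real.sin p.2.1 : ℂ) * (starRingEnd ℂ (eulerEntry n b a p.1 p.2.1 p.2.2) *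
        eulerEntry m b' a' p.1 p.2.1 p.2.2) =
      (starRingEnd ℂ (Complex.exp (Complex.I * ((b : ℤ) - n : ℤ) * p.1)) *
        Complex.exp (Complex.I * ((b' : ℤ) - m : ℤ) * p.1)) *
      (((dfun n b a p.2.1 * dfun m b' a' p.2.1 * Real.sin p.2.1 : ℝ) : ℂ) *
      (starRingEnd ℂ (Complex.exp (Complex.I * ((a : ℤ) - n : ℤ) * p.2.2)) *
        Complex.exp (Complex.I * ((a' : ℤ) - m : ℤ) * p.2.2))) := by
    intro p
    rw [eulerEntry, eulerEntry, map_mul, map_mul, Complex.conj_ofReal]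
    push_cast
    ring
  simp only [e]
  rw [setIntegral_box3_mul (fun x => starRingEnd ℂ (Complex.exp (Complex.I * ((b : ℤ) - n : ℤ) * x)) *
        Complex.exp (Complex.I * ((b' : ℤ) - m : ℤ) * x))
      (fun x => ((dfun n b a x * dfun m b' a' x * Real.sin x : ℝ) : ℂ))
      (fun x => starRingEnd ℂ (Complex.exp (Complex.I * ((a : ℤ) - n : ℤ) * x)) *
        Complex.exp (Complex.I * ((a' : ℤ) - m : ℤ) * x)),
    integral_exp_conj_mul_exp, integral_exp_conj_mul_exp, intervalIntegral.integral_ofReal]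
  by_cases hk : (b : ℤ) - n = b' - m
  · by_cases hj : (a : ℤ) - n = a' - m
    · rw [if_pos hk, if_pos hj, integral_dfun_mul_dfun hb ha hb' ha' hk hj]
      by_cases h : n = m
      · rw [if_pos h, if_pos ⟨h, by omega, by omega⟩]
        push_cast
        ring
      · rw [if_neg h, if_neg (fun h' => h h'.1)]
        simp
    · have hne : ¬ (n = m ∧ b = b' ∧ a = a') := by omega
      rw [if_neg hj, if_neg hne]
      simp
  · have hne : ¬ (n = m ∧ b = b' ∧ a = a') := by omega
    rw [if_neg hk, if_neg hne]
    simp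

theorem continuous_eulerEntry (n b a : ℕ) :
    Continuous fun p : ℝ × ℝ × ℝ => eulerEntry n b a p.1 p.2.1 p.2.2 := by
  have := continuous_dfun n b a
  unfold eulerEntry
  fun_prop

/-- The orthonormality relations, by writing the harmonics as matrix entries with `j = 0`. -/
theorem integral_sphericalHarmonic_mul {n m b b' : ℕ} (hb : b ≤ 2 * n) (hb' : b' ≤ 2 * m) :
    ∫ ξ, starRingEnd ℂ (sphericalHarmonic n ((b : ℤ) - n) ξ) *
      sphericalHarmonic m ((b' : ℤ) - m) ξ ∂sphereMeasure =
      if n = m ∧ b = b' then 1 else 0 := by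
  have hpi := Real.pi_pos
  have hc : Continuous fun ξ => starRingEnd ℂ (sphericalHarmonic n ((b : ℤ) - n) ξ) *
      sphericalHarmonic m ((b' : ℤ) - m) ξ :=
    (Complex.continuous_conj.comp (continuous_sphericalHarmonic hb)).mul
      (continuous_sphericalHarmonic hb')
  rw [integral_sphereMeasure hc]
  have e : ∀ p : ℝ × ℝ,
      (Real.sin p.2 : ℂ) * (starRingEnd ℂ (sphericalHarmonic n ((b : ℤ) - n) (sph p.1 p.2)) *
        sphericalHarmonic m ((b' : ℤ) - m) (sph p.1 p.2)) =
      (starRingEnd ℂ (Complex.exp (Complex.I * ((b : ℤ) - n : ℤ) * p.1)) *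
        Complex.exp (Complex.I * ((b' : ℤ) - m : ℤ) * p.1)) *
      ((Real.sqrt ((2 * n + 1) / (4 * Real.pi)) * Real.sqrt ((2 * m + 1) / (4 * Real.pi)) *
        (dfun n b n p.2 * dfun m b' m p.2 * Real.sin p.2) : ℝ) : ℂ) := by
    intro p
    rw [sphericalHarmonic_sph hb, sphericalHarmonic_sph hb', eulerEntry, eulerEntry, map_mul,
      map_mul, map_mul, Complex.conj_ofReal, Complex.conj_ofReal]
    simp
    ring
  simp only [e]
  rw [setIntegral_box2_mul
      (fun x => starRingEnd ℂ (Complex.exp (Complex.I * ((b : ℤ) - n : ℤ) * x)) *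
        Complex.exp (Complex.I * ((b' : ℤ) - m : ℤ) * x))
      (fun x => ((Real.sqrt ((2 * n + 1) / (4 * Real.pi)) *
        Real.sqrt ((2 * m + 1) / (4 * Real.pi)) *
        (dfun n b n x * dfun m b' m x * Real.sin x) : ℝ) : ℂ)),
    integral_exp_conj_mul_exp, intervalIntegral.integral_ofReal,
    intervalIntegral.integral_const_mul]
  by_cases hk : (b : ℤ) - n = b' - m
  · rw [if_pos hk, integral_dfun_mul_dfun hb (by omega) hb' (by omega) hk (by ring)]
    by_cases h : n = m
    · subst h
      rw [if_pos rfl, if_pos ⟨rfl, by omega⟩, Real.mul_self_sqrt (by positivity)]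
      norm_cast
      field_simp
      ring
    · rw [if_neg h, if_neg (fun h' => h h'.1)]
      simp
  · have hne : ¬ (n = m ∧ b = b') := by omega
    rw [if_neg hk, if_neg hne]
    simp

/-! ### The transforms of spherical harmonics -/

theorem continuous_rotate : Continuous fun p : SO3 × S2 => rotate p.1 p.2 := by
  refine Continuous.subtype_mk ((PiLp.continuous_toLp 2 _).comp ?_) _
  have h1 : Continuous fun p : SO3 × S2 => p.1.1 := continuous_subtype_val.comp continuous_fst
  have h2 : Continuous fun p : SO3 × S2 => p.2.1.ofLp :=
    (PiLp.continuous_ofLp 2 _).comp (continuous_subtype_val.comp continuous_snd)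
  exact h1.matrix_mulVec h2

theorem continuous_semicircleMap :
    Continuous fun p : SO3 × ℝ => rotate p.1 (sph 0 p.2) :=
  continuous_rotate.comp (continuous_fst.prodMk
    (continuous_sph.comp (f := fun p : SO3 × ℝ => ((0 : ℝ), p.2)) (by fun_prop)))

theorem continuous_semicircle {f : S2 → ℂ} (hf : Continuous f) : Continuous (semicircle f) := by
  refine continuous_const.mul
    (intervalIntegral.continuous_parametric_intervalIntegral_of_continuous' ?_ 0 Real.pi)
  have h : Continuous fun p : SO3 × ℝ => (Real.sin p.2 : ℂ) := by fun_prop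
  exact (hf.comp continuous_semicircleMap).mul h

/-- The squared `L²` norm of the transform of a spherical harmonic of degree `n`. -/
def normSq (n : ℕ) : ℝ :=
  8 * Real.pi ^ 2 / (2 * n + 1) * ∑ a ∈ Finset.range (2 * n + 1), lambda n ((a : ℤ) - n) ^ 2

/-- The transforms of spherical harmonics are orthogonal. -/
theorem integral_semicircle_mul {n m b b' : ℕ} (hb : b ≤ 2 * n) (hb' : b' ≤ 2 * m) :
    ∫ Q, starRingEnd ℂ (semicircle (sphericalHarmonic n ((b : ℤ) - n)) Q) *
      semicircle (sphericalHarmonic m ((b' : ℤ) - m)) Q ∂rotationMeasure =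
      if n = m ∧ b = b' then (normSq n : ℂ) else 0 := by
  have hc : Continuous fun Q => starRingEnd ℂ (semicircle (sphericalHarmonic n ((b : ℤ) - n)) Q) *
      semicircle (sphericalHarmonic m ((b' : ℤ) - m)) Q :=
    (Complex.continuous_conj.comp (continuous_semicircle (continuous_sphericalHarmonic hb))).mul
      (continuous_semicircle (continuous_sphericalHarmonic hb'))
  rw [integral_rotationMeasure hc]
  have e : ∀ p : ℝ × ℝ × ℝ, (Real.sin p.2.1 : ℂ) *
      (starRingEnd ℂ (semicircle (sphericalHarmonic n ((b : ℤ) - n)) (eul p.1 p.2.1 p.2.2)) *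
        semicircle (sphericalHarmonic m ((b' : ℤ) - m)) (eul p.1 p.2.1 p.2.2)) =
      ∑ a ∈ Finset.range (2 * n + 1), ∑ a' ∈ Finset.range (2 * m + 1),
        ((lambda n ((a : ℤ) - n) * lambda m ((a' : ℤ) - m) : ℝ) : ℂ) *
        ((Real.sin p.2.1 : ℂ) * (starRingEnd ℂ (eulerEntry n b a p.1 p.2.1 p.2.2) *
          eulerEntry m b' a' p.1 p.2.1 p.2.2)) := by
    intro p
    rw [semicircle_sphericalHarmonic_eul hb, semicircle_sphericalHarmonic_eul hb', map_sum,
      Finset.sum_mul_sum, Finset.mul_sum]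
    refine Finset.sum_congr rfl fun a _ => ?_
    rw [Finset.mul_sum]
    refine Finset.sum_congr rfl fun a' _ => ?_
    rw [map_mul, Complex.conj_ofReal]
    push_cast
    ring
  simp only [e]
  have hint : ∀ a a' : ℕ, IntegrableOn (fun p : ℝ × ℝ × ℝ =>
      ((lambda n ((a : ℤ) - n) * lambda m ((a' : ℤ) - m) : ℝ) : ℂ) *
        ((Real.sin p.2.1 : ℂ) * (starRingEnd ℂ (eulerEntry n b a p.1 p.2.1 p.2.2) *
          eulerEntry m b' a' p.1 p.2.1 p.2.2))) box3 := by
    intro a a'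
    have h1 : Continuous fun p : ℝ × ℝ × ℝ => (Real.sin p.2.1 : ℂ) := by fun_prop
    exact (continuous_const.mul (h1.mul ((Complex.continuous_conj.comp
      (continuous_eulerEntry n b a)).mul (continuous_eulerEntry m b' a')))).continuousOn
        |>.integrableOn_compact isCompact_box3
  rw [integral_finsetSum _ fun a _ => integrable_finsetSum _ fun a' _ => hint a a']
  have h2 : ∀ a ∈ Finset.range (2 * n + 1), ∫ p in box3, ∑ a' ∈ Finset.range (2 * m + 1),
        ((lambda n ((a : ℤ) - n) * lambda m ((a' : ℤ) - m) : ℝ) : ℂ) *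
        ((Real.sin p.2.1 : ℂ) * (starRingEnd ℂ (eulerEntry n b a p.1 p.2.1 p.2.2) *
          eulerEntry m b' a' p.1 p.2.1 p.2.2)) =
      if n = m ∧ b = b' then ((lambda n ((a : ℤ) - n) ^ 2 *
        (8 * Real.pi ^ 2 / (2 * n + 1)) : ℝ) : ℂ) else 0 := by
    intro a ha
    have ha1 : a ≤ 2 * n := Nat.lt_succ_iff.1 (Finset.mem_range.1 ha)
    rw [integral_finsetSum _ fun a' _ => hint a a']
    have h3 : ∀ a' ∈ Finset.range (2 * m + 1), ∫ p in box3,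
        ((lambda n ((a : ℤ) - n) * lambda m ((a' : ℤ) - m) : ℝ) : ℂ) *
        ((Real.sin p.2.1 : ℂ) * (starRingEnd ℂ (eulerEntry n b a p.1 p.2.1 p.2.2) *
          eulerEntry m b' a' p.1 p.2.1 p.2.2)) =
        ((lambda n ((a : ℤ) - n) * lambda m ((a' : ℤ) - m) : ℝ) : ℂ) *
        if n = m ∧ b = b' ∧ a = a' then ((8 * Real.pi ^ 2 / (2 * n + 1) : ℝ) : ℂ) else 0 := by
      intro a' ha'
      rw [integral_const_mul, integral_eulerEntry_mul hb ha1 hb'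
        (Nat.lt_succ_iff.1 (Finset.mem_range.1 ha'))]
    rw [Finset.sum_congr rfl h3]
    split_ifs with h
    · obtain ⟨rfl, rfl⟩ := h
      rw [Finset.sum_eq_single a]
      · rw [if_pos ⟨rfl, rfl, rfl⟩]
        push_cast
        ring
      · intro a' _ h'
        rw [if_neg (fun h => h' h.2.2.symm), mul_zero]
      · intro h
        exact absurd ha h
    · refine Finset.sum_eq_zero fun a' _ => ?_
      rw [if_neg (fun h' => h ⟨h'.1, h'.2.1⟩), mul_zero]
  rw [Finset.sum_congr rfl h2]
  split_ifs with h
  · rw [normSq, ← Complex.ofReal_sum, ← Finset.sum_mul, mul_comm]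
  · simp

section Completeness

open Polynomial

/-! ### Completeness of the spherical harmonics -/

/-- The order `k` as an exponent `b = n + k`. -/
theorem Idx.exists_nat (i : Idx) : ∃ b : ℕ, b ≤ 2 * i.1.1 ∧ i.1.2 = (b : ℤ) - i.1.1 := by
  have h := i.2
  exact ⟨(i.1.2 + i.1.1).toNat, by omega, by omega⟩

theorem Idx.continuous_sphericalHarmonic (i : Idx) :
    Continuous (sphericalHarmonic i.1.1 i.1.2) := by
  obtain ⟨b, hb, h⟩ := i.exists_nat
  rw [h]
  exact SemicircleTransform.continuous_sphericalHarmonic hb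

/-- The spherical harmonics as continuous maps. -/
def harmonicMap (i : Idx) : C(S2, ℂ) := ⟨_, i.continuous_sphericalHarmonic⟩

/-- The linear span of the spherical harmonics. -/
def harmonicSpan : Submodule ℂ C(S2, ℂ) := Submodule.span ℂ (Set.range harmonicMap)

/-- The function `ξ₁ + i ξ₂` as a continuous map. -/
def horizMap : C(S2, ℂ) := ⟨horiz, continuous_horiz⟩

/-- The function `ξ₃` as a continuous map. -/
def vertMap : C(S2, ℂ) := ⟨fun ξ => ((ξ.1 2 : ℝ) : ℂ), by fun_prop⟩

theorem aeval_vertMap_apply (q : ℂ[X]) (ξ : S2) :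
    (aeval vertMap q) ξ = q.eval ((ξ.1 2 : ℝ) : ℂ) := by
  have h := aeval_algHom_apply (ContinuousMap.evalAlgHom ℂ ℂ ξ) vertMap q
  rw [← coe_aeval_eq_eval]
  exact h.symm

/-- The harmonic `Y_n^k` with `k ≥ 0` is `horiz^k` times a polynomial in the third coordinate, the
derivative of order `n + k` of `(x² - 1)ⁿ`. -/
theorem factorial_mul_coeff_genPoly (n k : ℕ) (ξ : S2) :
    ((n + k).factorial : ℂ) * (genPoly ξ ^ n).coeff (n + k) =
      horiz ξ ^ k * (derivative^[n + k] ((X ^ 2 - 1 : ℂ[X]) ^ n)).eval ((ξ.1 2 : ℝ) : ℂ) := by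
  rw [genPoly, coeff_quad_pow_upper, eval_iterate_derivative, horiz_mul_conj, mul_left_comm]
  congr 3
  rw [pow_comp]
  congr 2
  simp [quad, map_ofNat]
  ring

theorem degree_iterate_derivative_legendre (m k : ℕ) :
    (derivative^[m + 2 * k] ((X ^ 2 - 1 : ℂ[X]) ^ (m + k))).degree = m := by
  have hm : ((X ^ 2 - 1 : ℂ[X]) ^ (m + k)).natDegree = m + (m + 2 * k) := by
    rw [natDegree_pow, ← C_1, natDegree_X_pow_sub_C]
    ring
  refine degree_eq_of_le_of_coeff_ne_zero ?_ ?_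
  · refine degree_le_of_natDegree_le ((natDegree_iterate_derivative _ _).trans ?_)
    omega
  · have h1 : ((X ^ 2 - 1 : ℂ[X]) ^ (m + k)).coeff (m + (m + 2 * k)) = 1 := by
      rw [← hm, coeff_natDegree]
      exact ((monic_X_pow_sub_C (1 : ℂ) two_ne_zero).pow (m + k)).leadingCoeff
    rw [coeff_iterate_derivative, h1, nsmul_one, Nat.cast_ne_zero]
    exact (Nat.descFactorial_pos.2 (by omega)).ne'

/-- The derivatives of order `n + k` of `(x² - 1)ⁿ`, for `n ≥ k`, form a polynomial sequence. -/
def legendreSequence (k : ℕ) : Polynomial.Sequence ℂ where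
  elems' m := derivative^[m + 2 * k] ((X ^ 2 - 1 : ℂ[X]) ^ (m + k))
  degree_eq' m := degree_iterate_derivative_legendre m k

/-- The polynomials belonging to a fixed order `k` have all degrees, hence span all polynomials. -/
theorem horizMap_pow_mul_mem (k : ℕ) (q : ℂ[X]) :
    horizMap ^ k * aeval vertMap q ∈ harmonicSpan := by
  have hq : q ∈ Submodule.span ℂ (Set.range (legendreSequence k)) := by
    rw [(legendreSequence k).span fun i =>
      (leadingCoeff_ne_zero.2 ((legendreSequence k).ne_zero i)).isUnit]
    trivial
  induction hq using Submodule.span_induction with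
  | mem q hq =>
    obtain ⟨m, rfl⟩ := hq
    have hi : -((m + k : ℕ) : ℤ) ≤ (k : ℤ) ∧ (k : ℤ) ≤ (m + k : ℕ) := by
      constructor <;> push_cast <;> omega
    have hy : (ycoef (m + k) (m + k + k) : ℂ) ≠ 0 := by exact_mod_cast ycoef_ne_zero _ _
    have e : horizMap ^ k * aeval vertMap (legendreSequence k m) =
        (((m + k + k).factorial : ℂ) / ycoef (m + k) (m + k + k)) •
          harmonicMap ⟨(m + k, (k : ℤ)), hi⟩ := by
      ext ξ
      have h := factorial_mul_coeff_genPoly (m + k) k ξ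
      rw [add_assoc m k k, ← two_mul] at h
      have h2 := sphericalHarmonic_natCast (n := m + k) (k := k) (by omega) ξ
      rw [ContinuousMap.mul_apply, aeval_vertMap_apply, ContinuousMap.smul_apply]
      refine h.symm.trans ?_
      change _ = _ • sphericalHarmonic (m + k) k ξ
      rw [h2, smul_eq_mul, add_assoc m k k, ← two_mul]
      rw [add_assoc m k k, ← two_mul] at hy
      field_simp
    rw [e]
    exact Submodule.smul_mem _ _ (Submodule.subset_span ⟨_, rfl⟩)
  | zero => simp
  | add p q _ _ hp hq =>
    rw [map_add, mul_add]
    exact Submodule.add_mem _ hp hq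
  | smul c p _ hp =>
    rw [map_smul, mul_smul_comm]
    exact Submodule.smul_mem _ _ hp

theorem star_mem_harmonicSpan {f : C(S2, ℂ)} (hf : f ∈ harmonicSpan) : star f ∈ harmonicSpan := by
  induction hf using Submodule.span_induction with
  | mem f hf =>
    obtain ⟨⟨⟨n, k⟩, hk⟩, rfl⟩ := hf
    have hk' : -(n : ℤ) ≤ k ∧ k ≤ n := hk
    have e : star (harmonicMap ⟨(n, k), hk⟩) = ((-1 : ℂ) ^ k.natAbs) •
        harmonicMap ⟨(n, -k), by constructor <;> simp <;> omega⟩ := by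
      ext ξ
      change starRingEnd ℂ (sphericalHarmonic n k ξ) = (-1) ^ k.natAbs * sphericalHarmonic n (-k) ξ
      obtain ⟨j, rfl | rfl⟩ := k.eq_nat_or_neg
      · rw [sphericalHarmonic_neg (by omega), ← mul_assoc, Int.natAbs_natCast, ← mul_pow]
        simp
      · rw [sphericalHarmonic_neg (by omega), neg_neg, Int.natAbs_neg, Int.natAbs_natCast]
        simp
    rw [e]
    exact Submodule.smul_mem _ _ (Submodule.subset_span ⟨_, rfl⟩)
  | zero => simp
  | add p q _ _ hp hq =>
    rw [star_add]
    exact Submodule.add_mem _ hp hq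
  | smul c p _ hp =>
    rw [star_smul]
    exact Submodule.smul_mem _ _ hp

/-- As `horiz · conj horiz = 1 - ξ₃²`, every monomial is a power of `horiz` or of its conjugate times a
polynomial in the third coordinate. -/
theorem monomial_mem_harmonicSpan (a b c : ℕ) :
    horizMap ^ a * star horizMap ^ b * vertMap ^ c ∈ harmonicSpan := by
  have key : ∀ b k c : ℕ,
      horizMap ^ (b + k) * star horizMap ^ b * vertMap ^ c ∈ harmonicSpan := by
    intro b k c
    have h := horizMap_pow_mul_mem k ((1 - X ^ 2) ^ b * X ^ c)
    have e : horizMap * star horizMap = 1 - vertMap ^ 2 := by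
      ext ξ
      refine (horiz_mul_conj ξ).trans ?_
      simp [vertMap]
    simp only [map_mul, map_pow, map_sub, map_one, aeval_X, ← e] at h
    convert h using 1
    ring
  rcases le_total b a with h | h
  · obtain ⟨k, rfl⟩ := Nat.exists_eq_add_of_le h
    exact key b k c
  · obtain ⟨k, rfl⟩ := Nat.exists_eq_add_of_le h
    have h2 := star_mem_harmonicSpan (key a k c)
    have e : star vertMap = vertMap := by
      ext ξ
      exact Complex.conj_ofReal _
    simp only [star_mul', star_pow, star_star, e] at h2
    convert h2 using 1
    ring

/-- The Stone–Weierstrass theorem, for the star subalgebra generated by the coordinates. -/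
theorem harmonicSpan_dense : harmonicSpan.topologicalClosure = ⊤ := by
  set A := StarAlgebra.adjoin ℂ ({horizMap, vertMap} : Set C(S2, ℂ)) with hA
  have hsep : A.SeparatesPoints := by
    intro ξ η hne
    by_contra! h
    refine hne (Subtype.ext ?_)
    have h1 : horiz ξ = horiz η :=
      h horiz ⟨horizMap, StarAlgebra.subset_adjoin _ _ (by simp), rfl⟩
    have h2 : ((ξ.1 2 : ℝ) : ℂ) = ((η.1 2 : ℝ) : ℂ) :=
      h vertMap ⟨vertMap, StarAlgebra.subset_adjoin _ _ (by simp), rfl⟩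
    ext i
    fin_cases i
    · exact congrArg Complex.re h1
    · exact congrArg Complex.im h1
    · exact Complex.ofReal_injective h2
  have hd := ContinuousMap.starSubalgebra_topologicalClosure_eq_top_of_separatesPoints A hsep
  have hle : Subalgebra.toSubmodule A.toSubalgebra ≤ harmonicSpan := by
    rw [hA, StarAlgebra.adjoin_toSubalgebra, Algebra.adjoin_eq_span, Submodule.span_le]
    intro f hf
    suffices h : ∃ a b c : ℕ, f = horizMap ^ a * star horizMap ^ b * vertMap ^ c by
      obtain ⟨a, b, c, rfl⟩ := h
      exact monomial_mem_harmonicSpan a b c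
    have e : star vertMap = vertMap := by
      ext ξ
      exact Complex.conj_ofReal _
    induction hf using Submonoid.closure_induction with
    | mem f hf =>
      rcases hf with (rfl | rfl) | hf
      · exact ⟨1, 0, 0, by simp⟩
      · exact ⟨0, 0, 1, by simp⟩
      · rw [Set.mem_star] at hf
        rcases hf with hf | hf
        · exact ⟨0, 1, 0, by rw [← hf]; simp⟩
        · exact ⟨0, 0, 1, by rw [← star_star f, Set.mem_singleton_iff.1 hf, e]; simp⟩
    | one => exact ⟨0, 0, 0, by simp⟩
    | mul f g _ _ hf hg =>
      obtain ⟨a, b, c, rfl⟩ := hf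
      obtain ⟨a', b', c', rfl⟩ := hg
      exact ⟨a + a', b + b', c + c', by ring⟩
  rw [eq_top_iff]
  intro f _
  have hf : f ∈ A.topologicalClosure := by rw [hd]; trivial
  exact closure_mono hle hf

theorem Idx.memLp_sphericalHarmonic (i : Idx) :
    MemLp (sphericalHarmonic i.1.1 i.1.2) 2 sphereMeasure :=
  (harmonicMap i).memLp sphereMeasure ℂ

theorem span_sphericalHarmonic_dense :
    (Submodule.span ℂ (Set.range fun i : Idx =>
      i.memLp_sphericalHarmonic.toLp)).topologicalClosure = ⊤ := by
  have h := (ContinuousMap.toLp_denseRange ℂ sphereMeasure ℂ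
    (p := 2) (by simp)).topologicalClosure_map_submodule harmonicSpan_dense
  have e : (Submodule.span ℂ (Set.range fun i : Idx => i.memLp_sphericalHarmonic.toLp)) =
      harmonicSpan.map (ContinuousMap.toLp 2 sphereMeasure ℂ : C(S2, ℂ) →L[ℂ] _).toLinearMap := by
    rw [harmonicSpan, Submodule.map_span, ← Set.range_comp]
    rfl
  rw [e]
  exact h

end Completeness

/-! ### Orbits of the rotation group -/

/-- A finite measure on the sphere is determined by its integrals of the spherical harmonics. -/
theorem ext_of_integral_sphericalHarmonic {μ ν : Measure S2} [IsFiniteMeasure μ]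
    [IsFiniteMeasure ν]
    (h : ∀ i, ∫ ξ, harmonicMap i ξ ∂μ = ∫ ξ, harmonicMap i ξ ∂ν) : μ = ν := by
  have hint : ∀ (ρ : Measure S2) [IsFiniteMeasure ρ] (f : C(S2, ℂ)), Integrable f ρ :=
    fun ρ _ f => memLp_one_iff_integrable.1 (f.memLp ρ ℂ)
  have hcont : ∀ (ρ : Measure S2) [IsFiniteMeasure ρ],
      Continuous fun f : C(S2, ℂ) => ∫ ξ, f ξ ∂ρ := by
    intro ρ _
    have h2 := (continuous_integral (μ := ρ) (G := ℂ)).comp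
      (ContinuousMap.toLp (E := ℂ) 1 ρ ℂ).continuous
    refine h2.congr fun f => ?_
    exact integral_congr_ae (ContinuousMap.coeFn_toLp ρ f)
  have hspan : ∀ f ∈ harmonicSpan, ∫ ξ, f ξ ∂μ = ∫ ξ, f ξ ∂ν := by
    intro f hf
    induction hf using Submodule.span_induction with
    | mem f hf =>
      obtain ⟨i, rfl⟩ := hf
      exact h i
    | zero => simp
    | add f g _ _ hf hg =>
      simp only [ContinuousMap.add_apply]
      rw [integral_add (hint μ f) (hint μ g), integral_add (hint ν f) (hint ν g), hf, hg]
    | smul c f _ hf =>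
      simp only [ContinuousMap.smul_apply]
      rw [integral_smul, integral_smul, hf]
  have hall : ∀ f : C(S2, ℂ), ∫ ξ, f ξ ∂μ = ∫ ξ, f ξ ∂ν := by
    intro f
    have hf : f ∈ harmonicSpan.topologicalClosure := by rw [harmonicSpan_dense]; trivial
    have hcl : IsClosed {f : C(S2, ℂ) | ∫ ξ, f ξ ∂μ = ∫ ξ, f ξ ∂ν} :=
      isClosed_eq (hcont μ) (hcont ν)
    exact closure_minimal (fun f hf => hspan f hf) hcl hf
  refine ext_of_forall_integral_eq_of_IsFiniteMeasure fun f => ?_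
  have h3 := hall ⟨fun ξ => ((f ξ : ℝ) : ℂ), by fun_prop⟩
  simp only [ContinuousMap.coe_mk, integral_complex_ofReal] at h3
  exact_mod_cast h3

theorem eulerEntry_zero (α β γ : ℝ) : eulerEntry 0 0 0 α β γ = 1 := by
  have h : ycoef 0 0 ≠ 0 := ycoef_ne_zero 0 0
  simp [eulerEntry, dfun, wig, wigPoly, div_self h]

theorem sphericalHarmonic_zero (ξ : S2) :
    sphericalHarmonic 0 0 ξ = ((1 / Real.sqrt (4 * Real.pi) : ℝ) : ℂ) := by
  have h := sphericalHarmonic_natCast (n := 0) (k := 0) le_rfl ξ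
  simp only [Nat.cast_zero] at h
  rw [h]
  simp [ycoef]

/-- The image of a point under a random rotation is uniformly distributed. Both sides vanish on all
nonconstant harmonics, the left one because the matrix entries are orthogonal to constants. -/
theorem map_rotate_rotationMeasure (ξ : S2) :
    rotationMeasure.map (fun Q => rotate Q ξ) = ENNReal.ofReal (2 * Real.pi) • sphereMeasure := by
  have hpi := Real.pi_pos
  have hc : Continuous fun Q : SO3 => rotate Q ξ :=
    continuous_rotate.comp (continuous_id.prodMk continuous_const)
  have : IsFiniteMeasure (rotationMeasure.map fun Q => rotate Q ξ) :=
    Measure.isFiniteMeasure_map _ _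
  have : IsFiniteMeasure (ENNReal.ofReal (2 * Real.pi) • sphereMeasure) :=
    Measure.smul_finite _ ENNReal.ofReal_ne_top
  refine ext_of_integral_sphericalHarmonic fun i => ?_
  obtain ⟨b, hb, hi⟩ := i.exists_nat
  have hY : ∀ η, harmonicMap i η = sphericalHarmonic i.1.1 ((b : ℤ) - i.1.1) η := fun η =>
    congrArg (fun k => sphericalHarmonic i.1.1 k η) hi
  generalize i.1.1 = n at *
  rw [integral_map hc.measurable.aemeasurable
    (harmonicMap i).continuous.stronglyMeasurable.aestronglyMeasurable, integral_smul_measure,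
    ENNReal.toReal_ofReal (by positivity)]
  simp only [hY]
  have hYc := continuous_sphericalHarmonic hb
  have h1 : ∫ η, sphericalHarmonic n ((b : ℤ) - n) η ∂sphereMeasure =
      if 0 = n ∧ 0 = b then (Real.sqrt (4 * Real.pi) : ℂ) else 0 := by
    have h := integral_sphericalHarmonic_mul (n := 0) (b := 0) (le_refl 0) hb
    simp only [Nat.cast_zero, sub_self, sphericalHarmonic_zero, Complex.conj_ofReal] at h
    rw [integral_const_mul] at h
    have hs : (Real.sqrt (4 * Real.pi) : ℂ) ≠ 0 := by
      have : Real.sqrt (4 * Real.pi) ≠ 0 := by positivity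
      exact_mod_cast this
    push_cast at h
    rw [one_div, inv_mul_eq_iff_eq_mul₀ hs] at h
    rw [h]
    split_ifs <;> simp
  have h2 : ∫ Q, sphericalHarmonic n ((b : ℤ) - n) (rotate Q ξ) ∂rotationMeasure =
      if 0 = n ∧ 0 = b then
        ((8 * Real.pi ^ 2 * (1 / Real.sqrt (4 * Real.pi)) : ℝ) : ℂ) else 0 := by
    have hc2 : Continuous fun Q => sphericalHarmonic n ((b : ℤ) - n) (rotate Q ξ) := hYc.comp hc
    rw [integral_rotationMeasure hc2]
    have e : ∀ p : ℝ × ℝ × ℝ, (Real.sin p.2.1 : ℂ) *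
        sphericalHarmonic n ((b : ℤ) - n) (rotate (eul p.1 p.2.1 p.2.2) ξ) =
        ∑ a ∈ Finset.range (2 * n + 1), sphericalHarmonic n ((a : ℤ) - n) ξ *
          ((Real.sin p.2.1 : ℂ) * (starRingEnd ℂ (eulerEntry 0 0 0 p.1 p.2.1 p.2.2) *
            eulerEntry n b a p.1 p.2.1 p.2.2)) := by
      intro p
      rw [sphericalHarmonic_rotate_eul hb, Finset.mul_sum]
      refine Finset.sum_congr rfl fun a _ => ?_
      rw [eulerEntry_zero, map_one]
      ring
    simp only [e]
    rw [integral_finsetSum]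
    · have h3 : ∀ a ∈ Finset.range (2 * n + 1), ∫ p in box3,
          sphericalHarmonic n ((a : ℤ) - n) ξ *
          ((Real.sin p.2.1 : ℂ) * (starRingEnd ℂ (eulerEntry 0 0 0 p.1 p.2.1 p.2.2) *
            eulerEntry n b a p.1 p.2.1 p.2.2)) = sphericalHarmonic n ((a : ℤ) - n) ξ *
          if 0 = n ∧ 0 = b ∧ 0 = a then ((8 * Real.pi ^ 2 / (2 * (0 : ℕ) + 1) : ℝ) : ℂ) else 0 := by
        intro a ha
        rw [integral_const_mul, integral_eulerEntry_mul (le_refl 0) (le_refl 0) hb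
          (Nat.lt_succ_iff.1 (Finset.mem_range.1 ha))]
      rw [Finset.sum_congr rfl h3]
      split_ifs with h
      · obtain ⟨rfl, rfl⟩ := h
        simp only [Nat.mul_zero, zero_add, Finset.range_one, Finset.sum_singleton, and_self,
          if_true, Nat.cast_zero, sub_self, sphericalHarmonic_zero]
        push_cast
        ring
      · refine Finset.sum_eq_zero fun a _ => ?_
        rw [if_neg (fun h' => h ⟨h'.1, h'.2.1⟩), mul_zero]
    · intro a _
      have h1 : Continuous fun p : ℝ × ℝ × ℝ => (Real.sin p.2.1 : ℂ) := by fun_prop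
      exact (continuous_const.mul (h1.mul ((Complex.continuous_conj.comp
        (continuous_eulerEntry 0 0 0)).mul (continuous_eulerEntry n b a)))).continuousOn
          |>.integrableOn_compact isCompact_box3
  rw [h1, h2]
  split_ifs
  · rw [Complex.real_smul, ← Complex.ofReal_mul]
    congr 1
    have hs : Real.sqrt (4 * Real.pi) ≠ 0 := by positivity
    have h4 := Real.mul_self_sqrt (show (0 : ℝ) ≤ 4 * Real.pi by positivity)
    generalize Real.sqrt (4 * Real.pi) = r at hs h4 ⊢
    rw [mul_one_div, div_eq_iff hs]
    linear_combination -(2 * Real.pi) * h4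
  · simp

/-! ### The transform as an operator on square integrable functions -/

theorem eLpNorm_two_rpow {X : Type*} [MeasurableSpace X] (μ : Measure X) (g : X → ℂ) :
    eLpNorm g 2 μ ^ (2 : ℝ) = ∫⁻ x, ‖g x‖ₑ ^ (2 : ℝ) ∂μ :=
  eLpNorm_nnreal_pow_eq_lintegral (p := 2) two_ne_zero

/-- Integrating out one variable is bounded on `L²`, by the Cauchy–Schwarz inequality. -/
theorem eLpNorm_integral_prod_le {X Y : Type*} [MeasurableSpace X] [MeasurableSpace Y]
    {μ : Measure X} {ν : Measure Y} [SFinite μ] [IsFiniteMeasure ν] {F : X × Y → ℂ}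
    (hF : AEStronglyMeasurable F (μ.prod ν)) :
    eLpNorm (fun x => ∫ y, F (x, y) ∂ν) 2 μ ≤
      ν Set.univ ^ (1 / 2 : ℝ) * eLpNorm F 2 (μ.prod ν) := by
  rw [← ENNReal.rpow_le_rpow_iff two_pos, ENNReal.mul_rpow_of_nonneg _ _ zero_le_two,
    ← ENNReal.rpow_mul, eLpNorm_two_rpow, eLpNorm_two_rpow, lintegral_prod _ (hF.enorm.pow_const 2),
    ← lintegral_const_mul'' _ (hF.enorm.pow_const 2).lintegral_prod_right']
  refine lintegral_mono_ae ?_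
  filter_upwards [hF.prodMk_left] with x hx
  have h1 : ‖∫ y, F (x, y) ∂ν‖ₑ ≤
      eLpNorm (fun y => F (x, y)) 2 ν * ν Set.univ ^ (1 / 2 : ℝ) := by
    refine (enorm_integral_le_lintegral_enorm _).trans ?_
    rw [← eLpNorm_one_eq_lintegral_enorm]
    refine (eLpNorm_le_eLpNorm_mul_rpow_measure_univ (q := 2) one_le_two hx).trans_eq ?_
    norm_num
  refine (ENNReal.rpow_le_rpow h1 zero_le_two).trans_eq ?_
  rw [ENNReal.mul_rpow_of_nonneg _ _ zero_le_two, ← ENNReal.rpow_mul, eLpNorm_two_rpow, mul_comm]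

/-- The measure `sin ϑ dϑ` on `(0, π]`. -/
def zenithMeasure : Measure ℝ :=
  ((volume : Measure ℝ).restrict (Set.Ioc 0 Real.pi)).withDensity
    fun ϑ => ENNReal.ofReal (Real.sin ϑ)

instance : IsFiniteMeasure zenithMeasure :=
  isFiniteMeasure_withDensity_ofReal
    (Real.continuous_sin.integrableOn_Ioc (a := 0) (b := Real.pi)).2

theorem toReal_ofReal_sin_smul {ϑ : ℝ} (h : ϑ ∈ Set.Ioc 0 Real.pi) (z : ℂ) :
    (ENNReal.ofReal (Real.sin ϑ)).toReal • z = z * (Real.sin ϑ : ℂ) := by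
  rw [ENNReal.toReal_ofReal (Real.sin_nonneg_of_mem_Icc ⟨h.1.le, h.2⟩), Complex.real_smul,
    mul_comm]

theorem integral_zenithMeasure (g : ℝ → ℂ) :
    ∫ ϑ, g ϑ ∂zenithMeasure = ∫ ϑ in (0 : ℝ)..Real.pi, g ϑ * (Real.sin ϑ : ℂ) := by
  rw [zenithMeasure, integral_withDensity_eq_integral_toReal_smul (by fun_prop) (by simp),
    intervalIntegral.integral_of_le Real.pi_pos.le]
  exact setIntegral_congr_fun measurableSet_Ioc fun ϑ h => toReal_ofReal_sin_smul h _

theorem integrable_zenithMeasure {g : ℝ → ℂ} :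
    Integrable g zenithMeasure ↔
      IntervalIntegrable (fun ϑ => g ϑ * (Real.sin ϑ : ℂ)) volume 0 Real.pi := by
  rw [zenithMeasure, integrable_withDensity_iff_integrable_smul' (by fun_prop) (by simp),
    intervalIntegrable_iff_integrableOn_Ioc_of_le Real.pi_pos.le]
  exact integrableOn_congr_fun (fun ϑ h => toReal_ofReal_sin_smul h _) measurableSet_Ioc

/-- The point of the rotated semicircle with a given parameter. -/
def semicirclePoint (p : SO3 × ℝ) : S2 := rotate p.1 (sph 0 p.2)

theorem semicircle_eq (f : S2 → ℂ) (Q : SO3) :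
    semicircle f Q = 1 / (4 * Real.pi) * ∫ ϑ, f (semicirclePoint (Q, ϑ)) ∂zenithMeasure := by
  rw [integral_zenithMeasure]
  rfl

/-- The factor by which the semicircle parameterization scales the measures. -/
def semicircleMass : NNReal :=
  Real.toNNReal (2 * Real.pi) * measureUnivNNReal zenithMeasure

/-- The points of the semicircles are uniformly distributed on the sphere: for every fixed
parameter, the rotated points are. -/
theorem measurePreserving_semicirclePoint :
    MeasurePreserving semicirclePoint (rotationMeasure.prod zenithMeasure)
      (semicircleMass • sphereMeasure) := by
  have hm : Measurable semicirclePoint := continuous_semicircleMap.measurable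
  refine ⟨hm, Measure.ext fun s hs => ?_⟩
  have h : ∀ ϑ, rotationMeasure ((fun Q => (Q, ϑ)) ⁻¹' (semicirclePoint ⁻¹' s)) =
      ENNReal.ofReal (2 * Real.pi) * sphereMeasure s := by
    intro ϑ
    have hc : Continuous fun Q : SO3 => rotate Q (sph 0 ϑ) :=
      continuous_rotate.comp (continuous_id.prodMk continuous_const)
    have h2 := congrArg (fun ρ => ρ s) (map_rotate_rotationMeasure (sph 0 ϑ))
    simp only [Measure.map_apply hc.measurable hs, Measure.smul_apply, smul_eq_mul] at h2
    exact h2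
  rw [Measure.map_apply hm hs, Measure.prod_apply_symm (hm hs)]
  simp only [h, lintegral_const, Measure.smul_apply, semicircleMass]
  rw [ENNReal.smul_def, ENNReal.coe_mul, coe_measureUnivNNReal, smul_eq_mul, ENNReal.ofReal]
  ring

/-- A property that holds almost everywhere on the sphere holds almost everywhere on almost every
semicircle. -/
theorem ae_semicirclePoint {p : S2 → Prop} (h : ∀ᵐ ξ ∂sphereMeasure, p ξ) :
    ∀ᵐ Q ∂rotationMeasure, ∀ᵐ ϑ ∂zenithMeasure, p (semicirclePoint (Q, ϑ)) :=
  Measure.ae_ae_of_ae_prod (measurePreserving_semicirclePoint.quasiMeasurePreserving.ae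
    (Measure.ae_smul_measure h _))

theorem semicircle_congr_ae {f g : S2 → ℂ} (h : f =ᵐ[sphereMeasure] g) :
    semicircle f =ᵐ[rotationMeasure] semicircle g := by
  filter_upwards [ae_semicirclePoint h] with Q hQ
  rw [semicircle_eq, semicircle_eq, integral_congr_ae hQ]

theorem memLp_comp_semicirclePoint {f : S2 → ℂ} (hf : MemLp f 2 sphereMeasure) :
    MemLp (f ∘ semicirclePoint) 2 (rotationMeasure.prod zenithMeasure) :=
  (hf.smul_measure (c := (semicircleMass : ENNReal)) ENNReal.coe_ne_top).comp_measurePreserving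
    measurePreserving_semicirclePoint

theorem ae_integrable_semicirclePoint {f : S2 → ℂ} (hf : MemLp f 2 sphereMeasure) :
    ∀ᵐ Q ∂rotationMeasure, Integrable (fun ϑ => f (semicirclePoint (Q, ϑ))) zenithMeasure :=
  ((memLp_comp_semicirclePoint hf).integrable one_le_two).prod_right_ae

/-- A bound of the operator norm of the transform. -/
def semicircleBound : ENNReal :=
  ‖(1 / (4 * Real.pi) : ℂ)‖ₑ * (zenithMeasure Set.univ ^ (1 / 2 : ℝ) *
    (semicircleMass : ENNReal) ^ (1 / 2 : ℝ))

theorem semicircleBound_ne_top : semicircleBound ≠ ⊤ :=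
  ENNReal.mul_ne_top enorm_ne_top (ENNReal.mul_ne_top
    (ENNReal.rpow_ne_top_of_nonneg (by norm_num) (measure_ne_top _ _))
    (ENNReal.rpow_ne_top_of_nonneg (by norm_num) ENNReal.coe_ne_top))

/-- The transform is bounded on square integrable functions. -/
theorem eLpNorm_semicircle_le {f : S2 → ℂ} (hf : MemLp f 2 sphereMeasure) :
    eLpNorm (semicircle f) 2 rotationMeasure ≤
      semicircleBound * eLpNorm f 2 sphereMeasure := by
  have hF := memLp_comp_semicirclePoint hf
  have e : semicircle f = (1 / (4 * Real.pi) : ℂ) •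
      fun Q => ∫ ϑ, (f ∘ semicirclePoint) (Q, ϑ) ∂zenithMeasure :=
    funext fun Q => semicircle_eq f Q
  have h1 : eLpNorm (f ∘ semicirclePoint) 2 (rotationMeasure.prod zenithMeasure) =
      (semicircleMass : ENNReal) ^ (1 / 2 : ℝ) * eLpNorm f 2 sphereMeasure := by
    rw [eLpNorm_comp_measurePreserving
      (hf.1.smul_measure semicircleMass) measurePreserving_semicirclePoint]
    refine (eLpNorm_smul_measure_of_ne_top (by simp) _ (semicircleMass : ENNReal)).trans ?_
    simp
  rw [e, eLpNorm_const_smul, semicircleBound, mul_assoc, mul_assoc, ← h1]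
  gcongr
  exact eLpNorm_integral_prod_le hF.1

theorem memLp_semicircle {f : S2 → ℂ} (hf : MemLp f 2 sphereMeasure) :
    MemLp (semicircle f) 2 rotationMeasure := by
  refine ⟨?_, (eLpNorm_semicircle_le hf).trans_lt
    (ENNReal.mul_lt_top semicircleBound_ne_top.lt_top hf.2)⟩
  have e : semicircle f = (1 / (4 * Real.pi) : ℂ) •
      fun Q => ∫ ϑ, (f ∘ semicirclePoint) (Q, ϑ) ∂zenithMeasure :=
    funext fun Q => semicircle_eq f Q
  rw [e]
  exact (memLp_comp_semicirclePoint hf).1.integral_prod_right'.const_smul _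

/-- The normalized semicircle transform as a bounded operator on square integrable functions. -/
def semicircleCLM : Lp ℂ 2 sphereMeasure →L[ℂ] Lp ℂ 2 rotationMeasure :=
  LinearMap.mkContinuous
    { toFun := fun f => (memLp_semicircle (Lp.memLp f)).toLp
      map_add' := by
        intro f g
        rw [← MemLp.toLp_add, MemLp.toLp_eq_toLp_iff]
        refine (semicircle_congr_ae (Lp.coeFn_add f g)).trans ?_
        filter_upwards [ae_integrable_semicirclePoint (Lp.memLp f),
          ae_integrable_semicirclePoint (Lp.memLp g)] with Q hf hg
        simp only [Pi.add_apply, semicircle_eq]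
        rw [integral_add hf hg, mul_add]
      map_smul' := by
        intro c f
        rw [RingHom.id_apply, ← MemLp.toLp_const_smul, MemLp.toLp_eq_toLp_iff]
        refine (semicircle_congr_ae (Lp.coeFn_smul c f)).trans (Filter.Eventually.of_forall ?_)
        intro Q
        simp only [Pi.smul_apply, semicircle_eq, smul_eq_mul]
        rw [integral_const_mul]
        ring }
    semicircleBound.toReal fun f => by
      change ‖(memLp_semicircle (Lp.memLp f)).toLp‖ ≤ _
      rw [Lp.norm_toLp, Lp.norm_def, ← ENNReal.toReal_mul]
      exact ENNReal.toReal_mono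
        (ENNReal.mul_ne_top semicircleBound_ne_top (Lp.eLpNorm_ne_top f))
        (eLpNorm_semicircle_le (Lp.memLp f))

theorem semicircleCLM_coeFn (f : Lp ℂ 2 sphereMeasure) :
    semicircleCLM f =ᵐ[rotationMeasure] semicircle f :=
  (memLp_semicircle (Lp.memLp f)).coeFn_toLp

theorem semicircleCLM_toLp {f : S2 → ℂ} (hf : MemLp f 2 sphereMeasure) :
    semicircleCLM hf.toLp = (memLp_semicircle hf).toLp := by
  exact (MemLp.toLp_eq_toLp_iff (memLp_semicircle (Lp.memLp hf.toLp)) _).2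
    (semicircle_congr_ae hf.coeFn_toLp)

theorem ae_intervalIntegrable {f : S2 → ℂ} (hf : MemLp f 2 sphereMeasure) :
    ∀ᵐ Q ∂rotationMeasure, IntervalIntegrable
      (fun ϑ : ℝ => f (rotate Q (sph 0 ϑ)) * (Real.sin ϑ : ℂ)) volume 0 Real.pi := by
  filter_upwards [ae_integrable_semicirclePoint hf] with Q hQ
  exact integrable_zenithMeasure.1 hQ

section Asymptotics

open Finset.HasAntidiagonal (antidiagonal)

/-! ### The size of the singular values -/

/-- The coefficients `binom(2i, i) / 4ⁱ` of the power series of `(1 - x)^(-1/2)`. -/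
def binomRatio (i : ℕ) : ℝ := (i.centralBinom : ℝ) / 4 ^ i

theorem succ_mul_binomRatio_succ (i : ℕ) :
    ((i + 1 : ℕ) : ℝ) * binomRatio (i + 1) = (i + 1 / 2) * binomRatio i := by
  have h : ((i + 1 : ℕ) : ℝ) * ((i + 1).centralBinom : ℝ) = 2 * (2 * i + 1) * i.centralBinom := by
    exact_mod_cast Nat.succ_mul_centralBinom_succ i
  rw [binomRatio, binomRatio, ← mul_div_assoc, h, pow_succ]
  field_simp
  ring

/-- Comparison of coefficients in `((1 - x)^(-1/2))² = (1 - x)⁻¹`. -/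
theorem sum_binomRatio (n : ℕ) :
    ∑ p ∈ antidiagonal n, binomRatio p.1 * binomRatio p.2 = 1 := by
  have hsymm : ∀ n : ℕ,
      2 * ∑ p ∈ antidiagonal n, (p.1 : ℝ) * (binomRatio p.1 * binomRatio p.2) =
        n * ∑ p ∈ antidiagonal n, binomRatio p.1 * binomRatio p.2 := by
    intro n
    rw [two_mul]
    nth_rw 1 [← Finset.Nat.sum_antidiagonal_swap]
    rw [← Finset.sum_add_distrib, Finset.mul_sum]
    refine Finset.sum_congr rfl fun p hp => ?_
    rw [← Finset.HasAntidiagonal.mem_antidiagonal.1 hp, Prod.fst_swap, Prod.snd_swap]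
    push_cast
    ring
  induction n with
  | zero => simp [binomRatio]
  | succ n ih =>
    have h := hsymm (n + 1)
    rw [Finset.Nat.sum_antidiagonal_succ] at h
    have e : ∀ p ∈ antidiagonal n,
        ((p.1 + 1 : ℕ) : ℝ) * (binomRatio (p.1 + 1) * binomRatio p.2) =
          (p.1 : ℝ) * (binomRatio p.1 * binomRatio p.2) +
            1 / 2 * (binomRatio p.1 * binomRatio p.2) := by
      intro p _
      rw [← mul_assoc, succ_mul_binomRatio_succ]
      ring
    rw [Finset.sum_congr rfl e, Finset.sum_add_distrib, ← Finset.mul_sum, ih] at h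
    have h2 := hsymm n
    rw [ih] at h2
    have hn : ((n + 1 : ℕ) : ℝ) ≠ 0 := by positivity
    refine mul_left_cancel₀ hn ?_
    rw [← h]
    push_cast
    linarith

/-- Comparison of coefficients in `(x d/dx (1 - x)^(-1/2))² = x² (1 - x)⁻³ / 4`. -/
theorem sum_mul_mul_binomRatio (n : ℕ) :
    ∑ p ∈ antidiagonal n, (p.1 : ℝ) * p.2 * (binomRatio p.1 * binomRatio p.2) =
      n * (n - 1) / 8 := by
  induction n using Nat.twoStepInduction with
  | zero => simp
  | one => simp [Finset.Nat.antidiagonal_succ]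
  | more n ih _ =>
    rw [Finset.Nat.sum_antidiagonal_succ, Finset.Nat.sum_antidiagonal_succ']
    have e : ∀ p ∈ antidiagonal n,
        ((p.1 + 1 : ℕ) : ℝ) * ((p.2 + 1 : ℕ) : ℝ) *
          (binomRatio (p.1 + 1) * binomRatio (p.2 + 1)) =
          (p.1 : ℝ) * p.2 * (binomRatio p.1 * binomRatio p.2) +
            (n / 2 + 1 / 4) * (binomRatio p.1 * binomRatio p.2) := by
      intro p hp
      rw [← Finset.HasAntidiagonal.mem_antidiagonal.1 hp, mul_mul_mul_comm, succ_mul_binomRatio_succ,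
        succ_mul_binomRatio_succ]
      push_cast
      ring
    rw [Finset.sum_congr rfl e, Finset.sum_add_distrib, ← Finset.mul_sum, ih, sum_binomRatio]
    push_cast
    ring

/-- The sum is `n² - 4 ∑ p q c_p c_q`. -/
theorem sum_sq_mul_binomRatio (n : ℕ) :
    ∑ p ∈ antidiagonal n, ((p.1 : ℝ) - p.2) ^ 2 * (binomRatio p.1 * binomRatio p.2) =
      n * (n + 1) / 2 := by
  have e : ∀ p ∈ antidiagonal n,
      ((p.1 : ℝ) - p.2) ^ 2 * (binomRatio p.1 * binomRatio p.2) =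
        n ^ 2 * (binomRatio p.1 * binomRatio p.2) -
          4 * ((p.1 : ℝ) * p.2 * (binomRatio p.1 * binomRatio p.2)) := by
    intro p hp
    rw [← Finset.HasAntidiagonal.mem_antidiagonal.1 hp]
    push_cast
    ring
  rw [Finset.sum_congr rfl e, Finset.sum_sub_distrib, ← Finset.mul_sum, ← Finset.mul_sum,
    sum_binomRatio, sum_mul_mul_binomRatio]
  ring

open Nat in
theorem factorial_div_doubleFactorial_sq (i : ℕ) :
    ((2 * i)! : ℝ) / ((2 * i)‼ : ℝ) ^ 2 = binomRatio i := by
  have h : ((2 * i)! : ℝ) = i.centralBinom * (i ! : ℝ) ^ 2 := by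
    have h1 := Nat.choose_mul_factorial_mul_factorial (show i ≤ 2 * i by omega)
    rw [show 2 * i - i = i by omega] at h1
    rw [Nat.centralBinom, ← h1]
    push_cast
    ring
  have h4 : ((2 : ℝ) ^ i) ^ 2 = 4 ^ i := by rw [← pow_mul, mul_comm, pow_mul]; norm_num
  rw [h, Nat.doubleFactorial_two_mul, binomRatio]
  push_cast
  rw [mul_pow, h4]
  field_simp

open Nat in
theorem doubleFactorial_pred_sq_div_factorial {m : ℕ} (hm : m ≠ 0) :
    ((2 * m - 1)‼ : ℝ) ^ 2 / ((2 * m)! : ℝ) = binomRatio m := by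
  have h : ((2 * m)! : ℝ) = (2 * m)‼ * (2 * m - 1)‼ := by exact_mod_cast factorial_two_mul hm
  rw [← factorial_div_doubleFactorial_sq, h]
  have h1 : ((2 * m)‼ : ℝ) ≠ 0 := by exact_mod_cast (Nat.doubleFactorial_pos _).ne'
  have h2 : ((2 * m - 1)‼ : ℝ) ≠ 0 := by exact_mod_cast (Nat.doubleFactorial_pos _).ne'
  field_simp

/-- The integral of the power `n + 1` of the sine over `[0, π]`. -/
def sinInt (n : ℕ) : ℝ := ∫ ϑ in (0 : ℝ)..Real.pi, Real.sin ϑ ^ (n + 1)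

theorem sinInt_nonneg (n : ℕ) : 0 ≤ sinInt n :=
  intervalIntegral.integral_nonneg Real.pi_pos.le fun _ h =>
    pow_nonneg (Real.sin_nonneg_of_mem_Icc h) _

open Nat in
/-- The Wallis product identity: the product of consecutive integrals telescopes. -/
theorem sinInt_mul_succ (n : ℕ) : sinInt n * sinInt (n + 1) = 2 * Real.pi / (n + 2) := by
  rw [sinInt, sinInt, integral_sin_pow_eq, integral_sin_pow_eq, Nat.doubleFactorial_add_two n]
  have h1 : (n‼ : ℝ) ≠ 0 := by exact_mod_cast (Nat.doubleFactorial_pos _).ne'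
  have h2 : ((n + 1)‼ : ℝ) ≠ 0 := by exact_mod_cast (Nat.doubleFactorial_pos _).ne'
  have h3 : (n : ℝ) + 2 ≠ 0 := by positivity
  have h4 : (if Even n then (2 : ℝ) else Real.pi) * (if Even (n + 1) then 2 else Real.pi) =
      2 * Real.pi := by
    by_cases h : Even n
    · rw [if_pos h, if_neg (by simpa [Nat.even_add_one] using h)]
    · rw [if_neg h, if_pos (by simpa [Nat.even_add_one] using h), mul_comm]
  rw [← h4]
  push_cast
  field_simp

theorem sinInt_succ_le (n : ℕ) : sinInt (n + 1) ≤ sinInt n :=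
  integral_sin_pow_succ_le (n + 1)

theorem sinInt_sq_ge (n : ℕ) : 2 * Real.pi / (n + 2) ≤ sinInt n ^ 2 := by
  rw [← sinInt_mul_succ, sq]
  exact mul_le_mul_of_nonneg_left (sinInt_succ_le n) (sinInt_nonneg n)

theorem sinInt_sq_le {n : ℕ} (hn : n ≠ 0) : sinInt n ^ 2 ≤ 2 * Real.pi / (n + 1) := by
  obtain ⟨m, rfl⟩ := Nat.exists_eq_succ_of_ne_zero hn
  have h := sinInt_mul_succ m
  have h2 := mul_le_mul_of_nonneg_right (sinInt_succ_le m) (sinInt_nonneg (m + 1))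
  rw [h] at h2
  rw [sq]
  refine h2.trans_eq ?_
  push_cast
  ring

open Nat in
/-- The double factorials combine to central binomial coefficients and a power integral of the sine. -/
theorem lambdaNonneg_sq {i j : ℕ} (hj : j ≠ 0) :
    lambdaNonneg (j + 2 * i) j ^ 2 =
      (2 * (j + 2 * i : ℕ) + 1) / (64 * Real.pi ^ 3) *
        (sinInt (j + 2 * i) / (j + 2 * i : ℕ)) ^ 2 *
        ((j : ℝ) ^ 2 * (binomRatio (j + i) * binomRatio i)) := by
  have hpi := Real.pi_pos
  have he : Even (j + 2 * i + j) := ⟨j + i, by ring⟩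
  have e1 : j + 2 * i - j = 2 * i := by omega
  have e2 : j + 2 * i + j = 2 * (j + i) := by ring
  rw [lambdaNonneg, if_neg (by omega), if_pos ⟨by omega, by omega, he⟩, e1, e2,
    ← factorial_div_doubleFactorial_sq i,
    ← doubleFactorial_pred_sq_div_factorial (show j + i ≠ 0 by omega), sinInt,
    integral_sin_pow_eq]
  have hn : ((j + 2 * i : ℕ) : ℝ) ≠ 0 := by exact_mod_cast (show j + 2 * i ≠ 0 by omega)
  have h3 : ((j + 2 * i : ℕ) : ℝ) * ((j + 2 * i - 2)‼ : ℝ) = ((j + 2 * i)‼ : ℝ) := by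
    exact_mod_cast mul_doubleFactorial_sub_two (show j + 2 * i ≠ 0 by omega)
  rw [← h3]
  generalize j + 2 * i = n at *
  generalize (if Even n then (2 : ℝ) else Real.pi) = c
  have p1 : ((2 * i)‼ : ℝ) ≠ 0 := by exact_mod_cast (Nat.doubleFactorial_pos _).ne'
  have p2 : ((n + 1)‼ : ℝ) ≠ 0 := by exact_mod_cast (Nat.doubleFactorial_pos _).ne'
  rw [mul_pow, mul_pow, mul_pow, Real.sq_sqrt (by positivity), div_pow, ← pow_mul, mul_comm j 2,
    pow_mul, neg_one_sq, one_pow]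
  field_simp
  ring

theorem lambda_neg_sq (n : ℕ) (j : ℤ) : lambda n (-j) ^ 2 = lambda n j ^ 2 := by
  have h : ∀ k : ℕ, lambda n (-(k : ℤ)) ^ 2 = lambda n k ^ 2 := by
    intro k
    rcases Nat.eq_zero_or_pos k with rfl | hk
    · simp
    · rw [lambda, if_neg (by omega), lambda, if_pos (by positivity), mul_pow, ← pow_mul, mul_comm _ 2,
        pow_mul, neg_one_sq, one_pow, one_mul]
      simp
  obtain ⟨k, rfl | rfl⟩ := j.eq_nat_or_neg
  · exact h k
  · rw [neg_neg, h k]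

theorem lambda_sq_of_odd {n a : ℕ} (ha : Odd a) : lambda n ((a : ℤ) - n) ^ 2 = 0 := by
  have h : ∀ k : ℕ, Odd (n + k) → lambda n k ^ 2 = 0 := by
    intro k hk
    rw [lambda, if_pos (by positivity), Int.toNat_natCast, lambdaNonneg, if_neg, if_neg]
    · simp
    · exact fun h => (Nat.not_even_iff_odd.2 hk) h.2.2
    · rintro ⟨rfl, rfl⟩
      simp at hk
  rcases le_total n a with hn | hn
  · obtain ⟨k, rfl⟩ := Nat.exists_eq_add_of_le hn
    rw [Nat.cast_add, add_sub_cancel_left, h k ha]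
  · obtain ⟨k, rfl⟩ := Nat.exists_eq_add_of_le hn
    rw [Nat.cast_add, sub_add_cancel_left, lambda_neg_sq, h k]
    obtain ⟨m, rfl⟩ := ha
    exact ⟨m + k, by ring⟩

/-- For indices `p + q = n` the order `j = 2p - n` equals `p - q`. -/
theorem lambda_sq {n : ℕ} (hn : n ≠ 0) {p : ℕ × ℕ} (hp : p ∈ antidiagonal n) :
    lambda n ((2 * p.1 : ℕ) - (n : ℤ)) ^ 2 =
      (2 * n + 1) / (64 * Real.pi ^ 3) * (sinInt n / n) ^ 2 *
        (((p.1 : ℝ) - p.2) ^ 2 * (binomRatio p.1 * binomRatio p.2)) := by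
  have h : ∀ i j : ℕ, j + 2 * i ≠ 0 → lambda (j + 2 * i) j ^ 2 =
      (2 * (j + 2 * i : ℕ) + 1) / (64 * Real.pi ^ 3) *
        (sinInt (j + 2 * i) / (j + 2 * i : ℕ)) ^ 2 *
        ((j : ℝ) ^ 2 * (binomRatio (j + i) * binomRatio i)) := by
    intro i j hij
    rw [lambda, if_pos (by positivity), Int.toNat_natCast]
    rcases Nat.eq_zero_or_pos j with rfl | hj
    · rw [lambdaNonneg, if_neg (by omega), if_neg (by omega)]
      simp
    · exact lambdaNonneg_sq hj.ne'
  obtain ⟨x, y⟩ := p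
  obtain rfl : x + y = n := Finset.HasAntidiagonal.mem_antidiagonal.1 hp
  rcases le_total y x with hxy | hxy
  · obtain ⟨j, rfl⟩ := Nat.exists_eq_add_of_le hxy
    have h1 := h y j (by omega)
    have e : ((2 * (y + j) : ℕ) : ℤ) - ((y + j + y : ℕ) : ℤ) = j := by push_cast; ring
    have e2 : y + j + y = j + 2 * y := by ring
    simp only [e]
    rw [e2, h1, add_comm y j]
    push_cast
    ring
  · obtain ⟨j, rfl⟩ := Nat.exists_eq_add_of_le hxy
    have h1 := h x j (by omega)
    have e : ((2 * x : ℕ) : ℤ) - ((x + (x + j) : ℕ) : ℤ) = -j := by push_cast; ring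
    have e2 : x + (x + j) = j + 2 * x := by ring
    simp only [e]
    rw [e2, lambda_neg_sq, h1, add_comm x j]
    push_cast
    ring

theorem sum_range_even_add_odd (f : ℕ → ℝ) (n : ℕ) (hf : ∀ a, Odd a → f a = 0) :
    ∑ a ∈ Finset.range (2 * n + 1), f a = ∑ p ∈ antidiagonal n, f (2 * p.1) := by
  rw [Finset.Nat.sum_antidiagonal_eq_sum_range_succ_mk]
  induction n with
  | zero => simp
  | succ n ih =>
    rw [Finset.sum_range_succ _ (n + 1), ← ih, show 2 * (n + 1) + 1 = 2 * n + 1 + 1 + 1 by ring,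
      Finset.sum_range_succ, Finset.sum_range_succ, hf (2 * n + 1) ⟨n, rfl⟩, add_zero]
    rfl

/-- The closed form of the squared singular values of positive degree. -/
theorem normSq_eq {n : ℕ} (hn : n ≠ 0) :
    normSq n = (n + 1) / (16 * Real.pi * n) * sinInt n ^ 2 := by
  have hpi := Real.pi_pos
  have hn' : (n : ℝ) ≠ 0 := by exact_mod_cast hn
  rw [normSq, sum_range_even_add_odd (fun a => lambda n ((a : ℤ) - n) ^ 2) n
    fun a ha => lambda_sq_of_odd ha, Finset.sum_congr rfl fun p hp => lambda_sq hn hp,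
    ← Finset.mul_sum, sum_sq_mul_binomRatio]
  field_simp
  ring

theorem normSq_zero : normSq 0 = 1 / (2 * Real.pi) := by
  have hpi := Real.pi_pos
  have h : ((4 * Real.pi) ^ (-(3 / 2) : ℝ)) ^ 2 = 1 / (4 * Real.pi) ^ 3 := by
    rw [← Real.rpow_natCast, ← Real.rpow_mul (by positivity), one_div, ← Real.rpow_natCast,
      ← Real.rpow_neg (by positivity)]
    norm_num
  simp only [normSq, Nat.mul_zero, zero_add, Finset.range_one, Finset.sum_singleton,
    Nat.cast_zero, sub_self, lambda, le_refl, if_true, Int.toNat_zero, lambdaNonneg, and_self,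
    mul_pow, h]
  field_simp
  norm_num

theorem normSq_bounds (n : ℕ) :
    1 / (8 * ((n : ℝ) + 1)) ≤ normSq n ∧ normSq n ≤ 1 / (4 * ((n : ℝ) + 1)) := by
  have hpi := Real.pi_pos
  rcases eq_or_ne n 0 with rfl | hn
  · have h3 := Real.pi_gt_three
    have h4 := Real.pi_le_four
    rw [normSq_zero]
    constructor
    · refine one_div_le_one_div_of_le (by positivity) ?_
      push_cast
      linarith
    · refine one_div_le_one_div_of_le (by positivity) ?_
      push_cast
      linarith
  · have hn1 : (1 : ℝ) ≤ n := by exact_mod_cast Nat.one_le_iff_ne_zero.2 hn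
    have hn0 : (0 : ℝ) < n := by linarith
    rw [normSq_eq hn]
    have hc : 0 ≤ ((n : ℝ) + 1) / (16 * Real.pi * n) := by positivity
    constructor
    · refine le_trans ?_ (mul_le_mul_of_nonneg_left (sinInt_sq_ge n) hc)
      rw [div_mul_div_comm, div_le_div_iff₀ (by positivity) (by positivity)]
      have : 0 ≤ Real.pi := hpi.le
      nlinarith
    · refine (mul_le_mul_of_nonneg_left (sinInt_sq_le hn) hc).trans ?_
      rw [div_mul_div_comm, div_le_div_iff₀ (by positivity) (by positivity)]
      have h : 0 ≤ Real.pi * (((n : ℝ) + 1) * (n - 1)) :=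
        mul_nonneg hpi.le (mul_nonneg (by linarith) (by linarith))
      nlinarith

end Asymptotics

/-! ### The singular value decomposition -/

theorem inner_toLp {X : Type*} [MeasurableSpace X] {μ : Measure X} {f g : X → ℂ}
    (hf : MemLp f 2 μ) (hg : MemLp g 2 μ) :
    inner ℂ hf.toLp hg.toLp = ∫ x, starRingEnd ℂ (f x) * g x ∂μ := by
  rw [L2.inner_def]
  refine integral_congr_ae ?_
  filter_upwards [hf.coeFn_toLp, hg.coeFn_toLp] with x h1 h2
  rw [h1, h2, RCLike.inner_apply, mul_comm]

theorem Idx.integral_sphericalHarmonic_mul (i i' : Idx) :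
    ∫ ξ, starRingEnd ℂ (sphericalHarmonic i.1.1 i.1.2 ξ) * sphericalHarmonic i'.1.1 i'.1.2 ξ
      ∂sphereMeasure = if i = i' then 1 else 0 := by
  obtain ⟨b, hb, h⟩ := i.exists_nat
  obtain ⟨b', hb', h'⟩ := i'.exists_nat
  simp only [h, h']
  rw [SemicircleTransform.integral_sphericalHarmonic_mul hb hb']
  refine if_congr ?_ rfl rfl
  rw [Subtype.ext_iff, Prod.ext_iff]
  omega

theorem Idx.integral_semicircle_mul (i i' : Idx) :
    ∫ Q, starRingEnd ℂ (semicircle (sphericalHarmonic i.1.1 i.1.2) Q) *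
      semicircle (sphericalHarmonic i'.1.1 i'.1.2) Q ∂rotationMeasure =
      if i = i' then (normSq i.1.1 : ℂ) else 0 := by
  obtain ⟨b, hb, h⟩ := i.exists_nat
  obtain ⟨b', hb', h'⟩ := i'.exists_nat
  simp only [h, h']
  rw [SemicircleTransform.integral_semicircle_mul hb hb']
  refine if_congr ?_ rfl rfl
  rw [Subtype.ext_iff, Prod.ext_iff]
  omega

theorem orthonormal_sphericalHarmonic :
    Orthonormal ℂ fun i : Idx => i.memLp_sphericalHarmonic.toLp := by
  classical
  rw [orthonormal_iff_ite]
  intro i i'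
  rw [inner_toLp, i.integral_sphericalHarmonic_mul]

theorem Idx.memLp_semicircle (i : Idx) :
    MemLp (semicircle (sphericalHarmonic i.1.1 i.1.2)) 2 rotationMeasure :=
  SemicircleTransform.memLp_semicircle i.memLp_sphericalHarmonic

theorem normSq_pos (n : ℕ) : 0 < normSq n :=
  lt_of_lt_of_le (by positivity) (normSq_bounds n).1

theorem Idx.norm_semicircle (i : Idx) : ‖i.memLp_semicircle.toLp‖ = Real.sqrt (normSq i.1.1) := by
  have h : ((‖i.memLp_semicircle.toLp‖ : ℂ)) ^ 2 = normSq i.1.1 := by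
    refine (inner_self_eq_norm_sq_to_K (𝕜 := ℂ) i.memLp_semicircle.toLp).symm.trans ?_
    rw [inner_toLp, i.integral_semicircle_mul, if_pos rfl]
  rw [← Real.sqrt_sq (norm_nonneg i.memLp_semicircle.toLp)]
  congr 1
  exact_mod_cast h

/-- The singular value is defined with the order `k = 0`; the norm of the transform is the same for all
orders. -/
theorem singularValue_eq (n : ℕ) : singularValue n = Real.sqrt (normSq n) := by
  rw [← Idx.norm_semicircle ⟨(n, 0), by simp⟩, Lp.norm_toLp]
  rfl

theorem singularValue_pos (n : ℕ) : 0 < singularValue n := by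
  rw [singularValue_eq]
  exact Real.sqrt_pos.2 (normSq_pos n)

theorem Idx.semicircle_eq (i : Idx) (Q : SO3) :
    semicircle (sphericalHarmonic i.1.1 i.1.2) Q =
      (singularValue i.1.1 : ℂ) * Z i.1.1 i.1.2 Q := by
  have hs : (singularValue i.1.1 : ℂ) ≠ 0 := by exact_mod_cast (singularValue_pos _).ne'
  obtain ⟨b, hb, h⟩ := i.exists_nat
  rw [Z, mul_inv_cancel_left₀ hs, h, semicircle_sphericalHarmonic hb]

theorem Idx.Z_eq (i : Idx) :
    Z i.1.1 i.1.2 =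
      (singularValue i.1.1 : ℂ)⁻¹ • semicircle (sphericalHarmonic i.1.1 i.1.2) := by
  have hs : (singularValue i.1.1 : ℂ) ≠ 0 := by exact_mod_cast (singularValue_pos _).ne'
  funext Q
  rw [Pi.smul_apply, smul_eq_mul, i.semicircle_eq, inv_mul_cancel_left₀ hs]

theorem Idx.memLp_Z (i : Idx) : MemLp (Z i.1.1 i.1.2) 2 rotationMeasure := by
  rw [i.Z_eq]
  exact i.memLp_semicircle.const_smul _

theorem orthonormal_Z : Orthonormal ℂ fun i : Idx => i.memLp_Z.toLp := by
  classical
  rw [orthonormal_iff_ite]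
  intro i i'
  have e : ∀ Q, starRingEnd ℂ (Z i.1.1 i.1.2 Q) * Z i'.1.1 i'.1.2 Q =
      ((singularValue i.1.1)⁻¹ * (singularValue i'.1.1)⁻¹ : ℝ) *
        (starRingEnd ℂ (semicircle (sphericalHarmonic i.1.1 i.1.2) Q) *
          semicircle (sphericalHarmonic i'.1.1 i'.1.2) Q) := by
    intro Q
    rw [i.Z_eq, i'.Z_eq]
    simp only [Pi.smul_apply, smul_eq_mul, map_mul, map_inv₀, Complex.conj_ofReal]
    push_cast
    ring
  rw [inner_toLp]
  simp only [e]
  rw [integral_const_mul, i.integral_semicircle_mul]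
  split_ifs with h
  · subst h
    have hs := (singularValue_pos i.1.1).ne'
    have h2 : normSq i.1.1 = singularValue i.1.1 * singularValue i.1.1 := by
      rw [singularValue_eq, Real.mul_self_sqrt (normSq_pos _).le]
    rw [← Complex.ofReal_mul, h2]
    norm_cast
    field_simp
  · rw [mul_zero]

theorem semicircleCLM_sphericalHarmonic (i : Idx) :
    semicircleCLM i.memLp_sphericalHarmonic.toLp =
      (singularValue i.1.1 : ℂ) • i.memLp_Z.toLp := by
  rw [semicircleCLM_toLp, ← MemLp.toLp_const_smul, MemLp.toLp_eq_toLp_iff]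
  exact Filter.Eventually.of_forall i.semicircle_eq

theorem singularValue_bounds (n : ℕ) :
    Real.sqrt (1 / 8) * ((n : ℝ) + 1) ^ (-(1 / 2) : ℝ) ≤ singularValue n ∧
      singularValue n ≤ Real.sqrt (1 / 4) * ((n : ℝ) + 1) ^ (-(1 / 2) : ℝ) := by
  have hn : (0 : ℝ) ≤ (n : ℝ) + 1 := by positivity
  have h := normSq_bounds n
  have e : ∀ c : ℝ, 0 < c → Real.sqrt (1 / c) * ((n : ℝ) + 1) ^ (-(1 / 2) : ℝ) =
      Real.sqrt (1 / (c * ((n : ℝ) + 1))) := by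
    intro c hc
    rw [Real.rpow_neg hn, ← Real.sqrt_eq_rpow, ← Real.sqrt_inv, ← Real.sqrt_mul (by positivity)]
    congr 1
    rw [one_div, one_div, mul_inv]
  rw [e 8 (by norm_num), e 4 (by norm_num), singularValue_eq]
  exact ⟨Real.sqrt_le_sqrt h.1, Real.sqrt_le_sqrt h.2⟩

end

end SemicircleTransform

theorem mainTheorem3 :
    ∃ (W : Lp ℂ 2 sphereMeasure →L[ℂ]
          Lp ℂ 2 rotationMeasure)
      (hY : ∀ i : Idx,
        MemLp (sphericalHarmonic i.1.1 i.1.2) 2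
          sphereMeasure)
      (hZ : ∀ i : Idx,
        MemLp (Z i.1.1 i.1.2) 2 rotationMeasure),
      -- `W` is the normalized semicircle transform on `L²`
      (∀ f : Lp ℂ 2 sphereMeasure,
        ∀ᵐ Q ∂rotationMeasure,
          IntervalIntegrable
            (fun ϑ : ℝ => f (rotate Q (sph 0 ϑ)) *
              (Real.sin ϑ : ℂ)) volume 0 Real.pi ∧
          W f Q = semicircle f Q) ∧
      -- the spherical harmonics are an orthonormal basis of `L²(S²)`
      Orthonormal ℂ (fun i : Idx => (hY i).toLp) ∧
      (Submodule.span ℂ (Set.range fun i : Idx =>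
        (hY i).toLp)).topologicalClosure = ⊤ ∧
      -- the functions `Z_n^k` are orthonormal in `L²(SO(3))`
      Orthonormal ℂ (fun i : Idx => (hZ i).toLp) ∧
      -- `W Y_n^k = w_n Z_n^k`, in `L²` and pointwise, where `w_n` is the norm of `W Y_n^k`
      (∀ i : Idx,
        W (hY i).toLp = (singularValue i.1.1 : ℂ) • (hZ i).toLp ∧
        ‖W (hY i).toLp‖ = singularValue i.1.1 ∧
        ∀ Q : SO3,
          semicircle
              (sphericalHarmonic i.1.1 i.1.2) Q =
            (singularValue i.1.1 : ℂ) *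
              Z i.1.1 i.1.2 Q) ∧
      -- the two-sided bound of the singular values
      ∃ C₁ C₂ : ℝ, 0 < C₁ ∧ 0 < C₂ ∧ ∀ n : ℕ,
        C₁ * ((n : ℝ) + 1) ^ (-(1 / 2) : ℝ) ≤ singularValue n ∧
        singularValue n ≤ C₂ * ((n : ℝ) + 1) ^ (-(1 / 2) : ℝ) := by
  refine ⟨semicircleCLM, Idx.memLp_sphericalHarmonic, Idx.memLp_Z, fun f => ?_,
    orthonormal_sphericalHarmonic, span_sphericalHarmonic_dense, orthonormal_Z,
    fun i => ⟨semicircleCLM_sphericalHarmonic i, ?_, i.semicircle_eq⟩,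
    Real.sqrt (1 / 8), Real.sqrt (1 / 4), by positivity, by positivity, singularValue_bounds⟩
  · exact (ae_intervalIntegrable (Lp.memLp f)).and (semicircleCLM_coeFn f)
  · rw [semicircleCLM_toLp, i.norm_semicircle, singularValue_eq]
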